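/- Call an edge coloring of a graph $H$ (not necessarily proper) non-repetitive if no simple path in $H$ has a color sequence of the form $xx$ with $x$ a nonempty word. Theorem. There exists an absolute constant $c>0$ such that for every constant $\varepsilon>0$ and every constant exponent $k\in\mathbb{N}$ there exists a randomized (Monte Carlo) algorithm, flipping fair coins, with the following property. Given any finite simple graph $H$ with $n$ vertices and maximum degree $\Delta$ (by its adjacency matrix), the algorithm always halts within a number of steps bounded by a polynomial in $n$ (the polynomial may depend on $\varepsilon$ and $k$, but not on $H$), and with failure probability at most $n^{-k}$ it outputs a non-repetitive edge coloring of $H$ that uses at most $c\,\Delta^{2+\varepsilon}$ colors. (For $n=0$ nothing is claimed about the failure probability.) -/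

import Mathlib

/-! ### Non-repetitive edge colorings -/

/-- An edge coloring `f` of `G` (only its values on edges of `G` matter; it need not be proper) is
non-repetitive if no simple path of `G` has a color sequence of the form `x x` with `x` nonempty. -/
def IsNonrepetitive {V C : Type*} (G : SimpleGraph V) (f : Sym2 V → C) : Prop :=
  ∀ (u v : V) (p : G.Walk u v), p.IsPath → ∀ x : List C, p.edges.map f = x ++ x → x = []

/-! ### A randomized random-access machine

Programs are while-programs over natural-number variables and natural-number arrays (a random-access
memory), with fair coin flips as the source of randomness.  The arithmetic is addition and truncated
subtraction only.  Every elementary operation costs one step.  A number created within `t` steps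
has at most `t` bits more than the constants of the program and the input, so polynomially many
steps amount to polynomial time on a Turing machine. -/

namespace RandRAM

/-- The state of the machine: the values of the variables, the contents of the arrays
(array `a` holds `arr a i` at index `i`), and the number of coins flipped so far. -/
structure State where
  var : ℕ → ℕ
  arr : ℕ → ℕ → ℕ
  flips : ℕ

/-- Arithmetic expressions; `read a e` is the entry of array `a` at the index given by `e`. -/
inductive Expr where
  | const (k : ℕ)
  | var (x : ℕ)
  | read (a : ℕ) (e : Expr)
  | add (e₁ e₂ : Expr)
  | sub (e₁ e₂ : Expr)

/-- The value of an expression. -/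
def Expr.eval (s : State) : Expr → ℕ
  | .const k => k
  | .var x => s.var x
  | .read a e => s.arr a (e.eval s)
  | .add e₁ e₂ => e₁.eval s + e₂.eval s
  | .sub e₁ e₂ => e₁.eval s - e₂.eval s

/-- The number of steps needed to evaluate an expression. -/
def Expr.cost : Expr → ℕ
  | .const _ => 1
  | .var _ => 1
  | .read _ e => e.cost + 1
  | .add e₁ e₂ => e₁.cost + e₂.cost + 1
  | .sub e₁ e₂ => e₁.cost + e₂.cost + 1

/-- Programs. -/
inductive Cmd where
  /-- set variable `x` to the value of `e` -/
  | assign (x : ℕ) (e : Expr)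
  /-- set the entry of array `a` at index `i` to the value of `e` -/
  | write (a : ℕ) (i e : Expr)
  /-- flip a fair coin and put the outcome (0 or 1) into variable `x` -/
  | flip (x : ℕ)
  /-- run `c₁`, then `c₂` -/
  | seq (c₁ c₂ : Cmd)
  /-- run `c₁` if `e` is nonzero, and `c₂` otherwise -/
  | cond (e : Expr) (c₁ c₂ : Cmd)
  /-- run `c` as long as `e` is nonzero -/
  | loop (e : Expr) (c : Cmd)

/-- `Run ω c s t s'`: with `ω` as the sequence of coin outcomes, the program `c`, started in the
state `s`, halts after exactly `t` steps in the state `s'`. -/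
inductive Run (ω : ℕ → Bool) : Cmd → State → ℕ → State → Prop where
  | assign (x : ℕ) (e : Expr) (s : State) :
      Run ω (.assign x e) s (e.cost + 1)
        { s with var := Function.update s.var x (e.eval s) }
  | write (a : ℕ) (i e : Expr) (s : State) :
      Run ω (.write a i e) s (i.cost + e.cost + 1)
        { s with arr := Function.update s.arr a
                          (Function.update (s.arr a) (i.eval s) (e.eval s)) }
  | flip (x : ℕ) (s : State) :
      Run ω (.flip x) s 1
        { s with var := Function.update s.var x (ω s.flips).toNat, flips := s.flips + 1 }
  | seq {c₁ c₂ : Cmd} {s s' s'' : State} {t t' : ℕ} :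
      Run ω c₁ s t s' → Run ω c₂ s' t' s'' → Run ω (.seq c₁ c₂) s (t + t') s''
  | cond_true {e : Expr} {c₁ c₂ : Cmd} {s s' : State} {t : ℕ} :
      e.eval s ≠ 0 → Run ω c₁ s t s' → Run ω (.cond e c₁ c₂) s (e.cost + 1 + t) s'
  | cond_false {e : Expr} {c₁ c₂ : Cmd} {s s' : State} {t : ℕ} :
      e.eval s = 0 → Run ω c₂ s t s' → Run ω (.cond e c₁ c₂) s (e.cost + 1 + t) s'
  | loop_true {e : Expr} {c : Cmd} {s s' s'' : State} {t t' : ℕ} :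
      e.eval s ≠ 0 → Run ω c s t s' → Run ω (.loop e c) s' t' s'' →
        Run ω (.loop e c) s (e.cost + 1 + t + t') s''
  | loop_false {e : Expr} {c : Cmd} {s : State} :
      e.eval s = 0 → Run ω (.loop e c) s (e.cost + 1) s

/-- For given coin outcomes, the running time and the final state are determined. -/
theorem Run.deterministic {ω : ℕ → Bool} {c : Cmd} {s s₁ s₂ : State} {t₁ t₂ : ℕ}
    (h₁ : Run ω c s t₁ s₁) (h₂ : Run ω c s t₂ s₂) : t₁ = t₂ ∧ s₁ = s₂ := by
  induction h₁ generalizing t₂ s₂ with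
  | assign | write | flip => cases h₂; exact ⟨rfl, rfl⟩
  | seq _ _ ih ih' =>
    cases h₂ with
    | seq g g' =>
      obtain ⟨rfl, rfl⟩ := ih g
      obtain ⟨rfl, rfl⟩ := ih' g'
      exact ⟨rfl, rfl⟩
  | cond_true he _ ih =>
    cases h₂ with
    | cond_true _ g => obtain ⟨rfl, rfl⟩ := ih g; exact ⟨rfl, rfl⟩
    | cond_false he' _ => exact absurd he' he
  | cond_false he _ ih =>
    cases h₂ with
    | cond_true he' _ => exact absurd he he'
    | cond_false _ g => obtain ⟨rfl, rfl⟩ := ih g; exact ⟨rfl, rfl⟩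
  | loop_true he _ _ ih ih' =>
    cases h₂ with
    | loop_true _ g g' =>
      obtain ⟨rfl, rfl⟩ := ih g
      obtain ⟨rfl, rfl⟩ := ih' g'
      exact ⟨rfl, rfl⟩
    | loop_false he' => exact absurd he' he
  | loop_false he =>
    cases h₂ with
    | loop_true he' _ _ => exact absurd he he'
    | loop_false _ => exact ⟨rfl, rfl⟩

/-- The sequence of coin outcomes that starts with the string `r`. A run of at most `T` steps
flips at most `T` coins and so never sees the padding. -/
def coins {T : ℕ} (r : Fin T → Bool) : ℕ → Bool :=
  fun i => if h : i < T then r ⟨i, h⟩ else false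

open Classical in
/-- The initial state on the input `G`, a graph on `n` vertices: variable `0` holds `n`, array `0`
holds the adjacency matrix of `G` row by row, and everything else is zero. -/
noncomputable def inputState {n : ℕ} (G : SimpleGraph (Fin n)) : State where
  var := fun x => if x = 0 then n else 0
  arr := fun a k =>
    if a = 0 ∧ ∃ i j : Fin n, k = n * i.val + j.val ∧ G.Adj i j then 1 else 0
  flips := 0

/-- The edge coloring that is read off a final state: for `i < j`, the color of the edge
`{i, j}` is the entry of array `1` at index `n * i + j`. -/
def outputColoring (n : ℕ) (s : State) : Sym2 (Fin n) → ℕ :=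
  fun e => s.arr 1 (n * e.inf.val + e.sup.val)

/-- On the input `G`, the program `P` halts within `T` steps, whatever the coins show. -/
def HaltsWithin (P : Cmd) {n : ℕ} (G : SimpleGraph (Fin n)) (T : ℕ) : Prop :=
  ∀ ω : ℕ → Bool, ∃ (t : ℕ) (s : State), t ≤ T ∧ Run ω P (inputState G) t s

/-- The probability, over `T` independent fair coins, that the program `P` on the input `G` fails
to halt within `T` steps with an edge coloring that satisfies `Good`. -/
noncomputable def failureProb (P : Cmd) {n : ℕ} (G : SimpleGraph (Fin n)) (T : ℕ)
    (Good : (Sym2 (Fin n) → ℕ) → Prop) : ℝ :=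
  ({r : Fin T → Bool | ¬ ∃ (t : ℕ) (s : State), t ≤ T ∧
      Run (coins r) P (inputState G) t s ∧ Good (outputColoring n s)}.ncard : ℝ) / 2 ^ T

end RandRAM

/-! The method is entropy compression. Edges are colored one at a time with random colors from a
palette of `N = 2 ^ b`; if the newly colored edge `e` lies on one of two equally colored walks, the
walk through `e` is uncolored. The erased colors can be read off the other walk, which keeps its
colors, so a long unfinished run would compress its own coins too well.

To make the search polynomial, halves of a repetition are compared only up to length `R`, the least
positive exponent with `n ^ m ≤ D ^ R`, where `D` is about `Δ` and `m > 1 / ε`. Of longer halves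
only the first `R` edges are used, as two walks that need not be adjacent. Forgetting adjacency
costs a factor `n` in the number of pairs of length `R`; since `n ≤ D ^ (R / m)`, a palette of order
`D ^ (2 + 1 / m)` instead of `D ^ 2` pays for it (`palette_bounds`). Candidate pairs are coded by `n
* n * R * D ^ (2 * R)` numbers, polynomially many (`codes_le`), and all of them are tried.

The count is a potential argument instead of a reconstruction of the run: `sum_survivors_le` bounds
the unfinished color sequences of length `t`, summed over all colorings of a given domain. It rests
on `eraseMatched_injective` and on the weight bound `sum_pairsThrough_le`. With `N = 4 * y` at most
`4 ^ |E| * (2 * y) ^ t` of the `(4 * y) ^ t` sequences survive, so the failure probability is at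
most `4 ^ |E| / 2 ^ t`, and polynomially many rounds push it below `n ^ (-k)` (`failure_le`).
Correctness is separate: `no_clash_resolve` keeps partial colorings free of clashes, and
`isNonrepetitive_of_no_clash` concludes.

In the program every loop is bounded by a clock variable, for the main phase with value `(n + 2) ^
K`. Thus `exists_run` yields polynomial time whatever the coins show, `rep_rule` reduces
verification to loop invariants, and `den_coloringLoop` identifies the output with that of the
abstract process. -/

/-! ### Clocked programs -/

namespace RandRAM

/-- Change the value of one variable. -/
def State.setVar (s : State) (x v : ℕ) : State :=
  { s with var := Function.update s.var x v }

/-- Change one entry of an array. -/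
def State.setArr (s : State) (a i v : ℕ) : State :=
  { s with arr := Function.update s.arr a (Function.update (s.arr a) i v) }

@[simp] theorem State.setVar_var (s : State) (x v y : ℕ) :
    (s.setVar x v).var y = if y = x then v else s.var y := by
  simp [State.setVar, Function.update_apply]

@[simp] theorem State.setVar_arr (s : State) (x v : ℕ) : (s.setVar x v).arr = s.arr := rfl

@[simp] theorem State.setVar_flips (s : State) (x v : ℕ) : (s.setVar x v).flips = s.flips := rfl

@[simp] theorem State.setArr_var (s : State) (a i v : ℕ) : (s.setArr a i v).var = s.var := rfl

@[simp] theorem State.setArr_flips (s : State) (a i v : ℕ) :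
    (s.setArr a i v).flips = s.flips := rfl

@[simp] theorem State.setArr_arr (s : State) (a i v b j : ℕ) :
    (s.setArr a i v).arr b j = if b = a ∧ j = i then v else s.arr b j := by
  by_cases h : b = a
  · subst h; simp [State.setArr, Function.update_apply]
  · simp [State.setArr, h]

theorem State.setVar_self (s : State) (x : ℕ) : s.setVar x (s.var x) = s := by
  simp [State.setVar]

/-- Programs all of whose loops are clocked: `rep x e c` performs "if `e` is nonzero, run `c`" as
often as the value of the clock variable says, counting down in the variable `x`. -/
inductive Prog where
  | assign (x : ℕ) (e : Expr)
  | write (a : ℕ) (i e : Expr)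
  | flip (x : ℕ)
  | seq (c₁ c₂ : Prog)
  | cond (e : Expr) (c₁ c₂ : Prog)
  | rep (x : ℕ) (e : Expr) (c : Prog)

infixr:60 " ;; " => Prog.seq

/-- One round of a clocked loop whose body acts as `g`. -/
def State.round (x : ℕ) (e : Expr) (g : State → State) (s : State) : State :=
  let s' := if e.eval s ≠ 0 then g s else s
  s'.setVar x (s'.var x - 1)

theorem State.round_of_ne {x : ℕ} {e : Expr} {g : State → State} {s : State}
    (h : e.eval s ≠ 0) : s.round x e g = (g s).setVar x ((g s).var x - 1) := by
  simp only [State.round, if_pos h]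

theorem State.round_of_eq {x : ℕ} {e : Expr} {g : State → State} {s : State}
    (h : e.eval s = 0) : s.round x e g = s.setVar x (s.var x - 1) := by
  simp only [State.round, h, ne_eq, not_true_eq_false, if_false]

namespace Prog

/-- The translation of a clocked program with clock variable `k`. -/
def compile (k : ℕ) : Prog → Cmd
  | assign x e => .assign x e
  | write a i e => .write a i e
  | flip x => .flip x
  | seq c₁ c₂ => .seq (c₁.compile k) (c₂.compile k)
  | cond e c₁ c₂ => .cond e (c₁.compile k) (c₂.compile k)
  | rep x e c => .seq (.assign x (.var k)) (.loop (.var x)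
      (.seq (.cond e (c.compile k) (.assign x (.var x)))
        (.assign x (.sub (.var x) (.const 1)))))

/-- The final state of a clocked program. -/
def den (ω : ℕ → Bool) (k : ℕ) : Prog → State → State
  | assign x e, s => s.setVar x (e.eval s)
  | write a i e, s => s.setArr a (i.eval s) (e.eval s)
  | flip x, s => { s.setVar x (ω s.flips).toNat with flips := s.flips + 1 }
  | seq c₁ c₂, s => den ω k c₂ (den ω k c₁ s)
  | cond e c₁ c₂, s => if e.eval s ≠ 0 then den ω k c₁ s else den ω k c₂ s
  | rep x e c, s => (State.round x e (den ω k c))^[s.var k] (s.setVar x (s.var k))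

theorem den_assign (ω : ℕ → Bool) (k x : ℕ) (e : Expr) (s : State) :
    den ω k (.assign x e) s = s.setVar x (e.eval s) := rfl

theorem den_write (ω : ℕ → Bool) (k a : ℕ) (i e : Expr) (s : State) :
    den ω k (.write a i e) s = s.setArr a (i.eval s) (e.eval s) := rfl

theorem den_seq (ω : ℕ → Bool) (k : ℕ) (c₁ c₂ : Prog) (s : State) :
    den ω k (c₁ ;; c₂) s = den ω k c₂ (den ω k c₁ s) := rfl

theorem den_cond (ω : ℕ → Bool) (k : ℕ) (e : Expr) (c₁ c₂ : Prog) (s : State) :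
    den ω k (.cond e c₁ c₂) s = if e.eval s ≠ 0 then den ω k c₁ s else den ω k c₂ s := rfl

/-- The variables that a program may change. -/
def vars : Prog → List ℕ
  | assign x _ => [x]
  | write _ _ _ => []
  | flip x => [x]
  | seq c₁ c₂ => c₁.vars ++ c₂.vars
  | cond _ c₁ c₂ => c₁.vars ++ c₂.vars
  | rep x _ c => x :: c.vars

/-- The arrays that a program may change. -/
def arrs : Prog → List ℕ
  | assign _ _ => []
  | write a _ _ => [a]
  | flip _ => []
  | seq c₁ c₂ => c₁.arrs ++ c₂.arrs
  | cond _ c₁ c₂ => c₁.arrs ++ c₂.arrs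
  | rep _ _ c => c.arrs

/-- The program flips no coins. -/
def flipless : Prog → Bool
  | assign _ _ => true
  | write _ _ _ => true
  | flip _ => false
  | seq c₁ c₂ => c₁.flipless && c₂.flipless
  | cond _ c₁ c₂ => c₁.flipless && c₂.flipless
  | rep _ _ c => c.flipless

/-- No loop tampers with the variable that it counts with. -/
def wf : Prog → Bool
  | assign _ _ => true
  | write _ _ _ => true
  | flip _ => true
  | seq c₁ c₂ => c₁.wf && c₂.wf
  | cond _ c₁ c₂ => c₁.wf && c₂.wf
  | rep x _ c => c.wf && decide (x ∉ c.vars)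

/-- A bound on the running time, as a polynomial in the value of the clock. -/
noncomputable def cost : Prog → Polynomial ℕ
  | assign _ e => Polynomial.C (e.cost + 1)
  | write _ i e => Polynomial.C (i.cost + e.cost + 1)
  | flip _ => 1
  | seq c₁ c₂ => c₁.cost + c₂.cost
  | cond e c₁ c₂ => Polynomial.C (e.cost + 1) + c₁.cost + c₂.cost
  | rep _ e c => Polynomial.X * (c.cost + Polynomial.C (e.cost + 9)) + 4

variable {ω : ℕ → Bool} {k : ℕ}

/-- Frame rule: since `vars` is computable, later proofs carry facts across a whole subprogram by
`decide`. -/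
theorem den_var {c : Prog} {x : ℕ} (hx : x ∉ c.vars) (s : State) :
    (den ω k c s).var x = s.var x := by
  induction c generalizing s with
  | assign y e => simp_all [vars, den]
  | write => simp [den]
  | flip y =>
    simp only [vars, List.mem_singleton] at hx
    show (s.setVar y _).var x = _
    simp [hx]
  | seq c₁ c₂ h₁ h₂ =>
    simp only [vars, List.mem_append, not_or] at hx
    simp only [den]
    rw [h₂ hx.2, h₁ hx.1]
  | cond e c₁ c₂ h₁ h₂ =>
    simp only [vars, List.mem_append, not_or] at hx
    simp only [den]
    split_ifs
    · exact h₁ hx.1 s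
    · exact h₂ hx.2 s
  | rep y e c h =>
    simp only [vars, List.mem_cons, not_or] at hx
    simp only [den]
    generalize s.var k = v
    have key : ∀ (m : ℕ) (s' : State), ((State.round y e (den ω k c))^[m] s').var x = s'.var x := by
      intro m
      induction m with
      | zero => intro s'; rfl
      | succ m ih =>
        intro s'
        rw [Function.iterate_succ_apply, ih]
        by_cases he : e.eval s' = 0
        · simp [State.round_of_eq he, hx.1]
        · simp [State.round_of_ne he, hx.1, h hx.2 s']
    rw [key]
    simp [hx.1]

theorem den_arr {c : Prog} {a : ℕ} (ha : a ∉ c.arrs) (s : State) :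
    (den ω k c s).arr a = s.arr a := by
  induction c generalizing s with
  | assign y e => simp [den]
  | write b i e =>
    simp only [arrs, List.mem_singleton] at ha
    ext j
    simp [den, ha]
  | flip y => rfl
  | seq c₁ c₂ h₁ h₂ =>
    simp only [arrs, List.mem_append, not_or] at ha
    simp only [den]
    rw [h₂ ha.2, h₁ ha.1]
  | cond e c₁ c₂ h₁ h₂ =>
    simp only [arrs, List.mem_append, not_or] at ha
    simp only [den]
    split_ifs
    · exact h₁ ha.1 s
    · exact h₂ ha.2 s
  | rep y e c h =>
    simp only [arrs] at ha
    simp only [den]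
    have key : ∀ (m : ℕ) (s' : State), ((State.round y e (den ω k c))^[m] s').arr a = s'.arr a := by
      intro m
      induction m with
      | zero => intro s'; rfl
      | succ m ih =>
        intro s'
        rw [Function.iterate_succ_apply, ih]
        by_cases he : e.eval s' = 0
        · simp [State.round_of_eq he]
        · simp [State.round_of_ne he, h ha s']
    rw [key]
    rfl

theorem den_flips {c : Prog} (hc : c.flipless = true) (s : State) :
    (den ω k c s).flips = s.flips := by
  induction c generalizing s with
  | assign y e => rfl
  | write b i e => rfl
  | flip y => cases hc
  | seq c₁ c₂ h₁ h₂ =>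
    simp only [flipless, Bool.and_eq_true] at hc
    simp only [den]
    rw [h₂ hc.2, h₁ hc.1]
  | cond e c₁ c₂ h₁ h₂ =>
    simp only [flipless, Bool.and_eq_true] at hc
    simp only [den]
    split_ifs
    · exact h₁ hc.1 s
    · exact h₂ hc.2 s
  | rep y e c h =>
    simp only [flipless] at hc
    simp only [den]
    have key : ∀ (m : ℕ) (s' : State), ((State.round y e (den ω k c))^[m] s').flips = s'.flips := by
      intro m
      induction m with
      | zero => intro s'; rfl
      | succ m ih =>
        intro s'
        rw [Function.iterate_succ_apply, ih]
        by_cases he : e.eval s' = 0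
        · simp [State.round_of_eq he]
        · simp [State.round_of_ne he, h hc s']
    rw [key]
    rfl

/-- The parameters are computed without coins; hence they are the same for all coin sequences, and
failures can be counted with fixed `D`, `R` and `b`. -/
theorem den_eq_of_flipless {c : Prog} (hc : c.flipless = true) (ω' : ℕ → Bool) :
    den ω k c = den ω' k c := by
  induction c with
  | assign y e => rfl
  | write b i e => rfl
  | flip y => cases hc
  | seq c₁ c₂ h₁ h₂ =>
    simp only [flipless, Bool.and_eq_true] at hc
    ext1 s
    simp only [den, h₁ hc.1, h₂ hc.2]
  | cond e c₁ c₂ h₁ h₂ =>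
    simp only [flipless, Bool.and_eq_true] at hc
    ext1 s
    simp only [den, h₁ hc.1, h₂ hc.2]
  | rep y e c h =>
    simp only [flipless] at hc
    ext1 s
    simp only [den, h hc]

/-- A clocked program halts in its final state within its cost. -/
theorem exists_run {c : Prog} (hc : c.wf = true) (hk : k ∉ c.vars) (s : State) :
    ∃ t, t ≤ c.cost.eval (s.var k) ∧ Run ω (c.compile k) s t (den ω k c s) := by
  induction c generalizing s with
  | assign y e => exact ⟨_, by simp [cost], Run.assign y e s⟩
  | write b i e => exact ⟨_, by simp [cost], Run.write b i e s⟩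
  | flip y => exact ⟨_, by simp [cost], Run.flip y s⟩
  | seq c₁ c₂ h₁ h₂ =>
    simp only [wf, Bool.and_eq_true] at hc
    simp only [vars, List.mem_append, not_or] at hk
    obtain ⟨t₁, ht₁, r₁⟩ := h₁ hc.1 hk.1 s
    obtain ⟨t₂, ht₂, r₂⟩ := h₂ hc.2 hk.2 (den ω k c₁ s)
    rw [den_var hk.1] at ht₂
    exact ⟨_, by simpa [cost] using add_le_add ht₁ ht₂, Run.seq r₁ r₂⟩
  | cond e c₁ c₂ h₁ h₂ =>
    simp only [wf, Bool.and_eq_true] at hc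
    simp only [vars, List.mem_append, not_or] at hk
    obtain ⟨t₁, ht₁, r₁⟩ := h₁ hc.1 hk.1 s
    obtain ⟨t₂, ht₂, r₂⟩ := h₂ hc.2 hk.2 s
    by_cases he : e.eval s = 0
    · refine ⟨_, ?_, by simpa [den, compile, he] using Run.cond_false he r₂⟩
      simp only [cost, Polynomial.eval_add, Polynomial.eval_C]
      omega
    · refine ⟨_, ?_, by simpa [den, compile, he] using Run.cond_true he r₁⟩
      simp only [cost, Polynomial.eval_add, Polynomial.eval_C]
      omega
  | rep x e c h =>
    simp only [wf, Bool.and_eq_true, decide_eq_true_eq] at hc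
    simp only [vars, List.mem_cons, not_or] at hk
    set F : State → State := State.round x e (den ω k c) with hF
    set L : Cmd := .loop (.var x) (.seq (.cond e (c.compile k) (.assign x (.var x)))
        (.assign x (.sub (.var x) (.const 1)))) with hL
    -- A round costs 2 for the loop test, at most the cost of `c` plus `e.cost + 3` for the
    -- conditional, and 4 for the decrement.
    set A := c.cost.eval (s.var k) + e.cost + 9 with hA
    have hden : den ω k (rep x e c) s = F^[s.var k] (s.setVar x (s.var k)) := rfl
    have key : ∀ (v : ℕ) (s' : State), s'.var x = v → s'.var k = s.var k →
        ∃ t, t ≤ v * A + 2 ∧ Run ω L s' t (F^[v] s') := by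
      intro v
      induction v with
      | zero =>
        intro s' h0 _
        exact ⟨_, by simp [Expr.cost], Run.loop_false (by simpa [Expr.eval] using h0)⟩
      | succ v ih =>
        intro s' hv hks
        have hstep : ∃ t s₁, t ≤ c.cost.eval (s.var k) + e.cost + 3 ∧
            Run ω (.cond e (c.compile k) (.assign x (.var x))) s' t s₁ ∧
            F s' = s₁.setVar x (s₁.var x - 1) ∧ s₁.var x = v + 1 ∧ s₁.var k = s.var k := by
          by_cases he : e.eval s' = 0
          · refine ⟨e.cost + 1 + 2, s', by omega, Run.cond_false he ?_,
              State.round_of_eq he, hv, hks⟩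
            simpa [Expr.eval, Expr.cost] using Run.assign (ω := ω) x (.var x) s'
          · obtain ⟨t, ht, r⟩ := h hc.1 hk.2 s'
            rw [hks] at ht
            refine ⟨_, _, ?_, Run.cond_true he r, State.round_of_ne he, ?_, ?_⟩
            · omega
            · rw [den_var hc.2, hv]
            · rw [den_var hk.2, hks]
        obtain ⟨t₁, s₁, ht₁, r₁, hFs, hx', hk'⟩ := hstep
        have r₂ := Run.assign (ω := ω) x (.sub (.var x) (.const 1)) s₁
        obtain ⟨t₃, ht₃, r₃⟩ := ih (F s') (by simp [hFs, hx']) (by simp [hFs, hk.1, hk'])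
        rw [hFs] at r₃
        rw [Function.iterate_succ_apply, hFs]
        refine ⟨_, ?_, Run.loop_true (by simp [Expr.eval, hv]) (Run.seq r₁ r₂) r₃⟩
        simp only [Expr.cost]
        have : (v + 1) * A = v * A + A := by ring
        omega
    obtain ⟨t, ht, r⟩ := key (s.var k) (s.setVar x (s.var k)) (by simp) (by simp [hk.1])
    refine ⟨_, ?_, Run.seq (Run.assign x (.var k) s) r⟩
    simp only [cost, Polynomial.eval_add, Polynomial.eval_mul, Polynomial.eval_X,
      Polynomial.eval_C, Polynomial.eval_ofNat, Expr.cost]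
    rw [← add_assoc, ← hA]
    omega

/-- The rule for loops with `K` effective rounds and invariant `I`. -/
theorem rep_rule {x : ℕ} {e : Expr} {c : Prog} (I : ℕ → State → Prop) (s : State) (K : ℕ)
    (hK : K ≤ s.var k)
    (hx : ∀ j s' v, I j s' → I j (s'.setVar x v))
    (h0 : I 0 s)
    (hstep : ∀ j s', j < K → (∀ y, y ≠ x → y ∉ c.vars → s'.var y = s.var y) →
      (∀ a, a ∉ c.arrs → s'.arr a = s.arr a) → I j s' →
      e.eval s' ≠ 0 ∧ I (j + 1) (den ω k c s'))
    (hend : ∀ s', (∀ y, y ≠ x → y ∉ c.vars → s'.var y = s.var y) →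
      (∀ a, a ∉ c.arrs → s'.arr a = s.arr a) → I K s' → K = s.var k ∨ e.eval s' = 0) :
    I K (den ω k (rep x e c) s) := by
  set F : State → State := State.round x e (den ω k c) with hF
  have hden : den ω k (rep x e c) s = F^[s.var k] (s.setVar x (s.var k)) := rfl
  have hfv : ∀ m y, y ≠ x → y ∉ c.vars →
      (F^[m] (s.setVar x (s.var k))).var y = s.var y := by
    intro m y hy hyc
    induction m with
    | zero => simp [hy]
    | succ m ih =>
      rw [Function.iterate_succ_apply', ← ih]
      by_cases he : e.eval (F^[m] (s.setVar x (s.var k))) = 0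
      · rw [hF] at he ⊢
        simp [State.round_of_eq he, hy]
      · rw [hF] at he ⊢
        simp [State.round_of_ne he, hy, den_var hyc]
  have hfa : ∀ m a, a ∉ c.arrs → (F^[m] (s.setVar x (s.var k))).arr a = s.arr a := by
    intro m a ha
    induction m with
    | zero => rfl
    | succ m ih =>
      rw [Function.iterate_succ_apply', ← ih]
      by_cases he : e.eval (F^[m] (s.setVar x (s.var k))) = 0
      · rw [hF] at he ⊢
        simp [State.round_of_eq he]
      · rw [hF] at he ⊢
        simp [State.round_of_ne he, den_arr ha]
  have h1 : ∀ j ≤ K, I j (F^[j] (s.setVar x (s.var k))) := by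
    intro j hj
    induction j with
    | zero => exact hx _ _ _ h0
    | succ j ih =>
      rw [Function.iterate_succ_apply']
      obtain ⟨he, hI⟩ := hstep j _ (by omega) (hfv j) (hfa j) (ih (by omega))
      rw [show F (F^[j] (s.setVar x (s.var k))) = _ from State.round_of_ne he]
      exact hx _ _ _ hI
  -- From here on the guard is zero, and idle rounds alter only the counter, to which `I` is
  -- insensitive by `hx`.
  have h2 : ∀ i, K + i ≤ s.var k → I K (F^[K + i] (s.setVar x (s.var k))) := by
    intro i hi
    induction i with
    | zero => exact h1 K le_rfl
    | succ i ih =>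
      have hI := ih (by omega)
      rw [← add_assoc, Function.iterate_succ_apply']
      have he : e.eval (F^[K + i] (s.setVar x (s.var k))) = 0 := by
        rcases hend _ (hfv _) (hfa _) hI with h | h
        · omega
        · exact h
      rw [show F (F^[K + i] (s.setVar x (s.var k))) = _ from State.round_of_eq he]
      exact hx _ _ _ hI
  rw [hden]
  have := h2 (s.var k - K) (by omega)
  rwa [Nat.add_sub_cancel' hK] at this

end Prog

end RandRAM

/-! ### Entropy compression for matched erasures -/

namespace EntropyCompression

open Finset

variable {E : Type*} [Fintype E] [DecidableEq E]

/-- Partial colorings are functions to `ℕ`; the value `0` means "uncolored". -/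
def dom (F : E → ℕ) : Finset E := univ.filter fun e => F e ≠ 0

omit [DecidableEq E] in
@[simp] theorem mem_dom {F : E → ℕ} {e : E} : e ∈ dom F ↔ F e ≠ 0 := by simp [dom]

/-- Go through the list of pairs `(p, q)`; erase the color of `p` and check that `q` has the color
that has just been erased. -/
def eraseMatched : List (E × E) → (E → ℕ) → Option (E → ℕ)
  | [], F => some F
  | (p, q) :: l, F =>
    if F p ≠ 0 ∧ Function.update F p 0 q = F p then eraseMatched l (Function.update F p 0)
    else none

theorem dom_update_zero (F : E → ℕ) (p : E) : dom (Function.update F p 0) = (dom F).erase p := by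
  ext e
  by_cases h : e = p <;> simp [h]

theorem dom_update_ne_zero (F : E → ℕ) (p : E) {c : ℕ} (hc : c ≠ 0) :
    dom (Function.update F p c) = insert p (dom F) := by
  ext e
  by_cases h : e = p <;> simp [h, hc]

/-- Each pair uncolors an element that was still colored, so the domain shrinks by exactly
`l.length`; this is the exponent gained in the counting. -/
theorem dom_eraseMatched {l : List (E × E)} {F F' : E → ℕ} (h : eraseMatched l F = some F') :
    dom F' = dom F \ (l.map Prod.fst).toFinset ∧ (dom F').card + l.length = (dom F).card ∧
      (∀ e, F' e = 0 ∨ F' e = F e) := by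
  induction l generalizing F with
  | nil => simp only [eraseMatched, Option.some.injEq] at h; subst h; simp
  | cons pq l ih =>
    obtain ⟨p, q⟩ := pq
    simp only [eraseMatched] at h
    split_ifs at h with hc
    obtain ⟨h1, h2, h3⟩ := ih h
    rw [dom_update_zero] at h1 h2
    refine ⟨?_, ?_, ?_⟩
    · rw [h1]
      ext e
      simp only [mem_sdiff, mem_erase, List.map_cons, List.toFinset_cons, mem_insert]
      tauto
    · have := card_erase_add_one (mem_dom.2 hc.1)
      simp only [List.length_cons]
      omega
    · intro e
      rcases h3 e with h | h
      · exact Or.inl h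
      · by_cases hep : e = p
        · subst hep; left; simpa using h
        · right; simpa [hep] using h

-- The compression step. Decode from the end of the list: the check is made after the erasure of
-- `p`, so at that stage the color of `q` is still available and equals the color that `p` lost.
omit [Fintype E] in
theorem eraseMatched_injective {l : List (E × E)} {F₁ F₂ F' : E → ℕ}
    (h₁ : eraseMatched l F₁ = some F') (h₂ : eraseMatched l F₂ = some F') : F₁ = F₂ := by
  induction l generalizing F₁ F₂ with
  | nil => simp_all [eraseMatched]
  | cons pq l ih =>
    obtain ⟨p, q⟩ := pq
    simp only [eraseMatched] at h₁ h₂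
    split_ifs at h₁ h₂ with c₁ c₂
    have h := ih h₁ h₂
    ext e
    by_cases he : e = p
    · subst he; rw [← c₁.2, ← c₂.2, h]
    · have := congrFun h e
      simpa [he] using this

omit [Fintype E] in
/-- A matched list with distinct first entries, none of which is a second entry, can be erased. -/
theorem exists_eraseMatched {l : List (E × E)} {F : E → ℕ}
    (hF : ∀ pq ∈ l, F pq.1 ≠ 0 ∧ F pq.2 = F pq.1) (hl : (l.map Prod.fst).Nodup)
    (hd : ∀ pq ∈ l, ∀ pq' ∈ l, pq.1 ≠ pq'.2) : ∃ F', eraseMatched l F = some F' := by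
  induction l generalizing F with
  | nil => exact ⟨F, rfl⟩
  | cons pq l ih =>
    obtain ⟨p, q⟩ := pq
    simp only [List.map_cons, List.nodup_cons, List.mem_map, not_exists, not_and] at hl
    have h0 := hF (p, q) List.mem_cons_self
    have hpq : q ≠ p := (hd (p, q) List.mem_cons_self (p, q) List.mem_cons_self).symm
    simp only [eraseMatched]
    rw [if_pos ⟨h0.1, by simpa [hpq] using h0.2⟩]
    apply ih
    · intro x hx
      have h1 : x.1 ≠ p := hl.1 x hx
      have h2 : x.2 ≠ p :=
        (hd (p, q) List.mem_cons_self x (List.mem_cons_of_mem _ hx)).symm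
      simpa [h1, h2] using hF x (List.mem_cons_of_mem _ hx)
    · exact hl.2
    · intro x hx y hy
      exact hd x (List.mem_cons_of_mem _ hx) y (List.mem_cons_of_mem _ hy)

/-- The colorings with colors `1, …, N` of a given set. -/
def colorings (N : ℕ) (X : Finset E) : Finset (E → ℕ) :=
  Fintype.piFinset fun e => if e ∈ X then Icc 1 N else {0}

theorem mem_colorings {N : ℕ} {X : Finset E} {F : E → ℕ} :
    F ∈ colorings N X ↔ dom F = X ∧ ∀ e, F e ≤ N := by
  simp only [colorings, Fintype.mem_piFinset]
  constructor
  · intro h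
    refine ⟨?_, fun e => ?_⟩
    · ext e
      have := h e
      split_ifs at this with he
      · simp only [mem_Icc] at this
        simp only [mem_dom, he, iff_true]; omega
      · simp only [mem_singleton] at this
        simp [he, this]
    · have := h e
      split_ifs at this with he
      · exact (mem_Icc.1 this).2
      · simp only [mem_singleton] at this; omega
  · rintro ⟨rfl, h⟩ e
    split_ifs with he
    · have := h e; rw [mem_dom] at he; rw [mem_Icc]; omega
    · simpa using he

theorem card_colorings (N : ℕ) (X : Finset E) : (colorings N X).card = N ^ X.card := by
  rw [colorings, Fintype.card_piFinset]
  have : ∀ e : E, (if e ∈ X then Icc 1 N else {0}).card = if e ∈ X then N else 1 := by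
    intro e; split_ifs <;> simp
  simp [this, prod_ite_mem]

/-- The number of sequences of `t` colors with which the process that colors the element `nxt` and
then calls `res` does not come to an end within `t` rounds. -/
def survivors (nxt : Finset E → Option E) (res : E → (E → ℕ) → (E → ℕ)) (N : ℕ) :
    ℕ → (E → ℕ) → ℕ
  | 0, _ => 1
  | t + 1, F =>
    match nxt (dom F) with
    | none => 0
    | some e => ∑ c ∈ Icc 1 N, survivors nxt res N t (res e (Function.update F e c))

/-- Coloring `e` afresh maps colorings of `X` with a new color bijectively to colorings of `insert e
X`, so the randomness of a round is absorbed by the sum over a domain. -/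
theorem sum_colorings_insert (N : ℕ) {X : Finset E} {e : E} (he : e ∉ X) (g : (E → ℕ) → ℝ) :
    ∑ F ∈ colorings N X, ∑ c ∈ Icc 1 N, g (Function.update F e c) =
      ∑ F ∈ colorings N (insert e X), g F := by
  rw [← sum_product']
  refine sum_bij' (fun p _ => Function.update p.1 e p.2) (fun F _ => (Function.update F e 0, F e))
    ?_ ?_ ?_ ?_ ?_
  · rintro ⟨F, c⟩ h
    simp only [mem_product, mem_colorings, mem_Icc] at h ⊢
    refine ⟨by rw [dom_update_ne_zero _ _ (by omega), h.1.1], fun x => ?_⟩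
    by_cases hx : x = e
    · subst hx; simpa using h.2.2
    · simpa [hx] using h.1.2 x
  · intro F h
    simp only [mem_product, mem_colorings, mem_Icc] at h ⊢
    refine ⟨⟨?_, fun x => ?_⟩, ?_, h.2 e⟩
    · rw [dom_update_zero, h.1, erase_insert he]
    · by_cases hx : x = e
      · subst hx; simp
      · simpa [hx] using h.2 x
    · have : e ∈ dom F := by rw [h.1]; exact mem_insert_self _ _
      rw [mem_dom] at this; omega
  · rintro ⟨F, c⟩ h
    simp only [mem_product, mem_colorings] at h
    have : F e = 0 := by
      by_contra h0
      exact he (h.1.1 ▸ mem_dom.2 h0)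
    simp [← this]
  · intro F _; simp
  · intro p _; rfl

/-- Induction on `t` for all domains at once. Since `nxt` sees only the domain, all colorings in the
sum color the same `e`. The larger domain costs a factor `y`, an erasure along `l` gives back `y ^
l.length`, and by `hw` all cases together contribute at most `y * (1 + 1)`. The gap between `2 * y`
and `N = 4 * y` is the decay per round. -/
theorem sum_survivors_le {nxt : Finset E → Option E} {res : E → (E → ℕ) → (E → ℕ)}
    {Ev : E → Finset (List (E × E))} {Ed : Finset E} {N : ℕ} {y : ℝ} (hy : 1 ≤ y)
    (hN : (N : ℝ) = 4 * y)
    (hn : ∀ X e, nxt X = some e → e ∉ X ∧ e ∈ Ed)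
    (hr : ∀ e F, dom F ⊆ Ed → e ∈ dom F →
      res e F = F ∨ ∃ l ∈ Ev e, eraseMatched l F = some (res e F))
    (hw : ∀ e ∈ Ed, ∑ l ∈ Ev e, (y⁻¹) ^ l.length ≤ 1) (t : ℕ) {X : Finset E} (hX : X ⊆ Ed) :
    (∑ F ∈ colorings N X, (survivors nxt res N t F : ℝ)) ≤
      4 ^ Ed.card * (2 * y) ^ t * y ^ X.card := by
  induction t generalizing X with
  | zero =>
    simp only [survivors, Nat.cast_one, sum_const, card_colorings, nsmul_eq_mul, mul_one, pow_zero]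
    push_cast
    rw [hN, mul_pow]
    -- The prefactor `4 ^ Ed.card` is only needed here, to compare `N ^ X.card` with `y ^ X.card`.
    have : (4 : ℝ) ^ X.card ≤ 4 ^ Ed.card := pow_le_pow_right₀ (by norm_num) (card_le_card hX)
    gcongr
  | succ t ih =>
    rcases hne : nxt X with _ | e
    · have : ∀ F ∈ colorings N X, (survivors nxt res N (t + 1) F : ℝ) = 0 := by
        intro F hF
        rw [mem_colorings] at hF
        simp [survivors, hF.1, hne]
      rw [sum_eq_zero this]
      positivity
    obtain ⟨heX, heE⟩ := hn X e hne
    have hX' : insert e X ⊆ Ed := insert_subset heE hX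
    set u : (E → ℕ) → ℝ := fun F => (survivors nxt res N t F : ℝ) with hu
    have hu0 : ∀ F, 0 ≤ u F := fun F => Nat.cast_nonneg _
    have h1 : ∑ F ∈ colorings N X, (survivors nxt res N (t + 1) F : ℝ) =
        ∑ F ∈ colorings N (insert e X), u (res e F) := by
      rw [← sum_colorings_insert N heX (fun F => u (res e F))]
      refine sum_congr rfl fun F hF => ?_
      rw [mem_colorings] at hF
      simp [survivors, hF.1, hne, hu]
    -- Union bound over what `res` may have done; lists whose erasure fails count as zero.
    have h2 : ∀ F ∈ colorings N (insert e X), u (res e F) ≤ u F +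
        ∑ l ∈ Ev e, ((eraseMatched l F).map u).getD 0 := by
      intro F hF
      rw [mem_colorings] at hF
      have hnn : ∀ l ∈ Ev e, 0 ≤ ((eraseMatched l F).map u).getD 0 := by
        intro l _
        rcases eraseMatched l F with _ | F'
        · simp
        · simpa using hu0 F'
      rcases hr e F (hF.1 ▸ hX') (hF.1 ▸ mem_insert_self _ _) with h | ⟨l, hl, h⟩
      · rw [h]
        exact le_add_of_nonneg_right (sum_nonneg hnn)
      · refine le_trans ?_ (le_add_of_nonneg_left (hu0 F))
        refine le_trans ?_ (single_le_sum hnn hl)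
        simp [h]
    have h3 : ∀ l ∈ Ev e, ∑ F ∈ colorings N (insert e X), ((eraseMatched l F).map u).getD 0 ≤
        4 ^ Ed.card * (2 * y) ^ t * (y ^ (X.card + 1) * (y⁻¹) ^ l.length) := by
      intro l _
      set S := (colorings N (insert e X)).filter fun F => (eraseMatched l F).isSome with hS
      have hSsum : ∑ F ∈ colorings N (insert e X), ((eraseMatched l F).map u).getD 0 =
          ∑ F ∈ S, ((eraseMatched l F).map u).getD 0 := by
        rw [hS, sum_filter]
        refine sum_congr rfl fun F _ => ?_
        split_ifs with h
        · rfl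
        · simp only [Bool.not_eq_true, Option.isSome_eq_false_iff, Option.isNone_iff_eq_none] at h
          simp [h]
      rw [hSsum]
      rcases S.eq_empty_or_nonempty with hS0 | ⟨F₀, hF₀⟩
      · rw [hS0]; simp only [sum_empty]; positivity
      have hval : ∀ F ∈ S, ∃ F', eraseMatched l F = some F' := by
        intro F hF
        exact Option.isSome_iff_exists.1 (mem_filter.1 hF).2
      set Y := insert e X \ (l.map Prod.fst).toFinset with hY
      have hYE : Y ⊆ Ed := sdiff_subset.trans hX'
      have hmem : ∀ F ∈ S, (eraseMatched l F).getD F ∈ colorings N Y := by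
        intro F hF
        obtain ⟨F', hF'⟩ := hval F hF
        have hFc := mem_colorings.1 (mem_filter.1 hF).1
        obtain ⟨d1, -, d3⟩ := dom_eraseMatched hF'
        rw [hF', Option.getD_some, mem_colorings]
        refine ⟨by rw [d1, hFc.1], fun x => ?_⟩
        rcases d3 x with h | h
        · omega
        · rw [h]; exact hFc.2 x
      -- For fixed `l`, erasing is injective into the colorings of `Y`, so no survivor is counted
      -- twice.
      have hle : ∑ F ∈ S, ((eraseMatched l F).map u).getD 0 ≤ ∑ F ∈ colorings N Y, u F := by
        have hinj : Set.InjOn (fun F => (eraseMatched l F).getD F) S := by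
          intro F₁ h₁ F₂ h₂ h
          obtain ⟨F₁', e₁⟩ := hval F₁ h₁
          obtain ⟨F₂', e₂⟩ := hval F₂ h₂
          simp only [e₁, e₂, Option.getD_some] at h
          subst h
          exact eraseMatched_injective e₁ e₂
        calc ∑ F ∈ S, ((eraseMatched l F).map u).getD 0
            = ∑ F ∈ S, u ((eraseMatched l F).getD F) := by
              refine sum_congr rfl fun F hF => ?_
              obtain ⟨F', hF'⟩ := hval F hF
              simp [hF']
          _ = ∑ F' ∈ S.image (fun F => (eraseMatched l F).getD F), u F' :=
              (sum_image hinj).symm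
          _ ≤ _ := sum_le_sum_of_subset_of_nonneg
              (image_subset_iff.2 hmem) fun F _ _ => hu0 F
      refine hle.trans ((ih hYE).trans (le_of_eq ?_))
      obtain ⟨F₀', hF₀'⟩ := hval F₀ hF₀
      have hFc := mem_colorings.1 (mem_filter.1 hF₀).1
      obtain ⟨d1, d2, -⟩ := dom_eraseMatched hF₀'
      rw [d1, hFc.1, ← hY, card_insert_of_notMem heX] at d2
      rw [← d2, pow_add, mul_assoc (y ^ Y.card), ← mul_pow, mul_inv_cancel₀ (by positivity),
        one_pow, mul_one]
    have hy0 : 0 < y := by linarith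
    rw [h1]
    calc ∑ F ∈ colorings N (insert e X), u (res e F)
        ≤ ∑ F ∈ colorings N (insert e X), (u F +
            ∑ l ∈ Ev e, ((eraseMatched l F).map u).getD 0) := sum_le_sum h2
      _ = ∑ F ∈ colorings N (insert e X), u F +
            ∑ l ∈ Ev e, ∑ F ∈ colorings N (insert e X), ((eraseMatched l F).map u).getD 0 := by
          rw [sum_add_distrib, sum_comm]
      _ ≤ 4 ^ Ed.card * (2 * y) ^ t * y ^ (X.card + 1) +
            ∑ l ∈ Ev e, 4 ^ Ed.card * (2 * y) ^ t * (y ^ (X.card + 1) * (y⁻¹) ^ l.length) := by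
          refine add_le_add ?_ (sum_le_sum h3)
          have := ih hX'
          rwa [card_insert_of_notMem heX] at this
      _ = 4 ^ Ed.card * (2 * y) ^ t * y ^ (X.card + 1) *
            (1 + ∑ l ∈ Ev e, (y⁻¹) ^ l.length) := by
          rw [mul_add, mul_one, mul_sum]
          congr 1
          exact sum_congr rfl fun l _ => by ring
      _ ≤ 4 ^ Ed.card * (2 * y) ^ t * y ^ (X.card + 1) * (1 + 1) := by
          have := hw e heE
          gcongr
      _ = _ := by ring

end EntropyCompression

/-! ### Random colors from coins, and the coin-driven process -/

namespace EntropyCompression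

open Finset

/-- The number whose binary digits are the first `b` coins. -/
def bitsValue (ω : ℕ → Bool) : ℕ → ℕ
  | 0 => 0
  | b + 1 => 2 * bitsValue ω b + (ω b).toNat

theorem bitsValue_lt (ω : ℕ → Bool) (b : ℕ) : bitsValue ω b < 2 ^ b := by
  induction b with
  | zero => simp [bitsValue]
  | succ b ih =>
    have := Bool.toNat_le (ω b)
    simp only [bitsValue, pow_succ]
    omega

theorem bitsValue_congr {ω ω' : ℕ → Bool} {b : ℕ} (h : ∀ i < b, ω i = ω' i) :
    bitsValue ω b = bitsValue ω' b := by
  induction b with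
  | zero => rfl
  | succ b ih =>
    simp only [bitsValue]
    rw [ih fun i hi => h i (by omega), h b (by omega)]

theorem eq_of_bitsValue_eq {ω ω' : ℕ → Bool} {b : ℕ} (h : bitsValue ω b = bitsValue ω' b) :
    ∀ i < b, ω i = ω' i := by
  induction b with
  | zero => intro i hi; omega
  | succ b ih =>
    simp only [bitsValue] at h
    have h1 := Bool.toNat_le (ω b)
    have h2 := Bool.toNat_le (ω' b)
    have h3 : (ω b).toNat = (ω' b).toNat := by omega
    intro i hi
    rcases Nat.lt_succ_iff_lt_or_eq.1 hi with h' | rfl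
    · exact ih (by omega) i h'
    · revert h3; cases ω i <;> cases ω' i <;> simp

open RandRAM in
theorem coins_apply {T : ℕ} (r : Fin T → Bool) (i : Fin T) : coins r i = r i := by
  simp [coins]

-- By uniqueness of binary expansions each color comes from exactly one string of `b` coins; this is
-- why the palette is a power of two.
open RandRAM in
theorem sum_bitsValue_coins (b : ℕ) (g : ℕ → ℕ) :
    ∑ r : Fin b → Bool, g (bitsValue (coins r) b + 1) = ∑ c ∈ Icc 1 (2 ^ b), g c := by
  have hinj : Function.Injective
      (fun r : Fin b → Bool => (⟨bitsValue (coins r) b, bitsValue_lt _ _⟩ : Fin (2 ^ b))) := by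
    intro r r' h
    ext1 i
    have := eq_of_bitsValue_eq (Fin.mk.inj h) i i.2
    rwa [coins_apply, coins_apply] at this
  have hbij := (Fintype.bijective_iff_injective_and_card _).2 ⟨hinj, by simp⟩
  rw [hbij.sum_comp (fun x : Fin (2 ^ b) => g (x + 1)), Fin.sum_univ_eq_sum_range
    (fun x => g (x + 1)), range_eq_Ico, Finset.sum_Ico_add' g 0 (2 ^ b) 1]
  rfl

variable {E : Type*} [Fintype E] [DecidableEq E]

/-- The process driven by coins: `b` coins for each color. -/
def process (nxt : Finset E → Option E) (res : E → (E → ℕ) → (E → ℕ)) (b : ℕ) :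
    ℕ → (ℕ → Bool) → (E → ℕ) → (E → ℕ)
  | 0, _, F => F
  | t + 1, ω, F =>
    match nxt (dom F) with
    | none => F
    | some e => process nxt res b t (fun i => ω (b + i))
        (res e (Function.update F e (bitsValue ω b + 1)))

-- Induction on the rounds, splitting off the first `b` coins. The `s` surplus coins are never read
-- and only multiply the count.
open Classical RandRAM in
theorem card_process_unfinished (nxt : Finset E → Option E) (res : E → (E → ℕ) → (E → ℕ))
    (b t s L : ℕ) (hL : L = b * t + s) (F : E → ℕ) :
    (univ.filter fun r : Fin L → Bool => nxt (dom (process nxt res b t (coins r) F)) ≠ none).card ≤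
      survivors nxt res (2 ^ b) t F * 2 ^ s := by
  induction t generalizing F L with
  | zero =>
    refine (card_le_univ _).trans ?_
    simp [survivors, hL]
  | succ t ih =>
    rcases hne : nxt (dom F) with _ | e
    · simp [process, hne]
    obtain ⟨L', rfl⟩ : ∃ L', L = b + L' := ⟨b * t + s, by rw [hL]; ring⟩
    have hL' : L' = b * t + s := by
      have : b * (t + 1) = b * t + b := by ring
      omega
    have h1 : ∀ (r₁ : Fin b → Bool) (r₂ : Fin L' → Bool),
        process nxt res b (t + 1) (coins (Fin.append r₁ r₂)) F =
          process nxt res b t (coins r₂)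
            (res e (Function.update F e (bitsValue (coins r₁) b + 1))) := by
      intro r₁ r₂
      have e1 : bitsValue (coins (Fin.append r₁ r₂)) b = bitsValue (coins r₁) b := by
        refine bitsValue_congr fun i hi => ?_
        have h := coins_apply (Fin.append r₁ r₂) (Fin.castAdd L' ⟨i, hi⟩)
        rw [Fin.append_left] at h
        have h' := coins_apply r₁ ⟨i, hi⟩
        simp only [Fin.val_castAdd] at h
        rw [h, h']
      have e2 : (fun i => coins (Fin.append r₁ r₂) (b + i)) = coins r₂ := by
        ext1 i
        by_cases hi : i < L'
        · have h := coins_apply (Fin.append r₁ r₂) (Fin.natAdd b ⟨i, hi⟩)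
          rw [Fin.append_right] at h
          have h' := coins_apply r₂ ⟨i, hi⟩
          simp only [Fin.val_natAdd] at h
          rw [h, h']
        · simp [coins, hi]
      simp only [process, hne, e1, e2]
    rw [← Fintype.card_subtype, ← Fintype.card_congr ((Fin.appendEquiv b L').subtypeEquiv
      (p := fun r => nxt (dom (process nxt res b t (coins r.2)
            (res e (Function.update F e (bitsValue (coins r.1) b + 1))))) ≠ none)
      (fun r => by rw [← h1]; rfl)), Fintype.card_subtype]
    have h2 : (univ.filter fun r : (Fin b → Bool) × (Fin L' → Bool) =>
        nxt (dom (process nxt res b t (coins r.2)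
            (res e (Function.update F e (bitsValue (coins r.1) b + 1))))) ≠ none).card =
        ∑ r₁ : Fin b → Bool, (univ.filter fun r₂ : Fin L' → Bool =>
          nxt (dom (process nxt res b t (coins r₂)
            (res e (Function.update F e (bitsValue (coins r₁) b + 1))))) ≠ none).card := by
      simp only [card_filter]
      rw [← univ_product_univ, sum_product]
    rw [h2]
    simp only [survivors, hne]
    rw [← sum_bitsValue_coins b (fun c => survivors nxt res (2 ^ b) t
      (res e (Function.update F e c))), sum_mul]
    exact sum_le_sum fun r₁ _ => ih L' hL' _

/-- Properties of partial colorings that are kept in each round hold at the end. -/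
theorem process_induction {nxt : Finset E → Option E} {res : E → (E → ℕ) → (E → ℕ)} {b : ℕ}
    (I : (E → ℕ) → Prop)
    (hI : ∀ F e c, I F → nxt (dom F) = some e → c ∈ Icc 1 (2 ^ b) →
      I (res e (Function.update F e c))) (t : ℕ) (ω : ℕ → Bool) {F : E → ℕ} (hF : I F) :
    I (process nxt res b t ω F) := by
  induction t generalizing F ω with
  | zero => exact hF
  | succ t ih =>
    rcases hne : nxt (dom F) with _ | e
    · simpa [process, hne] using hF
    · simp only [process, hne]
      exact ih _ (hI F e _ hF hne (mem_Icc.2 ⟨by omega, bitsValue_lt _ _⟩))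

end EntropyCompression

/-! ### Pairs of equally colored walks -/

namespace EntropyCompression

open Finset

section Walks

variable {V : Type*} [Fintype V] [DecidableEq V] (G : SimpleGraph V) [DecidableRel G.Adj]

/-- The vertex lists of the walks of a given length from a given vertex. -/
def walksFrom : ℕ → V → Finset (List V)
  | 0, v => {[v]}
  | l + 1, v => (G.neighborFinset v).biUnion fun u => (walksFrom l u).image (v :: ·)

/-- The vertex lists of the walks of length `l + 1` whose `j`-th step goes from `a` to `b`. -/
def walksThrough (a b : V) : ℕ → ℕ → Finset (List V)
  | 0, l => (walksFrom G l b).image (a :: ·)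
  | _ + 1, 0 => ∅
  | j + 1, l + 1 =>
    (walksThrough a b j l).biUnion fun w => (G.neighborFinset (w.headD a)).image (· :: w)

theorem card_walksFrom_le (l : ℕ) (v : V) : (walksFrom G l v).card ≤ G.maxDegree ^ l := by
  induction l generalizing v with
  | zero => simp [walksFrom]
  | succ l ih =>
    rw [walksFrom, pow_succ']
    refine card_biUnion_le_card_mul _ _ _ (fun u _ => card_image_le.trans (ih u)) |>.trans ?_
    rw [SimpleGraph.card_neighborFinset_eq_degree]
    exact Nat.mul_le_mul_right _ (G.degree_le_maxDegree v)

/-- The prescribed step is free: only the other `l` steps, backwards before it and forwards after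
it, involve a choice. -/
theorem card_walksThrough_le (a b : V) (j l : ℕ) :
    (walksThrough G a b j l).card ≤ G.maxDegree ^ l := by
  induction j generalizing l with
  | zero => exact card_image_le.trans (card_walksFrom_le G l b)
  | succ j ih =>
    cases l with
    | zero => simp [walksThrough]
    | succ l =>
      rw [walksThrough, pow_succ]
      refine card_biUnion_le_card_mul _ _ G.maxDegree (fun w _ => card_image_le.trans ?_) |>.trans
        (Nat.mul_le_mul_right _ (ih l))
      rw [SimpleGraph.card_neighborFinset_eq_degree]
      exact G.degree_le_maxDegree _

theorem mem_walksFrom {l : ℕ} {P : ℕ → V} (hP : ∀ i < l, G.Adj (P i) (P (i + 1))) :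
    (List.range (l + 1)).map P ∈ walksFrom G l (P 0) := by
  induction l generalizing P with
  | zero => simp [walksFrom]
  | succ l ih =>
    rw [walksFrom, mem_biUnion]
    refine ⟨P 1, by simpa using hP 0 (by omega), ?_⟩
    rw [mem_image]
    refine ⟨_, ih (P := fun i => P (i + 1)) fun i hi => hP (i + 1) (by omega), ?_⟩
    rw [List.range_succ_eq_map (n := l + 1)]
    simp [Function.comp_def]

theorem mem_walksThrough {l j : ℕ} {P : ℕ → V} (hP : ∀ i < l + 1, G.Adj (P i) (P (i + 1)))
    (hj : j < l + 1) :
    (List.range (l + 2)).map P ∈ walksThrough G (P j) (P (j + 1)) j l := by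
  induction j generalizing l P with
  | zero =>
    rw [walksThrough, mem_image]
    refine ⟨_, mem_walksFrom G (P := fun i => P (i + 1)) fun i hi => hP (i + 1) (by omega), ?_⟩
    rw [List.range_succ_eq_map (n := l + 1)]
    simp [Function.comp_def]
  | succ j ih =>
    cases l with
    | zero => omega
    | succ l =>
      rw [walksThrough, mem_biUnion]
      refine ⟨_, ih (P := fun i => P (i + 1)) (fun i hi => hP (i + 1) (by omega)) (by omega), ?_⟩
      rw [mem_image]
      refine ⟨P 0, ?_, ?_⟩
      · rw [SimpleGraph.mem_neighborFinset, List.range_succ_eq_map]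
        simpa using (hP 0 (by omega)).symm
      · rw [List.range_succ_eq_map (n := l + 1 + 1)]
        simp [Function.comp_def]

/-- The pairs of corresponding edges of two walks. -/
def walkPairs (P Q : ℕ → V) (r : ℕ) : List (Sym2 V × Sym2 V) :=
  (List.range r).map fun i => (s(P i, P (i + 1)), s(Q i, Q (i + 1)))

omit [Fintype V] [DecidableEq V] in
theorem walkPairs_congr {P Q P' Q' : ℕ → V} {r : ℕ} (hP : ∀ i ≤ r, P i = P' i)
    (hQ : ∀ i ≤ r, Q i = Q' i) : walkPairs P Q r = walkPairs P' Q' r := by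
  refine List.map_congr_left fun i hi => ?_
  rw [List.mem_range] at hi
  rw [hP i (by omega), hP (i + 1) (by omega), hQ i (by omega), hQ (i + 1) (by omega)]

/-- Two walks of length `r`, which have to be consecutive (in either order) if `r < R`. -/
structure IsWalkPair (R : ℕ) (P Q : ℕ → V) (r : ℕ) : Prop where
  pos : 1 ≤ r
  le : r ≤ R
  left : ∀ i < r, G.Adj (P i) (P (i + 1))
  right : ∀ i < r, G.Adj (Q i) (Q (i + 1))
  joined : r = R ∨ P r = Q 0 ∨ Q r = P 0

/-- The two orientations of an edge. -/
noncomputable def orientations (e : Sym2 V) : Finset (V × V) :=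
  {(e.out.1, e.out.2), (e.out.2, e.out.1)}

/-- The edge pairs of the pairs of walks of length `r` the first of which uses the edge `e` (and
possibly some more). -/
noncomputable def pairsThrough (R : ℕ) (e : Sym2 V) (r : ℕ) : Finset (List (Sym2 V × Sym2 V)) :=
  if r = R then
    (range r ×ˢ orientations e).biUnion fun x =>
      (walksThrough G x.2.1 x.2.2 x.1 (r - 1) ×ˢ univ.biUnion (walksFrom G r)).image fun w =>
        walkPairs (w.1.getD · e.out.1) (w.2.getD · e.out.1) r
  else
    (range (2 * r) ×ˢ orientations e).biUnion fun x =>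
      (walksThrough G x.2.1 x.2.2 x.1 (2 * r - 1)).biUnion fun w =>
        {walkPairs (w.getD · e.out.1) (fun i => w.getD (r + i) e.out.1) r,
          walkPairs (fun i => w.getD (r + i) e.out.1) (w.getD · e.out.1) r}

theorem length_of_mem_pairsThrough {R : ℕ} {e : Sym2 V} {r : ℕ} {l : List (Sym2 V × Sym2 V)}
    (h : l ∈ pairsThrough G R e r) : l.length = r := by
  rw [pairsThrough] at h
  split_ifs at h
  · simp only [mem_biUnion, mem_image] at h
    obtain ⟨_, _, _, _, rfl⟩ := h
    simp [walkPairs]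
  · simp only [mem_biUnion, mem_insert, mem_singleton] at h
    obtain ⟨_, _, _, _, rfl | rfl⟩ := h <;> simp [walkPairs]

/-- Position and orientation of `e` give `R * 2`; the second walk may start anywhere, hence the
factor `Fintype.card V`. -/
theorem card_pairsThrough_top (R : ℕ) (e : Sym2 V) :
    (pairsThrough G R e R).card ≤
      R * 2 * (G.maxDegree ^ (R - 1) * (Fintype.card V * G.maxDegree ^ R)) := by
  rw [pairsThrough, if_pos rfl]
  refine (card_biUnion_le_card_mul _ _ _ fun x _ => card_image_le.trans ?_).trans
    (Nat.mul_le_mul_right _ ?_)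
  · rw [card_product]
    exact Nat.mul_le_mul (card_walksThrough_le G _ _ _ _)
      (card_biUnion_le_card_mul _ _ _ fun v _ => card_walksFrom_le G R v)
  · rw [card_product, card_range]
    exact Nat.mul_le_mul_left _ card_le_two

/-- Consecutive walks form a single walk of length `2 * r`, so no factor `Fintype.card V` appears;
the last 2 is the order of the halves. -/
theorem card_pairsThrough {R r : ℕ} (h : r ≠ R) (e : Sym2 V) :
    (pairsThrough G R e r).card ≤ 2 * r * 2 * (G.maxDegree ^ (2 * r - 1) * 2) := by
  rw [pairsThrough, if_neg h]
  refine (card_biUnion_le_card_mul _ _ _ fun x _ => ?_).trans (Nat.mul_le_mul_right _ ?_)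
  · exact (card_biUnion_le_card_mul _ _ _ fun w _ => card_le_two).trans
      (Nat.mul_le_mul_right _ (card_walksThrough_le G _ _ _ _))
  · rw [card_product, card_range]
    exact Nat.mul_le_mul_left _ card_le_two

omit [Fintype V] in
theorem mem_orientations {e : Sym2 V} {a b : V} (h : s(a, b) = e) :
    (a, b) ∈ orientations e := by
  have h' : s(e.out.1, e.out.2) = e := Quot.out_eq e
  rw [← h, Sym2.eq_iff] at h'
  simp only [orientations, mem_insert, mem_singleton, Prod.mk.injEq]
  rw [← h]
  tauto

omit [Fintype V] [DecidableEq V] in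
theorem getD_map_range {P : ℕ → V} {m i : ℕ} (h : i < m) (d : V) :
    ((List.range m).map P).getD i d = P i := by
  simp [List.getD_eq_getElem?_getD, h]

theorem mem_pairsThrough {R r : ℕ} {P Q : ℕ → V} (h : IsWalkPair G R P Q r) {e : Sym2 V} {j : ℕ}
    (hj : j < r) (he : s(P j, P (j + 1)) = e) : walkPairs P Q r ∈ pairsThrough G R e r := by
  have hr := h.pos
  rw [pairsThrough]
  split_ifs with hR
  · simp only [mem_biUnion, mem_image, mem_product, Prod.exists]
    refine ⟨j, P j, P (j + 1), ⟨mem_range.2 hj, mem_orientations he⟩, (List.range (r + 1)).map P,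
      (List.range (r + 1)).map Q, ⟨?_, Q 0, mem_univ _, mem_walksFrom G h.right⟩, ?_⟩
    · have := mem_walksThrough G (l := r - 1) (j := j) (P := P)
        (fun i hi => h.left i (by omega)) (by omega)
      rwa [show r - 1 + 2 = r + 1 by omega] at this
    · exact walkPairs_congr (fun i hi => getD_map_range (by omega) _)
        (fun i hi => getD_map_range (by omega) _)
  · have hjoin := h.joined.resolve_left hR
    simp only [mem_biUnion, mem_insert, mem_singleton, mem_product, Prod.exists]
    -- Glue consecutive walks into one; at index `r` the two definitions agree because `P r = Q 0`.
    -- If `Q` comes first, step `j` of `P` has number `r + j`.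
    have key : ∀ (P Q : ℕ → V), (∀ i < r, G.Adj (P i) (P (i + 1))) →
        (∀ i < r, G.Adj (Q i) (Q (i + 1))) → P r = Q 0 → ∃ W : ℕ → V,
        (∀ i ≤ r, W i = P i) ∧ (∀ i ≤ r, W (r + i) = Q i) ∧
        (∀ i < 2 * r - 1 + 1, G.Adj (W i) (W (i + 1))) := by
      intro P Q hP hQ hPQ
      refine ⟨fun i => if i < r then P i else Q (i - r), ?_, ?_, ?_⟩
      · intro i hi
        rcases hi.lt_or_eq with h | rfl
        · simp [h]
        · simp [hPQ]
      · intro i _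
        simp
      · intro i hi
        dsimp only
        rcases Nat.lt_trichotomy (i + 1) r with h | h | h
        · rw [if_pos (by omega), if_pos h]; exact hP i (by omega)
        · rw [if_pos (by omega), if_neg (by omega), h, Nat.sub_self, ← hPQ, ← h]
          exact hP i (by omega)
        · rw [if_neg (by omega), if_neg (by omega), show i + 1 - r = i - r + 1 by omega]
          exact hQ (i - r) (by omega)
    rcases hjoin with h1 | h1
    · obtain ⟨W, hW1, hW2, hW3⟩ := key P Q h.left h.right h1
      refine ⟨j, P j, P (j + 1), ⟨mem_range.2 (by omega), mem_orientations he⟩,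
        (List.range (2 * r + 1)).map W, ?_, Or.inl ?_⟩
      · have := mem_walksThrough G (l := 2 * r - 1) (j := j) (P := W) hW3 (by omega)
        rwa [show 2 * r - 1 + 2 = 2 * r + 1 by omega, hW1 j (by omega),
          hW1 (j + 1) (by omega)] at this
      · refine walkPairs_congr (fun i hi => ?_) (fun i hi => ?_)
        · rw [getD_map_range (by omega), hW1 i hi]
        · rw [getD_map_range (by omega), hW2 i hi]
    · obtain ⟨W, hW1, hW2, hW3⟩ := key Q P h.right h.left h1
      refine ⟨r + j, P j, P (j + 1), ⟨mem_range.2 (by omega), mem_orientations he⟩,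
        (List.range (2 * r + 1)).map W, ?_, Or.inr ?_⟩
      · have := mem_walksThrough G (l := 2 * r - 1) (j := r + j) (P := W) hW3 (by omega)
        rwa [show 2 * r - 1 + 2 = 2 * r + 1 by omega, hW2 j (by omega), add_assoc,
          hW2 (j + 1) (by omega)] at this
      · refine walkPairs_congr (fun i hi => ?_) (fun i hi => ?_)
        · rw [getD_map_range (by omega), hW2 i hi]
        · rw [getD_map_range (by omega), hW1 i hi]

theorem sum_geometric_half_le (R : ℕ) : ∑ r ∈ Icc 1 R, ((2 : ℝ)⁻¹) ^ r ≤ 1 := by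
  have : ∑ r ∈ Icc 1 R, ((2 : ℝ)⁻¹) ^ r = 1 - 2⁻¹ ^ R := by
    induction R with
    | zero => simp
    | succ R ih => rw [sum_Icc_succ_top (by omega), ih]; ring
  rw [this]
  have : (0 : ℝ) ≤ 2⁻¹ ^ R := by positivity
  linarith

/-- The pairs of walks through an edge have total weight at most `1`. -/
theorem sum_pairsThrough_le {R D y : ℕ} (hD : G.maxDegree ≤ D) (hD1 : 1 ≤ D)
    (hy : 16 * D ^ 2 ≤ y) (hyR : Fintype.card V * (16 * D ^ 2) ^ R ≤ y ^ R) (e : Sym2 V) :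
    ∑ l ∈ (Icc 1 R).biUnion (pairsThrough G R e), ((y : ℝ)⁻¹) ^ l.length ≤ 1 := by
  have hy0 : 0 < y := lt_of_lt_of_le (by positivity) hy
  have hcard : ∀ r ∈ Icc 1 R, (pairsThrough G R e r).card * 2 ^ r ≤ y ^ r := by
    intro r hr
    rw [mem_Icc] at hr
    -- In `16 * D ^ 2` the 16 is `8 * 2`: `8 ^ r` absorbs positions, orientations and order, and `2
    -- ^ r` makes the sum over `r` geometric.
    have h8 : 8 * r ≤ 8 ^ r := by
      have h : ∀ m : ℕ, 8 * (m + 1) ≤ 8 ^ (m + 1) := by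
        intro m
        induction m with
        | zero => norm_num
        | succ m ih => rw [pow_succ]; omega
      have := h (r - 1)
      rwa [Nat.sub_add_cancel hr.1] at this
    have hmono : ∀ m, G.maxDegree ^ m ≤ D ^ m := fun m => Nat.pow_le_pow_left hD m
    have hexp : (16 * D ^ 2) ^ r = 8 ^ r * (D ^ (2 * r) * 2 ^ r) := by
      rw [show 16 * D ^ 2 = 8 * (D ^ 2 * 2) by ring, mul_pow, mul_pow, ← pow_mul]
    by_cases hR : r = R
    · subst hR
      calc (pairsThrough G r e r).card * 2 ^ r
          ≤ r * 2 * (D ^ (r - 1) * (Fintype.card V * D ^ r)) * 2 ^ r := by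
            refine Nat.mul_le_mul_right _ ((card_pairsThrough_top G r e).trans ?_)
            gcongr
        _ ≤ r * 8 * (D ^ r * (Fintype.card V * D ^ r)) * 2 ^ r := by
            gcongr
            · norm_num
            · omega
        _ = 8 * r * (Fintype.card V * (D ^ (2 * r) * 2 ^ r)) := by rw [two_mul, pow_add]; ring
        _ ≤ 8 ^ r * (Fintype.card V * (D ^ (2 * r) * 2 ^ r)) := by gcongr
        _ = Fintype.card V * (16 * D ^ 2) ^ r := by rw [hexp]; ring
        _ ≤ y ^ r := hyR
    · calc (pairsThrough G R e r).card * 2 ^ r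
          ≤ 2 * r * 2 * (D ^ (2 * r - 1) * 2) * 2 ^ r := by
            refine Nat.mul_le_mul_right _ ((card_pairsThrough G hR e).trans ?_)
            gcongr
        _ ≤ 2 * r * 2 * (D ^ (2 * r) * 2) * 2 ^ r := by
            gcongr
            · omega
        _ = 8 * r * (D ^ (2 * r) * 2 ^ r) := by ring
        _ ≤ 8 ^ r * (D ^ (2 * r) * 2 ^ r) := by gcongr
        _ = (16 * D ^ 2) ^ r := hexp.symm
        _ ≤ y ^ r := Nat.pow_le_pow_left hy r
  calc ∑ l ∈ (Icc 1 R).biUnion (pairsThrough G R e), ((y : ℝ)⁻¹) ^ l.length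
      ≤ ∑ r ∈ Icc 1 R, ∑ l ∈ pairsThrough G R e r, ((y : ℝ)⁻¹) ^ l.length :=
        by
          classical
          have hdisj : Set.PairwiseDisjoint (Icc 1 R : Set ℕ) (pairsThrough G R e) := by
            intro r _ r' _ hne
            refine disjoint_left.2 fun l h1 h2 => hne ?_
            rw [← length_of_mem_pairsThrough G h1, ← length_of_mem_pairsThrough G h2]
          rw [sum_biUnion hdisj]
    _ ≤ ∑ r ∈ Icc 1 R, ((2 : ℝ)⁻¹) ^ r := by
        refine sum_le_sum fun r hr => ?_
        rw [sum_congr rfl fun l hl => by rw [length_of_mem_pairsThrough G hl], sum_const,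
          nsmul_eq_mul]
        have h := hcard r hr
        have h' : ((pairsThrough G R e r).card : ℝ) * 2 ^ r ≤ (y : ℝ) ^ r := by exact_mod_cast h
        rw [inv_pow, inv_pow, ← div_eq_mul_inv, div_le_iff₀ (by positivity), inv_mul_eq_div,
          le_div_iff₀ (by positivity)]
        exact h'
    _ ≤ 1 := sum_geometric_half_le R

end Walks

end EntropyCompression

/-! ### The recoloring step: clashes, codes of walk pairs, and exhaustive search -/

namespace EntropyCompression

open Finset

section Algorithm

variable {n : ℕ} [NeZero n] (G : SimpleGraph (Fin n)) [DecidableRel G.Adj]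

/-- Two walks of length `r` with disjoint edge sets and equal color sequences. -/
structure Clash {V : Type*} (G : SimpleGraph V) (R : ℕ) (F : Sym2 V → ℕ) (P Q : ℕ → V)
    (r : ℕ) : Prop where
  walks : IsWalkPair G R P Q r
  colored : ∀ i < r, F s(P i, P (i + 1)) ≠ 0
  eq : ∀ i < r, F s(Q i, Q (i + 1)) = F s(P i, P (i + 1))
  left : ∀ i < r, ∀ j < r, s(P i, P (i + 1)) = s(P j, P (j + 1)) → i = j
  right : ∀ i < r, ∀ j < r, s(Q i, Q (i + 1)) = s(Q j, Q (j + 1)) → i = j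
  disjoint : ∀ i < r, ∀ j < r, s(P i, P (i + 1)) ≠ s(Q j, Q (j + 1))

/-- Only the first walk is erased; by symmetry a clash through the new edge may be assumed to have
it there. -/
theorem Clash.swap {V : Type*} {G : SimpleGraph V} {R : ℕ} {F : Sym2 V → ℕ} {P Q : ℕ → V} {r : ℕ}
    (h : Clash G R F P Q r) : Clash G R F Q P r where
  walks := ⟨h.walks.pos, h.walks.le, h.walks.right, h.walks.left,
    h.walks.joined.imp_right Or.symm⟩
  colored i hi := by rw [h.eq i hi]; exact h.colored i hi
  eq i hi := (h.eq i hi).symm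
  left := h.right
  right := h.left
  disjoint i hi j hj := (h.disjoint j hj i hi).symm

theorem Clash.mono {V : Type*} {G : SimpleGraph V} {R : ℕ} {F F' : Sym2 V → ℕ} {P Q : ℕ → V}
    {r : ℕ} (h : Clash G R F P Q r)
    (hP : ∀ i < r, F s(P i, P (i + 1)) = F' s(P i, P (i + 1)))
    (hQ : ∀ i < r, F s(Q i, Q (i + 1)) = F' s(Q i, Q (i + 1))) : Clash G R F' P Q r where
  walks := h.walks
  colored i hi := by rw [← hP i hi]; exact h.colored i hi
  eq i hi := by rw [← hP i hi, ← hQ i hi]; exact h.eq i hi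
  left := h.left
  right := h.right
  disjoint := h.disjoint

/-- A coloring of all edges without a clash is non-repetitive. -/
theorem isNonrepetitive_of_no_clash {V : Type*} {G : SimpleGraph V} {R : ℕ} (hR : 1 ≤ R)
    {F : Sym2 V → ℕ} (hF : ∀ e ∈ G.edgeSet, F e ≠ 0) (h : ∀ P Q r, ¬ Clash G R F P Q r) :
    IsNonrepetitive G F := by
  intro u v p hp x hx
  by_contra hx0
  have hr : 0 < x.length := List.length_pos_iff.2 hx0
  set r := x.length with hrdef
  have hlen : p.length = r + r := by
    rw [← SimpleGraph.Walk.length_edges, ← List.length_map (f := F), hx, List.length_append]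
  have hed : ∀ i (hi : i < p.length), p.edges[i]'(by simpa using hi) =
      s(p.getVert i, p.getVert (i + 1)) := fun i hi => by
    rw [SimpleGraph.Walk.getElem_edges]
  have hinj : ∀ i < p.length, ∀ j < p.length, s(p.getVert i, p.getVert (i + 1)) =
      s(p.getVert j, p.getVert (j + 1)) → i = j := by
    intro i hi j hj hij
    rw [← hed i hi, ← hed j hj] at hij
    exact (List.Nodup.getElem_inj_iff hp.isTrail.edges_nodup).1 hij
  have hcol : ∀ i < r, F s(p.getVert (r + i), p.getVert (r + i + 1)) =
      F s(p.getVert i, p.getVert (i + 1)) := by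
    intro i hi
    rw [← hed i (by omega), ← hed (r + i) (by omega)]
    have h1 : (p.edges.map F)[i]? = x[i]? := by
      rw [hx, List.getElem?_append_left hi]
    have h2 : (p.edges.map F)[r + i]? = x[i]? := by
      rw [hx, List.getElem?_append_right (by omega)]
      congr 1; omega
    have h3 := h2.trans h1.symm
    rw [List.getElem?_eq_getElem (by simp; omega), List.getElem?_eq_getElem (by simp; omega)] at h3
    simpa using h3
  -- The halves are cut to their first `R` edges. If nothing is cut off they are consecutive;
  -- otherwise the length is `R` and adjacency is not required.
  refine h p.getVert (fun i => p.getVert (r + i)) (min r R) ⟨⟨?_, ?_, ?_, ?_, ?_⟩, ?_, ?_, ?_, ?_, ?_⟩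
  · omega
  · omega
  · exact fun i hi => p.adj_getVert_succ (by omega)
  · exact fun i hi => p.adj_getVert_succ (by omega)
  · rcases le_total R r with h' | h'
    · left; omega
    · right; left; rw [min_eq_left h', add_zero]
  · exact fun i hi => hF _ (p.adj_getVert_succ (by omega))
  · exact fun i hi => hcol i (by omega)
  · exact fun i hi j hj => hinj i (by omega) j (by omega)
  · intro i hi j hj hij
    have := hinj (r + i) (by omega) (r + j) (by omega) hij
    omega
  · intro i hi j hj hij
    have := hinj i (by omega) (r + j) (by omega) hij
    omega

/-- One step of a pair of walks, steered by the two last digits to the base `D`. -/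
def walkStep (nb : Fin n → ℕ → Fin n) (D : ℕ) (x : Fin n × Fin n × ℕ) : Fin n × Fin n × ℕ :=
  (nb x.1 (x.2.2 % D), nb x.2.1 (x.2.2 / D % D), x.2.2 / D / D)

/-- The pair of walks with a given code. -/
def codeWalks (nb : Fin n → ℕ → Fin n) (D R c i : ℕ) : Fin n × Fin n × ℕ :=
  (walkStep nb D)^[i] (Fin.ofNat n c, Fin.ofNat n (c / n), c / n / n / R)

/-- The length of the walks with a given code. -/
def codeLength (n R c : ℕ) : ℕ := c / n / n % R + 1

/-- Try to erase the first of the two walks with a given code. -/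
def trial (nb : Fin n → ℕ → Fin n) (D R : ℕ) (e : Sym2 (Fin n)) (F : Sym2 (Fin n) → ℕ) (c : ℕ) :
    Option (Sym2 (Fin n) → ℕ) :=
  let w := codeWalks nb D R c
  let r := codeLength n R c
  (eraseMatched (walkPairs (fun i => (w i).1) (fun i => (w i).2.1) r) F).bind fun F' =>
    if (r = R ∨ (w r).1 = (w 0).2.1 ∨ (w r).2.1 = (w 0).1) ∧ F' e = 0 then some F' else none

/-- The result of the first successful trial. -/
def search (nb : Fin n → ℕ → Fin n) (D R : ℕ) (e : Sym2 (Fin n)) (F : Sym2 (Fin n) → ℕ) :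
    ℕ → Option (Sym2 (Fin n) → ℕ)
  | 0 => none
  | c + 1 => (search nb D R e F c).or (trial nb D R e F c)

/-- Make up for the coloring of `e`. -/
def resolve (nb : Fin n → ℕ → Fin n) (D R B : ℕ) (e : Sym2 (Fin n)) (F : Sym2 (Fin n) → ℕ) :
    Sym2 (Fin n) → ℕ :=
  (search nb D R e F B).getD F

/-- One more than the last index below `k` of an edge outside `X`, or `0`. -/
def lastUncolored (X : Finset (Sym2 (Fin n))) : ℕ → ℕ
  | 0 => 0
  | k + 1 =>
    if G.Adj (Fin.ofNat n (k / n)) (Fin.ofNat n k) ∧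
        s(Fin.ofNat n (k / n), Fin.ofNat n k) ∉ X then k + 1
    else lastUncolored X k

/-- The edge to be colored next. -/
def nextEdge (X : Finset (Sym2 (Fin n))) : Option (Sym2 (Fin n)) :=
  let k := lastUncolored G X (n * n)
  if k = 0 then none else some s(Fin.ofNat n ((k - 1) / n), Fin.ofNat n (k - 1))

variable {G}

theorem search_eq_some {nb : Fin n → ℕ → Fin n} {D R : ℕ} {e : Sym2 (Fin n)}
    {F F' : Sym2 (Fin n) → ℕ} {B : ℕ} (h : search nb D R e F B = some F') :
    ∃ c, trial nb D R e F c = some F' := by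
  induction B with
  | zero => simp [search] at h
  | succ c ih =>
    rw [search, Option.or_eq_some_iff] at h
    rcases h with h | ⟨_, h⟩
    · exact ih h
    · exact ⟨c, h⟩

theorem trial_eq_none_of_search {nb : Fin n → ℕ → Fin n} {D R : ℕ} {e : Sym2 (Fin n)}
    {F : Sym2 (Fin n) → ℕ} {B c : ℕ} (h : search nb D R e F B = none) (hc : c < B) :
    trial nb D R e F c = none := by
  induction B with
  | zero => omega
  | succ B ih =>
    rw [search, Option.or_eq_none_iff] at h
    rcases Nat.lt_succ_iff_lt_or_eq.1 hc with h' | rfl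
    · exact ih h.1 h'
    · exact h.2

theorem lastUncolored_spec (X : Finset (Sym2 (Fin n))) (k : ℕ) (h : lastUncolored G X k ≠ 0) :
    lastUncolored G X k ≤ k ∧
    G.Adj (Fin.ofNat n ((lastUncolored G X k - 1) / n)) (Fin.ofNat n (lastUncolored G X k - 1)) ∧
      s(Fin.ofNat n ((lastUncolored G X k - 1) / n),
        Fin.ofNat n (lastUncolored G X k - 1)) ∉ X := by
  induction k with
  | zero => exact absurd rfl h
  | succ k ih =>
    rw [lastUncolored] at h ⊢
    split_ifs at h ⊢ with hk
    · exact ⟨le_rfl, by simpa using hk⟩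
    · have := ih h
      exact ⟨by omega, this.2⟩

theorem of_lastUncolored_eq_zero {X : Finset (Sym2 (Fin n))} {k : ℕ}
    (h : lastUncolored G X k = 0) (i : ℕ) (hi : i < k)
    (hadj : G.Adj (Fin.ofNat n (i / n)) (Fin.ofNat n i)) :
    s(Fin.ofNat n (i / n), Fin.ofNat n i) ∈ X := by
  induction k with
  | zero => omega
  | succ k ih =>
    rw [lastUncolored] at h
    split_ifs at h with hk
    rcases Nat.lt_succ_iff_lt_or_eq.1 hi with h' | rfl
    · exact ih h h'
    · by_contra hX
      exact hk ⟨hadj, hX⟩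

theorem nextEdge_eq_some {X : Finset (Sym2 (Fin n))} {e : Sym2 (Fin n)}
    (h : nextEdge G X = some e) : e ∉ X ∧ e ∈ G.edgeFinset := by
  simp only [nextEdge] at h
  split_ifs at h with h0
  rw [Option.some.injEq] at h
  subst h
  obtain ⟨-, h1, h2⟩ := lastUncolored_spec X _ h0
  exact ⟨h2, by simpa using h1⟩

theorem nextEdge_eq_none {X : Finset (Sym2 (Fin n))} (h : nextEdge G X = none) {e : Sym2 (Fin n)}
    (he : e ∈ G.edgeSet) : e ∈ X := by
  simp only [nextEdge] at h
  split_ifs at h with h0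
  induction e with
  | _ a b =>
    have ha : (n * a.val + b.val) / n = a.val := by
      rw [Nat.mul_add_div (NeZero.pos n), Nat.div_eq_of_lt b.2, add_zero]
    have e1 : Fin.ofNat n ((n * a.val + b.val) / n) = a := by rw [ha]; simp
    have e2 : Fin.ofNat n (n * a.val + b.val) = b := by
      ext; simp [Nat.mod_eq_of_lt b.2]
    have hlt : n * a.val + b.val < n * n := by
      have := a.2; have := b.2
      calc n * a.val + b.val < n * a.val + n := by omega
        _ = n * (a.val + 1) := by ring
        _ ≤ n * n := Nat.mul_le_mul_left _ a.2
    have := of_lastUncolored_eq_zero h0 _ hlt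
    rw [e1, e2] at this
    exact this he

/-- A successful trial need not stem from a clash, as its walks may overlap. The counting needs only
that the erased list is one of those through `e`. -/
theorem trial_eq_some {nb : Fin n → ℕ → Fin n} {D R : ℕ} (hR : 1 ≤ R) {e : Sym2 (Fin n)}
    {F F' : Sym2 (Fin n) → ℕ} {c : ℕ} (hF : dom F ⊆ G.edgeFinset) (he : e ∈ dom F)
    (h : trial nb D R e F c = some F') :
    ∃ l ∈ (Icc 1 R).biUnion (pairsThrough G R e), eraseMatched l F = some F' := by
  set w := codeWalks nb D R c with hw
  set r := codeLength n R c with hr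
  set P : ℕ → Fin n := fun i => (w i).1 with hP
  set Q : ℕ → Fin n := fun i => (w i).2.1 with hQ
  have h' : (eraseMatched (walkPairs P Q r) F).bind (fun F' =>
    if (r = R ∨ P r = Q 0 ∨ Q r = P 0) ∧ F' e = 0 then some F' else none) = some F' := h
  rw [Option.bind_eq_some_iff] at h'
  obtain ⟨F₁, h1, h2⟩ := h'
  split_ifs at h2 with h3
  rw [Option.some.injEq] at h2
  subst h2
  have hr1 : 1 ≤ r := by rw [hr, codeLength]; omega
  have hrR : r ≤ R := by
    have := Nat.mod_lt (c / n / n) hR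
    rw [hr, codeLength]; omega
  -- Pairs that pass the checks consist of colored elements, which are edges by `hF`; so the walks
  -- follow edges although nothing is assumed about `nb`.
  have hadj : ∀ l : List (Sym2 (Fin n) × Sym2 (Fin n)), ∀ F : Sym2 (Fin n) → ℕ,
      dom F ⊆ G.edgeFinset → eraseMatched l F ≠ none →
      ∀ pq ∈ l, pq.1 ∈ G.edgeFinset ∧ pq.2 ∈ G.edgeFinset := by
    intro l
    induction l with
    | nil => simp
    | cons pq l ih =>
      obtain ⟨p, q⟩ := pq
      intro F hF hne
      simp only [eraseMatched] at hne
      split_ifs at hne with hc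
      · intro x hx
        rw [List.mem_cons] at hx
        rcases hx with rfl | hx
        · refine ⟨hF (mem_dom.2 hc.1), hF ?_⟩
          have : q ∈ dom (Function.update F p 0) := by rw [mem_dom, hc.2]; exact hc.1
          rw [dom_update_zero] at this
          exact mem_of_mem_erase this
        · refine ih (Function.update F p 0) ?_ hne x hx
          rw [dom_update_zero]
          exact (erase_subset _ _).trans hF
      · exact absurd rfl hne
  have hadj' := hadj _ F hF (by rw [h1]; simp)
  have hmem : ∀ i < r, (s(P i, P (i + 1)), s(Q i, Q (i + 1))) ∈ walkPairs P Q r :=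
    fun i hi => List.mem_map.2 ⟨i, List.mem_range.2 hi, rfl⟩
  have hwp : IsWalkPair G R P Q r := by
    refine ⟨hr1, hrR, fun i hi => ?_, fun i hi => ?_, h3.1⟩
    · simpa using (hadj' _ (hmem i hi)).1
    · simpa using (hadj' _ (hmem i hi)).2
  obtain ⟨d1, -, -⟩ := dom_eraseMatched h1
  -- `e` was colored before and is uncolored after, so it is one of the erased edges.
  have heP : e ∈ ((walkPairs P Q r).map Prod.fst).toFinset := by
    by_contra hcon
    have : e ∈ dom F₁ := by rw [d1]; exact mem_sdiff.2 ⟨he, hcon⟩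
    rw [mem_dom] at this
    exact this h3.2
  simp only [walkPairs, List.map_map, List.mem_toFinset, List.mem_map, List.mem_range,
    Function.comp_apply] at heP
  obtain ⟨j, hj, hje⟩ := heP
  exact ⟨_, mem_biUnion.2 ⟨r, mem_Icc.2 ⟨hr1, hrR⟩, mem_pairsThrough G hwp hj hje⟩, h1⟩

/-- This is the hypothesis `hr` of `sum_survivors_le`. -/
theorem resolve_eq {nb : Fin n → ℕ → Fin n} {D R B : ℕ} (hR : 1 ≤ R) {e : Sym2 (Fin n)}
    {F : Sym2 (Fin n) → ℕ} (hF : dom F ⊆ G.edgeFinset) (he : e ∈ dom F) :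
    resolve nb D R B e F = F ∨ ∃ l ∈ (Icc 1 R).biUnion (pairsThrough G R e),
      eraseMatched l F = some (resolve nb D R B e F) := by
  rw [resolve]
  rcases h : search nb D R e F B with _ | F'
  · left; rfl
  · right
    obtain ⟨c, hc⟩ := search_eq_some h
    exact trial_eq_some hR hF he hc

omit [NeZero n] [DecidableRel G.Adj] in
/-- Every pair of walks of length `r` is steered by some number below `D ^ (2 * r)`. -/
theorem exists_steering {nb : Fin n → ℕ → Fin n} {D : ℕ}
    (hnb : ∀ u v, G.Adj u v → ∃ d < D, nb u d = v) (r : ℕ) (P Q : ℕ → Fin n)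
    (hP : ∀ i < r, G.Adj (P i) (P (i + 1))) (hQ : ∀ i < r, G.Adj (Q i) (Q (i + 1))) :
    ∃ c < D ^ (2 * r), ∀ i ≤ r, ((walkStep nb D)^[i] (P 0, Q 0, c)).1 = P i ∧
      ((walkStep nb D)^[i] (P 0, Q 0, c)).2.1 = Q i := by
  induction r generalizing P Q with
  | zero => exact ⟨0, by simp, fun i hi => by obtain rfl : i = 0 := by omega
                                              simp⟩
  | succ r ih =>
    obtain ⟨c, hc, h⟩ := ih (fun i => P (i + 1)) (fun i => Q (i + 1))
      (fun i hi => hP (i + 1) (by omega)) (fun i hi => hQ (i + 1) (by omega))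
    obtain ⟨d, hd, hd'⟩ := hnb _ _ (hP 0 (by omega))
    obtain ⟨f, hf, hf'⟩ := hnb _ _ (hQ 0 (by omega))
    have hD : 0 < D := by omega
    -- Lowest digits first: the first step of `P`, the first step of `Q`, then the code of the
    -- remaining walks.
    refine ⟨d + D * (f + D * c), ?_, fun i hi => ?_⟩
    · calc d + D * (f + D * c) < D + D * (f + D * c) := by omega
        _ = D * (f + 1 + D * c) := by ring
        _ ≤ D * (D + D * c) := by gcongr; omega
        _ = D * D * (c + 1) := by ring
        _ ≤ D * D * D ^ (2 * r) := by gcongr; omega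
        _ = D ^ (2 * (r + 1)) := by ring
    · have hs : walkStep nb D (P 0, Q 0, d + D * (f + D * c)) = (P 1, Q 1, c) := by
        simp only [walkStep, Nat.add_mul_mod_self_left, Nat.mod_eq_of_lt hd,
          Nat.add_mul_div_left _ _ hD, Nat.div_eq_of_lt hd, zero_add, Nat.mod_eq_of_lt hf,
          Nat.div_eq_of_lt hf, hd', hf']
      cases i with
      | zero => exact ⟨rfl, rfl⟩
      | succ i =>
        rw [Function.iterate_succ_apply, hs]
        exact h i (by omega)

omit [DecidableRel G.Adj] in
/-- A clash whose first walk uses `e` leads to a successful trial. -/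
theorem exists_trial_ne_none {nb : Fin n → ℕ → Fin n} {D R B : ℕ}
    (hnb : ∀ u v, G.Adj u v → ∃ d < D, nb u d = v) (hB : n * n * R * D ^ (2 * R) ≤ B) (hD : 1 ≤ D)
    {F : Sym2 (Fin n) → ℕ} {P Q : ℕ → Fin n} {r : ℕ} (h : Clash G R F P Q r) {j : ℕ} (hj : j < r) :
    ∃ c < B, trial nb D R s(P j, P (j + 1)) F c ≠ none := by
  obtain ⟨c, hc, hc'⟩ := exists_steering hnb r P Q h.walks.left h.walks.right
  have hr1 := h.walks.pos
  have hrR := h.walks.le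
  have hn : 0 < n := NeZero.pos n
  have hRpos : 0 < R := by omega
  -- Mixed radix code: both starting vertices to the base `n`, then `r - 1` to the base `R`, then
  -- the steering number.
  set c₂ := r - 1 + R * c with hc₂
  set c₁ := (Q 0).val + n * c₂ with hc₁
  set c₀ := (P 0).val + n * c₁ with hc₀
  have e1 : c₀ / n = c₁ := by
    rw [hc₀, Nat.add_mul_div_left _ _ hn, Nat.div_eq_of_lt (P 0).2, zero_add]
  have e2 : c₁ / n = c₂ := by
    rw [hc₁, Nat.add_mul_div_left _ _ hn, Nat.div_eq_of_lt (Q 0).2, zero_add]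
  have e3 : c₂ / R = c := by
    rw [hc₂, Nat.add_mul_div_left _ _ hRpos, Nat.div_eq_of_lt (by omega), zero_add]
  have e4 : codeLength n R c₀ = r := by
    rw [codeLength, e1, e2, hc₂, Nat.add_mul_mod_self_left, Nat.mod_eq_of_lt (by omega)]
    omega
  have e5 : ∀ i, codeWalks nb D R c₀ i = (walkStep nb D)^[i] (P 0, Q 0, c) := by
    intro i
    rw [codeWalks, e1, e2, e3]
    congr 2
    · ext; simp [hc₀, Nat.mod_eq_of_lt (P 0).2]
    · congr 1; ext; simp [hc₁, Nat.mod_eq_of_lt (Q 0).2]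
  refine ⟨c₀, ?_, ?_⟩
  · refine lt_of_lt_of_le ?_ hB
    have hc4 : c + 1 ≤ D ^ (2 * R) :=
      le_trans hc (Nat.pow_le_pow_right hD (by omega))
    have h2 : c₂ + 1 ≤ R * D ^ (2 * R) := by
      calc c₂ + 1 ≤ R * (c + 1) := by have := mul_add_one R c; omega
        _ ≤ _ := Nat.mul_le_mul_left _ hc4
    have h1 : c₁ + 1 ≤ n * (R * D ^ (2 * R)) := by
      have := (Q 0).2
      calc c₁ + 1 ≤ n * (c₂ + 1) := by have := mul_add_one n c₂; omega
        _ ≤ _ := Nat.mul_le_mul_left _ h2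
    have := (P 0).2
    calc c₀ < n * (c₁ + 1) := by have := mul_add_one n c₁; omega
      _ ≤ n * (n * (R * D ^ (2 * R))) := Nat.mul_le_mul_left _ h1
      _ = _ := by ring
  · have hwalk : walkPairs (fun i => (codeWalks nb D R c₀ i).1)
        (fun i => (codeWalks nb D R c₀ i).2.1) r = walkPairs P Q r :=
      walkPairs_congr (fun i hi => by rw [e5, (hc' i hi).1]) (fun i hi => by rw [e5, (hc' i hi).2])
    obtain ⟨F', hF'⟩ : ∃ F', eraseMatched (walkPairs P Q r) F = some F' := by
      refine exists_eraseMatched ?_ ?_ ?_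
      · intro pq hpq
        obtain ⟨i, hi, rfl⟩ := List.mem_map.1 hpq
        rw [List.mem_range] at hi
        exact ⟨h.colored i hi, h.eq i hi⟩
      · rw [walkPairs, List.map_map]
        refine List.Nodup.map_on ?_ List.nodup_range
        intro i hi k hk hik
        rw [List.mem_range] at hi hk
        exact h.left i hi k hk hik
      · intro pq hpq pq' hpq'
        obtain ⟨i, hi, rfl⟩ := List.mem_map.1 hpq
        obtain ⟨k, hk, rfl⟩ := List.mem_map.1 hpq'
        rw [List.mem_range] at hi hk
        exact h.disjoint i hi k hk
    have hFe : F' s(P j, P (j + 1)) = 0 := by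
      obtain ⟨d1, -, -⟩ := dom_eraseMatched hF'
      by_contra hcon
      have := d1 ▸ mem_dom.2 hcon
      refine (mem_sdiff.1 this).2 (List.mem_toFinset.2 (List.mem_map.2 ⟨_, List.mem_map.2
        ⟨j, List.mem_range.2 hj, rfl⟩, rfl⟩))
    simp only [trial]
    rw [e4, hwalk, hF', Option.bind_some, if_pos]
    · simp
    · refine ⟨?_, hFe⟩
      rw [e5, e5, (hc' r le_rfl).1, (hc' r le_rfl).2, (hc' 0 (by omega)).1, (hc' 0 (by omega)).2]
      exact h.walks.joined

/-- Resolving keeps a partial coloring free of clashes. -/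
theorem no_clash_resolve {nb : Fin n → ℕ → Fin n} {D R B : ℕ} (hR : 1 ≤ R)
    (hnb : ∀ u v, G.Adj u v → ∃ d < D, nb u d = v) (hB : n * n * R * D ^ (2 * R) ≤ B) (hD : 1 ≤ D)
    {F : Sym2 (Fin n) → ℕ} {e : Sym2 (Fin n)} {c : ℕ} (hF : dom F ⊆ G.edgeFinset)
    (he : e ∈ G.edgeFinset) (hc : c ≠ 0)
    (hno : ∀ P Q r, ¬ Clash G R F P Q r) (P Q : ℕ → Fin n) (r : ℕ) :
    ¬ Clash G R (resolve nb D R B e (Function.update F e c)) P Q r := by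
  intro h
  -- Away from `e` the new coloring is a restriction of `F`, so a clash avoiding `e` would already
  -- be a clash of `F`.
  have hne : ∀ (F' : Sym2 (Fin n) → ℕ), Clash G R F' P Q r →
      (∀ x, x ≠ e → F' x = 0 ∨ F' x = F x) →
      (∀ i < r, s(P i, P (i + 1)) ≠ e ∧ s(Q i, Q (i + 1)) ≠ e) → False := by
    intro F' h hF' hPQ
    refine hno P Q r (h.mono (fun i hi => ?_) (fun i hi => ?_))
    · exact (hF' _ (hPQ i hi).1).resolve_left (h.colored i hi)
    · exact (hF' _ (hPQ i hi).2).resolve_left (h.swap.colored i hi)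
  rw [resolve] at h
  rcases hs : search nb D R e (Function.update F e c) B with _ | F'
  · rw [hs, Option.getD_none] at h
    -- The search has failed, whereas a clash through `e`, after a swap if necessary, would have
    -- been found by some code below `B`.
    refine hne _ h (fun x hx => Or.inr (by simp [hx])) fun i hi => ⟨?_, ?_⟩
    · rintro rfl
      obtain ⟨c', hc', ht⟩ := exists_trial_ne_none hnb hB hD h hi
      exact ht (trial_eq_none_of_search hs hc')
    · rintro rfl
      obtain ⟨c', hc', ht⟩ := exists_trial_ne_none hnb hB hD h.swap hi
      exact ht (trial_eq_none_of_search hs hc')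
  · rw [hs, Option.getD_some] at h
    obtain ⟨c', hc'⟩ := search_eq_some hs
    have hdom : dom (Function.update F e c) ⊆ G.edgeFinset := by
      rw [dom_update_ne_zero _ _ hc]
      exact insert_subset he hF
    obtain ⟨l, -, hl⟩ := trial_eq_some hR hdom (by simp [hc]) hc'
    obtain ⟨-, -, d3⟩ := dom_eraseMatched hl
    -- After a success `e` is uncolored again, and a clash uses colored edges only.
    have he0 : F' e = 0 := by
      simp only [trial] at hc'
      rw [Option.bind_eq_some_iff] at hc'
      obtain ⟨F₁, -, h2⟩ := hc'
      split_ifs at h2 with h3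
      rw [Option.some.injEq] at h2
      subst h2
      exact h3.2
    refine hne _ h (fun x hx => by simpa [hx] using d3 x) fun i hi => ⟨?_, ?_⟩
    · rintro rfl
      exact h.colored i hi he0
    · rintro rfl
      exact h.swap.colored i hi he0

end Algorithm

end EntropyCompression

/-! ### Failure bound and correctness of the abstract process -/

namespace EntropyCompression

open Finset

section Main

variable {n : ℕ} [NeZero n] {G : SimpleGraph (Fin n)} [DecidableRel G.Adj]

/-- The coloring process is unfinished with small probability. -/
theorem card_unfinished_le {nb : Fin n → ℕ → Fin n} {D R B b y t s L : ℕ} (hR : 1 ≤ R)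
    (hD : G.maxDegree ≤ D) (hD1 : 1 ≤ D) (hy : 16 * D ^ 2 ≤ y)
    (hyR : n * (16 * D ^ 2) ^ R ≤ y ^ R) (hb : 2 ^ b = 4 * y) (hL : L = b * t + s) :
    (univ.filter fun r : Fin L → Bool => nextEdge G (dom (process (nextEdge G)
      (resolve nb D R B) b t (RandRAM.coins r) 0)) ≠ none).card * 2 ^ t ≤
        4 ^ G.edgeFinset.card * 2 ^ L := by
  have hy1 : (1 : ℝ) ≤ y := by
    have : 1 ≤ y := le_trans (Nat.one_le_iff_ne_zero.2 (by positivity)) hy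
    exact_mod_cast this
  have hN : ((2 ^ b : ℕ) : ℝ) = 4 * y := by rw [hb]; push_cast; ring
  have h1 := sum_survivors_le (nxt := nextEdge G) (res := resolve nb D R B)
    (Ev := fun e => (Icc 1 R).biUnion (pairsThrough G R e)) (Ed := G.edgeFinset) hy1 hN
    (fun X e h => nextEdge_eq_some h) (fun e F hF he => resolve_eq hR hF he)
    (fun e _ => sum_pairsThrough_le G hD hD1 hy (by simpa using hyR) e) t
    (X := ∅) (empty_subset _)
  have h0 : (0 : Sym2 (Fin n) → ℕ) ∈ colorings (2 ^ b) ∅ := by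
    rw [mem_colorings]
    exact ⟨by ext; simp, fun e => Nat.zero_le _⟩
  -- The empty coloring is one term of the sum over the colorings of the empty domain.
  have h2 : (survivors (nextEdge G) (resolve nb D R B) (2 ^ b) t 0 : ℝ) ≤
      4 ^ G.edgeFinset.card * (2 * y) ^ t := by
    refine le_trans (single_le_sum (f := fun F => (survivors (nextEdge G) (resolve nb D R B)
      (2 ^ b) t F : ℝ)) (fun F _ => Nat.cast_nonneg _) h0) ?_
    simpa using h1
  have h3 : survivors (nextEdge G) (resolve nb D R B) (2 ^ b) t 0 ≤
      4 ^ G.edgeFinset.card * (2 * y) ^ t := by exact_mod_cast h2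
  calc _ ≤ survivors (nextEdge G) (resolve nb D R B) (2 ^ b) t 0 * 2 ^ s * 2 ^ t :=
        Nat.mul_le_mul_right _ (card_process_unfinished _ _ b t s L hL 0)
    _ ≤ 4 ^ G.edgeFinset.card * (2 * y) ^ t * 2 ^ s * 2 ^ t := by gcongr
    _ = 4 ^ G.edgeFinset.card * ((4 * y) ^ t * 2 ^ s) := by
        rw [show 4 * y = (2 * y) * 2 by ring, mul_pow (2 * y) 2]; ring
    _ = 4 ^ G.edgeFinset.card * 2 ^ L := by rw [← hb, hL, pow_add, pow_mul]

/-- A finished coloring is good. -/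
theorem process_good {nb : Fin n → ℕ → Fin n} {D R B b t : ℕ} (hR : 1 ≤ R) (hD1 : 1 ≤ D)
    (hnb : ∀ u v, G.Adj u v → ∃ d < D, nb u d = v) (hB : n * n * R * D ^ (2 * R) ≤ B)
    {ω : ℕ → Bool} {F : Sym2 (Fin n) → ℕ}
    (hF : F = process (nextEdge G) (resolve nb D R B) b t ω 0) (h : nextEdge G (dom F) = none) :
    IsNonrepetitive G F ∧ (F '' G.edgeSet).ncard ≤ 2 ^ b := by
  have hI := process_induction (nxt := nextEdge G) (res := resolve nb D R B) (b := b)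
    (fun F => dom F ⊆ G.edgeFinset ∧ (∀ e, F e ≤ 2 ^ b) ∧ ∀ P Q r, ¬ Clash G R F P Q r)
    (by
      rintro F e c ⟨hF, hle, hno⟩ hne hc
      rw [mem_Icc] at hc
      have he := (nextEdge_eq_some hne).2
      have hdom : dom (Function.update F e c) ⊆ G.edgeFinset := by
        rw [dom_update_ne_zero _ _ (by omega)]
        exact insert_subset he hF
      have hmem : e ∈ dom (Function.update F e c) := by
        rw [mem_dom, Function.update_self]; omega
      have hle' : ∀ x, Function.update F e c x ≤ 2 ^ b := by
        intro x
        by_cases hx : x = e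
        · subst hx; simpa using hc.2
        · simpa [hx] using hle x
      refine ⟨?_, ?_, fun P Q r => no_clash_resolve hR hnb hB hD1 hF he (by omega) hno P Q r⟩
      · rcases resolve_eq (nb := nb) (D := D) (B := B) hR hdom
          hmem with h | ⟨l, -, h⟩
        · rw [h]; exact hdom
        · rw [(dom_eraseMatched h).1]
          exact sdiff_subset.trans hdom
      · rcases resolve_eq (nb := nb) (D := D) (B := B) hR hdom
          hmem with h | ⟨l, -, h⟩
        · rw [h]; exact hle'
        · intro x
          rcases (dom_eraseMatched h).2.2 x with h' | h'
          · omega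
          · rw [h']; exact hle' x)
    t ω (F := 0)
    ⟨by intro e; simp, fun e => Nat.zero_le _, fun P Q r h => h.colored 0 h.walks.pos rfl⟩
  rw [← hF] at hI
  have hne : ∀ e ∈ G.edgeSet, F e ≠ 0 := fun e he => mem_dom.1 (nextEdge_eq_none h he)
  refine ⟨isNonrepetitive_of_no_clash hR hne hI.2.2, ?_⟩
  have hsub : F '' G.edgeSet ⊆ (Icc 1 (2 ^ b) : Finset ℕ) := by
    rintro _ ⟨e, he, rfl⟩
    have := hne e he
    have := hI.2.1 e
    simp only [coe_Icc, Set.mem_Icc]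
    omega
  calc (F '' G.edgeSet).ncard ≤ ((Icc 1 (2 ^ b) : Finset ℕ) : Set ℕ).ncard :=
        Set.ncard_le_ncard hsub (Finset.finite_toSet _)
    _ = 2 ^ b := by rw [Set.ncard_coe_finset, Nat.card_Icc, Nat.add_sub_cancel]

end Main

end EntropyCompression

/-! ### The program -/

namespace RandRAM

namespace Prog

open EntropyCompression

/-- Do nothing. -/
def nop : Prog := .assign 99 (.var 99)

/-- The index of the entry in row `x` and column `y` of a matrix. -/
def entry (x y : ℕ) : Expr := .add (.read 2 (.var x)) (.var y)

/-- An expression that is nonzero if and only if the two values differ. -/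
def differ (e₁ e₂ : Expr) : Expr := .add (.sub e₁ e₂) (.sub e₂ e₁)

/-- Divide variable `10` by variable `y`, with the remainder in variable `11`. -/
def divMod (y : ℕ) : Prog :=
  .assign 12 (.const 0) ;;
  .rep 100 (.sub (.add (.var 10) (.const 1)) (.var y))
    (.assign 10 (.sub (.var 10) (.var y)) ;; .assign 12 (.add (.var 12) (.const 1))) ;;
  .assign 11 (.var 10) ;;
  .assign 10 (.var 12)

/-- Copy array `a` to array `b`. -/
def copy (a b : ℕ) : Prog :=
  .assign 28 (.const 0) ;;
  .rep 101 (.sub (.var 5) (.var 28))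
    (.write b (.var 28) (.read a (.var 28)) ;; .assign 28 (.add (.var 28) (.const 1)))

/-- Split off a digit and put the neighbor of variable `x` with that number into variable `y`. -/
def digit (x y : ℕ) : Prog := divMod 2 ;; .assign y (.read 3 (entry x 11))

/-- Erase the color of the current edge of the first walk. -/
def eraseStep : Prog :=
  .assign 22 (.read 4 (entry 13 20)) ;;
  .write 4 (entry 13 20) (.const 0) ;;
  .write 4 (entry 20 13) (.const 0)

/-- Compare the erased color with the color of the current edge of the second walk. -/
def checkStep : Prog :=
  .cond (.var 22) (.cond (differ (.read 4 (entry 14 21)) (.var 22)) (.assign 18 (.const 0)) nop)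
    (.assign 18 (.const 0))

/-- Go on to the next edges of the walks. -/
def advance : Prog :=
  .assign 13 (.var 20) ;; .assign 14 (.var 21) ;; .assign 19 (.add (.var 19) (.const 1))

/-- One step of both walks, with the erasure of the color of the first edge. -/
def walkBody : Prog := digit 13 20 ;; digit 14 21 ;; eraseStep ;; checkStep ;; advance

/-- Decode the number in variable `23` and prepare the walks. -/
def decodeStart : Prog :=
  .assign 10 (.var 23) ;;
  divMod 0 ;;
  .assign 13 (.var 11) ;;
  divMod 0 ;;
  .assign 14 (.var 11) ;;
  divMod 3 ;;
  .assign 17 (.add (.var 11) (.const 1)) ;;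
  .assign 15 (.var 13) ;;
  .assign 16 (.var 14) ;;
  .assign 18 (.const 1) ;;
  .assign 19 (.const 0)

/-- The loop that follows the walks. -/
def walkLoop : Prog := .rep 102 (.sub (.var 17) (.var 19)) walkBody

/-- Check the ends of the walks and the edge that has been colored last. -/
def finalCheck : Prog :=
  .cond (.sub (.var 3) (.var 17))
    (.cond (differ (.var 13) (.var 16))
      (.cond (differ (.var 14) (.var 15)) (.assign 18 (.const 0)) nop) nop) nop ;;
  .cond (.read 4 (.sub (.var 25) (.const 1))) (.assign 18 (.const 0)) nop

/-- One trial. -/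
def trialBody : Prog :=
  decodeStart ;; copy 1 4 ;; walkLoop ;; finalCheck ;;
  .cond (.var 18) (.assign 24 (.const 1) ;; copy 4 1) nop

/-- The search for a successful trial. -/
def searchLoop : Prog :=
  .assign 24 (.const 0) ;;
  .assign 23 (.const 0) ;;
  .rep 103 (.sub (.var 1) (.var 23))
    (.cond (.var 24) nop trialBody ;; .assign 23 (.add (.var 23) (.const 1)))

/-- Find an uncolored edge. -/
def findEdge : Prog :=
  .assign 25 (.const 0) ;;
  .assign 28 (.const 0) ;;
  .rep 104 (.sub (.var 5) (.var 28))
    (.cond (.read 0 (.var 28))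
      (.cond (.read 1 (.var 28)) nop (.assign 25 (.add (.var 28) (.const 1)))) nop ;;
    .assign 28 (.add (.var 28) (.const 1)))

/-- Choose a random color. -/
def randomColor : Prog :=
  .assign 30 (.const 0) ;;
  .assign 29 (.const 1) ;;
  .rep 105 (.sub (.var 4) (.var 29))
    (.flip 31 ;;
    .assign 30 (.add (.add (.var 30) (.var 30)) (.var 31)) ;;
    .assign 29 (.add (.var 29) (.var 29)))

/-- Give the color to the edge. -/
def setColor : Prog :=
  .assign 10 (.sub (.var 25) (.const 1)) ;;
  divMod 0 ;;
  .assign 26 (.var 10) ;;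
  .assign 27 (.var 11) ;;
  .write 1 (entry 26 27) (.add (.var 30) (.const 1)) ;;
  .write 1 (entry 27 26) (.add (.var 30) (.const 1))

/-- One round of the coloring process. -/
def roundBody : Prog :=
  findEdge ;; .cond (.var 25) (randomColor ;; setColor ;; searchLoop) nop

/-- The coloring process. -/
def coloringLoop : Prog := .rep 106 (.const 1) roundBody

variable {ω : ℕ → Bool}

@[simp] theorem den_nop (k : ℕ) (s : State) : den ω k nop s = s := by
  simp [nop, den, Expr.eval, State.setVar_self]

theorem eval_differ {s : State} {e₁ e₂ : Expr} :
    (differ e₁ e₂).eval s = 0 ↔ e₁.eval s = e₂.eval s := by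
  simp only [differ, Expr.eval]; omega

@[simp] theorem eval_entry {s : State} {x y : ℕ} :
    (entry x y).eval s = s.arr 2 (s.var x) + s.var y := rfl

/-- Repeated subtraction: the guard `a + 1 - d` is nonzero exactly when `d ≤ a`, and the quotient is
at most `a`, so the clock suffices. -/
theorem den_divMod {y d a : ℕ} {s : State} (hy : y ∉ [10, 11, 12, 100]) (hd : 0 < d)
    (hyd : s.var y = d) (ha : s.var 10 = a) (hB : a ≤ s.var 1) :
    (den ω 1 (divMod y) s).var 10 = a / d ∧ (den ω 1 (divMod y) s).var 11 = a % d := by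
  simp only [List.mem_cons, List.not_mem_nil, or_false, not_or] at hy
  obtain ⟨hy1, hy2, hy3, hy4⟩ := hy
  have h := rep_rule (ω := ω) (k := 1) (x := 100)
    (e := .sub (.add (.var 10) (.const 1)) (.var y))
    (c := .assign 10 (.sub (.var 10) (.var y)) ;; .assign 12 (.add (.var 12) (.const 1)))
    (fun j s' => s'.var 10 + d * j = a ∧ s'.var 12 = j ∧ s'.var y = d) (s.setVar 12 0) (a / d)
    (by simpa using (Nat.div_le_self a d).trans hB)
    (by intro j s' v h; simpa [hy4] using h)
    (by simp [ha, hyd, hy3])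
    (by
      rintro j s' hj - - ⟨h1, h2, h3⟩
      have h4 : d * (j + 1) ≤ a :=
        (Nat.mul_le_mul_left d hj).trans (Nat.mul_div_le a d)
      rw [mul_add_one] at h4
      refine ⟨by simp only [Expr.eval, h3]; omega, ?_⟩
      simp only [den, Expr.eval, State.setVar_var, h3, h2, hy1, hy3]
      simp only [if_true, if_false, Nat.reduceEqDiff]
      rw [mul_add_one]
      refine ⟨by omega, trivial, trivial⟩)
    (by
      rintro s' - - ⟨h1, h2, h3⟩
      right
      have := Nat.div_add_mod a d
      have := Nat.mod_lt a hd
      simp only [Expr.eval, h3]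
      omega)
  obtain ⟨h1, h2, h3⟩ := h
  have h4 := Nat.div_add_mod a d
  simp only [divMod, den_seq, den_assign, Expr.eval, State.setVar_var]
  simp only [reduceIte, Nat.reduceEqDiff]
  exact ⟨h2, by omega⟩

theorem den_copy {a b : ℕ} {s : State} (hab : a ≠ b) (hB : s.var 5 ≤ s.var 1) :
    ∀ i < s.var 5, (den ω 1 (copy a b) s).arr b i = s.arr a i := by
  have h := rep_rule (ω := ω) (k := 1) (x := 101) (e := .sub (.var 5) (.var 28))
    (c := .write b (.var 28) (.read a (.var 28)) ;; .assign 28 (.add (.var 28) (.const 1)))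
    (fun j s' => s'.var 28 = j ∧ ∀ i < j, s'.arr b i = s.arr a i) (s.setVar 28 0) (s.var 5)
    (by simpa using hB)
    (by intro j s' v h; simpa using h)
    (by simp)
    (by
      rintro j s' hj hf hf' ⟨h1, h2⟩
      have h5 : s'.var 5 = s.var 5 := by
        rw [hf 5 (by decide) (by simp [vars])]; simp
      have ha : s'.arr a = s.arr a := by
        rw [hf' a (by simp [arrs, hab])]; simp
      refine ⟨by simp only [Expr.eval]; omega, ?_⟩
      simp only [den, Expr.eval, State.setVar_var, State.setArr_arr, State.setVar_arr,
        State.setArr_var, h1, ha]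
      refine ⟨by simp, fun i hi => ?_⟩
      by_cases hij : i = j
      · simp [hij]
      · simp [hij, h2 i (by omega)])
    (by
      rintro s' hf - ⟨h1, h2⟩
      right
      have h5 : s'.var 5 = s.var 5 := by
        rw [hf 5 (by decide) (by simp [vars])]; simp
      simp [Expr.eval, h1, h5])
  exact h.2

end Prog

end RandRAM

/-! ### Representation of colorings and tables in the memory; one step of the walks -/

namespace RandRAM

open EntropyCompression

/-- Array `a` holds the partial coloring `F`. -/
def Colors {n : ℕ} (s : State) (a : ℕ) (F : Sym2 (Fin n) → ℕ) : Prop :=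
  ∀ i j : Fin n, s.arr a (n * i.val + j.val) = F s(i, j)

/-- The tables and parameters that the coloring process uses. -/
structure Setup {n : ℕ} (G : SimpleGraph (Fin n)) (nb : Fin n → ℕ → Fin n) (D R b B : ℕ)
    (s : State) : Prop where
  var0 : s.var 0 = n
  var1 : s.var 1 = B
  var2 : s.var 2 = D
  var3 : s.var 3 = R
  var4 : s.var 4 = 2 ^ b
  var5 : s.var 5 = n * n
  adj : ∀ i j : Fin n, s.arr 0 (n * i.val + j.val) ≠ 0 ↔ G.Adj i j
  row : ∀ i : Fin n, s.arr 2 i.val = n * i.val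
  nbr : ∀ (i : Fin n), ∀ d < D, s.arr 3 (n * i.val + d) = (nb i d).val
  hD : 1 ≤ D
  hR : 1 ≤ R
  hn : n * n ≤ B
  hb : b ≤ B
  hRB : R ≤ B

/-- Variable `x` tells whether the partial coloring `o` exists, and then array `a` holds it. -/
def Tracks {n : ℕ} (s : State) (x a : ℕ) (o : Option (Sym2 (Fin n) → ℕ)) : Prop :=
  match o with
  | none => s.var x = 0
  | some F => s.var x = 1 ∧ Colors s a F

theorem index_inj {n a b c d : ℕ} (hb : b < n) (hd : d < n) :
    n * a + b = n * c + d ↔ a = c ∧ b = d := by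
  constructor
  · intro h
    have h1 : (n * a + b) / n = (n * c + d) / n := by rw [h]
    have hn : 0 < n := by omega
    rw [Nat.mul_add_div hn, Nat.mul_add_div hn, Nat.div_eq_of_lt hb, Nat.div_eq_of_lt hd] at h1
    have : a = c := by omega
    subst this
    exact ⟨rfl, by omega⟩
  · rintro ⟨rfl, rfl⟩; rfl

theorem index_lt {n a b : ℕ} (ha : a < n) (hb : b < n) : n * a + b < n * n := by
  calc n * a + b < n * a + n := by omega
    _ = n * (a + 1) := by ring
    _ ≤ n * n := Nat.mul_le_mul_left _ ha

namespace Prog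

variable {ω : ℕ → Bool} {n : ℕ} {G : SimpleGraph (Fin n)}
  {nb : Fin n → ℕ → Fin n} {D R b B : ℕ} {s : State}

/-- All parameters and tables live in variables below 6 and in arrays 0, 2, 3; array 1, the current
coloring, is free to change. -/
theorem _root_.RandRAM.Setup.congr (h : Setup G nb D R b B s) {s' : State}
    (hv : ∀ y < 6, s'.var y = s.var y) (ha : ∀ a < 4, a ≠ 1 → s'.arr a = s.arr a) :
    Setup G nb D R b B s' where
  var0 := by rw [hv 0 (by decide), h.var0]
  var1 := by rw [hv 1 (by decide), h.var1]
  var2 := by rw [hv 2 (by decide), h.var2]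
  var3 := by rw [hv 3 (by decide), h.var3]
  var4 := by rw [hv 4 (by decide), h.var4]
  var5 := by rw [hv 5 (by decide), h.var5]
  adj := by rw [ha 0 (by decide) (by decide)]; exact h.adj
  row := by rw [ha 2 (by decide) (by decide)]; exact h.row
  nbr := by rw [ha 3 (by decide) (by decide)]; exact h.nbr
  hD := h.hD
  hR := h.hR
  hn := h.hn
  hb := h.hb
  hRB := h.hRB

theorem _root_.RandRAM.Setup.setVar (h : Setup G nb D R b B s) {x : ℕ} (hx : 6 ≤ x) (v : ℕ) :
    Setup G nb D R b B (s.setVar x v) :=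
  h.congr (fun y hy => by simp [show y ≠ x by omega]) (fun _ _ _ => rfl)

theorem _root_.RandRAM.Setup.den (h : Setup G nb D R b B s) (c : Prog)
    (hv : ∀ y < 6, y ∉ c.vars) (ha : ∀ a < 4, a ≠ 1 → a ∉ c.arrs) :
    Setup G nb D R b B (den ω 1 c s) :=
  h.congr (fun y hy => den_var (hv y hy) s) (fun a h1 h2 => den_arr (ha a h1 h2) s)

theorem _root_.RandRAM.Setup.rep (h : Setup G nb D R b B s) {s' : State} {x : ℕ} (c : Prog)
    (hf : ∀ y, y ≠ x → y ∉ c.vars → s'.var y = s.var y)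
    (hf' : ∀ a, a ∉ c.arrs → s'.arr a = s.arr a) (hx : 6 ≤ x)
    (hv : ∀ y < 6, y ∉ c.vars) (ha : ∀ a < 4, a ≠ 1 → a ∉ c.arrs) :
    Setup G nb D R b B s' :=
  h.congr (fun y hy => hf y (by omega) (hv y hy)) (fun a h1 h2 => hf' a (ha a h1 h2))

/-- A coloring is stored as a symmetric matrix, hence the two writes. -/
theorem colors_erase {a : ℕ} {F : Sym2 (Fin n) → ℕ} (h : Colors s a F) (i j : Fin n) (v : ℕ) :
    Colors ((s.setArr a (n * i.val + j.val) v).setArr a (n * j.val + i.val) v) a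
      (Function.update F s(i, j) v) := by
  intro i' j'
  simp only [State.setArr_arr, true_and, index_inj j'.2 i.2, index_inj j'.2 j.2, Fin.val_inj,
    Function.update_apply, Sym2.eq_iff]
  rw [h i' j']
  by_cases h1 : i' = i ∧ j' = j
  · simp [h1]
  · by_cases h2 : i' = j ∧ j' = i
    · simp [h2]
    · simp [h1, h2]

theorem colors_at [NeZero n] {a : ℕ} {F : Sym2 (Fin n) → ℕ} (h : Colors s a F) {k : ℕ}
    (hk : k < n * n) : s.arr a k = F s(Fin.ofNat n (k / n), Fin.ofNat n k) := by
  have h1 : k / n < n := Nat.div_lt_of_lt_mul hk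
  rw [← h, Fin.val_ofNat, Fin.val_ofNat, Nat.mod_eq_of_lt h1, Nat.div_add_mod]

theorem adj_at [NeZero n] (h : Setup G nb D R b B s) {k : ℕ}
    (hk : k < n * n) : s.arr 0 k ≠ 0 ↔ G.Adj (Fin.ofNat n (k / n)) (Fin.ofNat n k) := by
  have h1 : k / n < n := Nat.div_lt_of_lt_mul hk
  rw [← h.adj, Fin.val_ofNat, Fin.val_ofNat, Nat.mod_eq_of_lt h1, Nat.div_add_mod]

theorem den_digit (h : Setup G nb D R b B s) {x y c : ℕ} {p : Fin n}
    (hx : x ∉ [10, 11, 12, 100]) (hy : 10 ≠ y) (hp : s.var x = p) (hc : s.var 10 = c)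
    (hcB : c ≤ B) :
    (den ω 1 (digit x y) s).var y = nb p (c % D) ∧ (den ω 1 (digit x y) s).var 10 = c / D := by
  obtain ⟨d1, d2⟩ := den_divMod (ω := ω) (y := 2) (by decide) h.hD h.var2 hc
    (by rw [h.var1]; exact hcB)
  have S1 := h.den (ω := ω) (divMod 2) (by decide) (by decide)
  have f1 : (den ω 1 (divMod 2) s).var x = p := by
    rw [den_var (by simp [divMod, vars] at hx ⊢; tauto), hp]
  rw [digit, den_seq, den_assign]
  constructor
  · rw [State.setVar_var, if_pos rfl, Expr.eval, eval_entry, f1, S1.row, d2,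
      S1.nbr _ _ (Nat.mod_lt _ h.hD)]
  · rw [State.setVar_var, if_neg hy, d1]

theorem den_eraseStep (h : Setup G nb D R b B s) {p p' : Fin n} (hp : s.var 13 = p)
    (hp' : s.var 20 = p') :
    (den ω 1 eraseStep s).var 22 = s.arr 4 (n * p + p') ∧
    ∀ F, Colors s 4 F → Colors (den ω 1 eraseStep s) 4 (Function.update F s(p, p') 0) := by
  have e : den ω 1 eraseStep s = ((s.setVar 22 (s.arr 4 (n * p + p'))).setArr 4
      (n * p + p') 0).setArr 4 (n * p' + p) 0 := by
    simp only [eraseStep, den_seq, den_assign, den_write, eval_entry, Expr.eval,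
      State.setVar_var, State.setVar_arr, State.setArr_var, Nat.reduceEqDiff, if_false, hp, hp',
      h.row, State.setArr_arr, false_and]
  rw [e]
  refine ⟨by simp, fun F hF => colors_erase ?_ p p' 0⟩
  exact hF

theorem den_checkStep (h : Setup G nb D R b B s) {q q' : Fin n} (hq : s.var 14 = q)
    (hq' : s.var 21 = q') :
    den ω 1 checkStep s =
      if s.var 22 ≠ 0 ∧ s.arr 4 (n * q + q') = s.var 22 then s else s.setVar 18 0 := by
  rw [checkStep, den_cond, den_cond, den_nop, den_assign]
  have e : (differ (.read 4 (entry 14 21)) (.var 22)).eval s = 0 ↔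
      s.arr 4 (n * q + q') = s.var 22 := by
    rw [eval_differ]
    simp only [Expr.eval, eval_entry, hq, hq', h.row]
  simp only [ne_eq, e, Expr.eval]
  split_ifs <;> simp_all

/-- One step of `eraseMatched`. These commands never set flag 18 again once it is cleared, so after
a failure the contents of array 4 do not matter. -/
theorem den_eraseStep_checkStep (h : Setup G nb D R b B s) {p p' q q' : Fin n}
    (hp : s.var 13 = p) (hp' : s.var 20 = p') (hq : s.var 14 = q) (hq' : s.var 21 = q')
    {o : Option (Sym2 (Fin n) → ℕ)} (ho : Tracks s 18 4 o) :
    Tracks (den ω 1 checkStep (den ω 1 eraseStep s)) 18 4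
      (o.bind (eraseMatched [(s(p, p'), s(q, q'))])) := by
  obtain ⟨h1, h2⟩ := den_eraseStep (ω := ω) h hp hp'
  have h3 := den_checkStep (ω := ω) (h.den (ω := ω) eraseStep (by decide) (by decide))
    (q := q) (q' := q') (by rw [den_var (by decide), hq]) (by rw [den_var (by decide), hq'])
  have h4 : (den ω 1 eraseStep s).var 18 = s.var 18 := den_var (by decide) s
  rw [h3, h1]
  rcases o with _ | F
  · simp only [Option.bind_none, Tracks] at ho ⊢
    split_ifs
    · rw [h4, ho]
    · simp
  · obtain ⟨ho1, ho2⟩ := ho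
    have hF := h2 F ho2
    rw [ho2 p p', hF q q']
    simp only [Option.bind_some, eraseMatched]
    split_ifs with hc
    · exact ⟨by rw [h4, ho1], hF⟩
    · simp [Tracks]

theorem den_walkBody (h : Setup G nb D R b B s) {p q : Fin n} {c : ℕ} (hp : s.var 13 = p)
    (hq : s.var 14 = q) (hc : s.var 10 = c) (hcB : c ≤ B) {o : Option (Sym2 (Fin n) → ℕ)}
    (ho : Tracks s 18 4 o) :
    (den ω 1 walkBody s).var 13 = (walkStep nb D (p, q, c)).1 ∧
    (den ω 1 walkBody s).var 14 = (walkStep nb D (p, q, c)).2.1 ∧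
    (den ω 1 walkBody s).var 10 = (walkStep nb D (p, q, c)).2.2 ∧
    (den ω 1 walkBody s).var 19 = s.var 19 + 1 ∧
    Tracks (den ω 1 walkBody s) 18 4 (o.bind (eraseMatched
      [(s(p, (walkStep nb D (p, q, c)).1), s(q, (walkStep nb D (p, q, c)).2.1))])) := by
  simp only [walkBody, den_seq, walkStep]
  obtain ⟨a1, a2⟩ := den_digit (ω := ω) h (x := 13) (y := 20) (by decide) (by decide) hp hc hcB
  have S1 := h.den (ω := ω) (digit 13 20) (by decide) (by decide)
  have T1 : Tracks (den ω 1 (digit 13 20) s) 18 4 o := by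
    simpa only [Tracks, Colors, den_var (show 18 ∉ (digit 13 20).vars by decide),
      den_arr (show 4 ∉ (digit 13 20).arrs by decide)] using ho
  have v13 : (den ω 1 (digit 13 20) s).var 13 = p := by rw [den_var (by decide), hp]
  have v14 : (den ω 1 (digit 13 20) s).var 14 = q := by rw [den_var (by decide), hq]
  have v19 : (den ω 1 (digit 13 20) s).var 19 = s.var 19 := den_var (by decide) s
  -- The state after each subprogram is replaced by a variable about which only the collected facts
  -- are kept.
  generalize den ω 1 (digit 13 20) s = s1 at a1 a2 S1 T1 v13 v14 v19 ⊢
  obtain ⟨b1, b2⟩ := den_digit (ω := ω) S1 (x := 14) (y := 21) (by decide) (by decide) v14 a2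
    ((Nat.div_le_self c D).trans hcB)
  have S2 := S1.den (ω := ω) (digit 14 21) (by decide) (by decide)
  have T2 : Tracks (den ω 1 (digit 14 21) s1) 18 4 o := by
    simpa only [Tracks, Colors, den_var (show 18 ∉ (digit 14 21).vars by decide),
      den_arr (show 4 ∉ (digit 14 21).arrs by decide)] using T1
  have w13 : (den ω 1 (digit 14 21) s1).var 13 = p := by rw [den_var (by decide), v13]
  have w14 : (den ω 1 (digit 14 21) s1).var 14 = q := by rw [den_var (by decide), v14]
  have w19 : (den ω 1 (digit 14 21) s1).var 19 = s.var 19 := by rw [den_var (by decide), v19]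
  have w20 : (den ω 1 (digit 14 21) s1).var 20 = nb p (c % D) := by rw [den_var (by decide), a1]
  generalize den ω 1 (digit 14 21) s1 = s2 at b1 b2 S2 T2 w13 w14 w19 w20 ⊢
  have T3 := den_eraseStep_checkStep (ω := ω) S2 w13 w20 w14 b1 T2
  have x10 : (den ω 1 checkStep (den ω 1 eraseStep s2)).var 10 = c / D / D := by
    rw [den_var (by decide), den_var (by decide), b2]
  have x19 : (den ω 1 checkStep (den ω 1 eraseStep s2)).var 19 = s.var 19 := by
    rw [den_var (by decide), den_var (by decide), w19]
  have x20 : (den ω 1 checkStep (den ω 1 eraseStep s2)).var 20 = nb p (c % D) := by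
    rw [den_var (by decide), den_var (by decide), w20]
  have x21 : (den ω 1 checkStep (den ω 1 eraseStep s2)).var 21 = nb q (c / D % D) := by
    rw [den_var (by decide), den_var (by decide), b1]
  generalize den ω 1 checkStep (den ω 1 eraseStep s2) = s3 at T3 x10 x19 x20 x21 ⊢
  refine ⟨?_, ?_, ?_, ?_, ?_⟩
  · simp [advance, den_seq, den_assign, Expr.eval, x20]
  · simp [advance, den_seq, den_assign, Expr.eval, x21]
  · rw [den_var (by decide), x10]
  · simp [advance, den_seq, den_assign, Expr.eval, x19]
  · simpa only [Tracks, Colors, den_var (show 18 ∉ advance.vars by decide),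
      den_arr (show 4 ∉ advance.arrs by decide)] using T3

end Prog

end RandRAM

/-! ### Verification of the trials, the search and the choice of an edge -/

namespace EntropyCompression

/-- Needed because the machine extends the list at its end, while `eraseMatched` recurses from the
front. -/
theorem eraseMatched_append {E : Type*} [DecidableEq E] (l l' : List (E × E)) (F : E → ℕ) :
    eraseMatched (l ++ l') F = (eraseMatched l F).bind (eraseMatched l') := by
  induction l generalizing F with
  | nil => rfl
  | cons pq l ih =>
    obtain ⟨p, q⟩ := pq
    simp only [List.cons_append, eraseMatched]
    split_ifs
    · exact ih _
    · rfl

theorem codeLength_le {n R c : ℕ} (hR : 1 ≤ R) : codeLength n R c ≤ R := by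
  have := Nat.mod_lt (c / n / n) hR
  rw [codeLength]; omega

/-- The unread part of the code only shrinks, so each division on it stays within the clock. -/
theorem codeWalks_le {n : ℕ} [NeZero n] (nb : Fin n → ℕ → Fin n) (D R c i : ℕ) :
    (codeWalks nb D R c i).2.2 ≤ c := by
  induction i with
  | zero => exact (Nat.div_le_self _ _).trans ((Nat.div_le_self _ _).trans (Nat.div_le_self _ _))
  | succ i ih =>
    rw [codeWalks, Function.iterate_succ_apply']
    exact (Nat.div_le_self _ _).trans ((Nat.div_le_self _ _).trans ih)

/-- A finished process is stationary, which matches the idle rounds of the machine. -/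
theorem process_of_none {E : Type*} [Fintype E] [DecidableEq E] {nxt : Finset E → Option E}
    {res : E → (E → ℕ) → (E → ℕ)} {F : E → ℕ} (h : nxt (dom F) = none) (b t : ℕ) (ω : ℕ → Bool) :
    process nxt res b t ω F = F := by
  cases t <;> simp [process, h]

end EntropyCompression

namespace RandRAM

open EntropyCompression

namespace Prog

variable {ω : ℕ → Bool} {n : ℕ} {G : SimpleGraph (Fin n)}
  {nb : Fin n → ℕ → Fin n} {D R b B : ℕ} {s : State}

theorem colors_copy (h : Setup G nb D R b B s) {x y : ℕ} (hxy : x ≠ y) {F : Sym2 (Fin n) → ℕ}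
    (hF : Colors s x F) : Colors (den ω 1 (copy x y) s) y F := by
  intro i j
  rw [den_copy hxy (by rw [h.var5, h.var1]; exact h.hn) _
    (by rw [h.var5]; exact index_lt i.2 j.2), hF]

variable [NeZero n]

theorem den_decodeStart (h : Setup G nb D R b B s) {c : ℕ} (hc : s.var 23 = c) (hcB : c ≤ B) :
    (den ω 1 decodeStart s).var 10 = c / n / n / R ∧
    (den ω 1 decodeStart s).var 13 = Fin.ofNat n c ∧
    (den ω 1 decodeStart s).var 14 = Fin.ofNat n (c / n) ∧
    (den ω 1 decodeStart s).var 15 = Fin.ofNat n c ∧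
    (den ω 1 decodeStart s).var 16 = Fin.ofNat n (c / n) ∧
    (den ω 1 decodeStart s).var 17 = codeLength n R c ∧
    (den ω 1 decodeStart s).var 18 = 1 ∧
    (den ω 1 decodeStart s).var 19 = 0 := by
  have hn : 0 < n := NeZero.pos n
  simp only [decodeStart, den_seq]
  have e0 : den ω 1 (.assign 10 (.var 23)) s = s.setVar 10 c := by
    rw [den_assign, Expr.eval, hc]
  rw [e0]
  have S0 := h.setVar (x := 10) (by decide) c
  obtain ⟨a1, a2⟩ := den_divMod (ω := ω) (y := 0) (s := s.setVar 10 c) (a := c) (by decide) hn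
    S0.var0 (by simp) (by rw [S0.var1]; exact hcB)
  have S1 := S0.den (ω := ω) (divMod 0) (by decide) (by decide)
  generalize den ω 1 (divMod 0) (s.setVar 10 c) = s1 at a1 a2 S1 ⊢
  have e1 : den ω 1 (.assign 13 (.var 11)) s1 = s1.setVar 13 (c % n) := by
    rw [den_assign, Expr.eval, a2]
  rw [e1]
  have S2 := S1.setVar (x := 13) (by decide) (c % n)
  have hc1 : c / n ≤ B := (Nat.div_le_self _ _).trans hcB
  obtain ⟨b1, b2⟩ := den_divMod (ω := ω) (y := 0) (s := s1.setVar 13 (c % n)) (a := c / n)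
    (by decide) hn S2.var0 (by simpa using a1) (by rw [S2.var1]; exact hc1)
  have S3 := S2.den (ω := ω) (divMod 0) (by decide) (by decide)
  have v13 : (den ω 1 (divMod 0) (s1.setVar 13 (c % n))).var 13 = c % n := by
    rw [den_var (by decide)]; simp
  generalize den ω 1 (divMod 0) (s1.setVar 13 (c % n)) = s2 at b1 b2 S3 v13 ⊢
  have e2 : den ω 1 (.assign 14 (.var 11)) s2 = s2.setVar 14 (c / n % n) := by
    rw [den_assign, Expr.eval, b2]
  rw [e2]
  have S4 := S3.setVar (x := 14) (by decide) (c / n % n)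
  have hc2 : c / n / n ≤ B := (Nat.div_le_self _ _).trans hc1
  obtain ⟨d1, d2⟩ := den_divMod (ω := ω) (y := 3) (s := s2.setVar 14 (c / n % n)) (a := c / n / n)
    (by decide) h.hR S4.var3 (by simpa using b1) (by rw [S4.var1]; exact hc2)
  have w13 : (den ω 1 (divMod 3) (s2.setVar 14 (c / n % n))).var 13 = c % n := by
    rw [den_var (by decide)]; simpa using v13
  have w14 : (den ω 1 (divMod 3) (s2.setVar 14 (c / n % n))).var 14 = c / n % n := by
    rw [den_var (by decide)]; simp
  generalize den ω 1 (divMod 3) (s2.setVar 14 (c / n % n)) = s3 at d1 d2 w13 w14 ⊢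
  simp [den_assign, Expr.eval, d1, d2, w13, w14, codeLength]

/-- The invariant follows `codeWalks`, with variable 10 holding the digits not yet consumed. -/
theorem den_walkLoop (h : Setup G nb D R b B s) {c : ℕ} (hcB : c ≤ B)
    (h10 : s.var 10 = c / n / n / R) (h13 : s.var 13 = Fin.ofNat n c)
    (h14 : s.var 14 = Fin.ofNat n (c / n)) (h17 : s.var 17 = codeLength n R c)
    (h18 : s.var 18 = 1) (h19 : s.var 19 = 0) {F : Sym2 (Fin n) → ℕ} (hF : Colors s 4 F) :
    (den ω 1 walkLoop s).var 13 = (codeWalks nb D R c (codeLength n R c)).1 ∧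
    (den ω 1 walkLoop s).var 14 = (codeWalks nb D R c (codeLength n R c)).2.1 ∧
    Tracks (den ω 1 walkLoop s) 18 4 (eraseMatched (walkPairs (fun i => (codeWalks nb D R c i).1)
      (fun i => (codeWalks nb D R c i).2.1) (codeLength n R c)) F) := by
  have hstep : ∀ i, walkStep nb D (codeWalks nb D R c i) = codeWalks nb D R c (i + 1) := by
    intro i; rw [codeWalks, codeWalks, Function.iterate_succ_apply']
  have H := rep_rule (ω := ω) (k := 1) (x := 102) (e := .sub (.var 17) (.var 19)) (c := walkBody)
    (fun j s' => s'.var 13 = (codeWalks nb D R c j).1 ∧ s'.var 14 = (codeWalks nb D R c j).2.1 ∧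
      s'.var 10 = (codeWalks nb D R c j).2.2 ∧ s'.var 19 = j ∧
      Tracks s' 18 4 (eraseMatched (walkPairs (fun i => (codeWalks nb D R c i).1)
      (fun i => (codeWalks nb D R c i).2.1) j) F)) s (codeLength n R c)
    (by rw [h.var1]; exact (codeLength_le h.hR).trans h.hRB)
    (by
      rintro j s' v ⟨a1, a2, a3, a4, a5⟩
      refine ⟨by simpa using a1, by simpa using a2, by simpa using a3, by simpa using a4, ?_⟩
      rcases ho : eraseMatched (walkPairs (fun i => (codeWalks nb D R c i).1)
        (fun i => (codeWalks nb D R c i).2.1) j) F with _ | F' <;> rw [ho] at a5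
      · simpa [Tracks] using a5
      · exact ⟨by simpa using a5.1, a5.2⟩)
    ⟨h13, h14, h10, h19, h18, hF⟩
    (by
      rintro j s' hj hf hf' ⟨a1, a2, a3, a4, a5⟩
      have S' := h.rep walkBody hf hf' (by decide) (by decide) (by decide)
      have h17' : s'.var 17 = codeLength n R c := by rw [hf 17 (by decide) (by decide), h17]
      refine ⟨by simp only [Expr.eval, a4, h17']; omega, ?_⟩
      obtain ⟨b1, b2, b3, b4, b5⟩ := den_walkBody (ω := ω) S' a1 a2 a3
        ((codeWalks_le nb D R c j).trans hcB) a5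
      rw [hstep] at b1 b2 b3 b5
      refine ⟨b1, b2, b3, by rw [b4, a4], ?_⟩
      rw [walkPairs, List.range_succ, List.map_append, eraseMatched_append]
      exact b5)
    (by
      rintro s' hf - ⟨-, -, -, a4, -⟩
      right
      have h17' : s'.var 17 = codeLength n R c := by rw [hf 17 (by decide) (by decide), h17]
      simp [Expr.eval, a4, h17'])
  exact ⟨H.1, H.2.1, H.2.2.2.2⟩

theorem den_finalCheck {P₀ Q₀ P₁ Q₁ r k : ℕ} (h3 : s.var 3 = R) (h17 : s.var 17 = r) (hr : r ≤ R)
    (h13 : s.var 13 = P₁) (h14 : s.var 14 = Q₁) (h15 : s.var 15 = P₀) (h16 : s.var 16 = Q₀)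
    (h25 : s.var 25 = k + 1) :
    den ω 1 finalCheck s =
      if (r = R ∨ P₁ = Q₀ ∨ Q₁ = P₀) ∧ s.arr 4 k = 0 then s else s.setVar 18 0 := by
  have e1 : (differ (.var 13) (.var 16)).eval s = 0 ↔ P₁ = Q₀ := by
    rw [eval_differ]; simp [Expr.eval, h13, h16]
  have e2 : (differ (.var 14) (.var 15)).eval s = 0 ↔ Q₁ = P₀ := by
    rw [eval_differ]; simp [Expr.eval, h14, h15]
  -- Truncated subtraction tests equality here because `r ≤ R`.
  have e3 : (Expr.sub (.var 3) (.var 17)).eval s = 0 ↔ r = R := by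
    simp only [Expr.eval, h3, h17]; omega
  have e5 : (Expr.read 4 (.sub (.var 25) (.const 1))).eval s = s.arr 4 k := by
    simp [Expr.eval, h25]
  have e6 : (Expr.const 0).eval s = 0 := rfl
  have e7 : (s.setVar 18 0).setVar 18 0 = s.setVar 18 0 := by simp [State.setVar]
  simp only [finalCheck, den_seq, den_cond, den_nop, den_assign, ne_eq, e1, e2, e3, ite_not]
  by_cases c1 : r = R
  · simp only [if_pos c1, e5, e6]
    split_ifs <;> simp_all
  by_cases c2 : P₁ = Q₀
  · simp only [if_neg c1, if_pos c2, e5, e6]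
    split_ifs <;> simp_all
  by_cases c3 : Q₁ = P₀
  · simp only [if_neg c1, if_neg c2, if_pos c3, e5, e6]
    split_ifs <;> simp_all
  · simp only [if_neg c1, if_neg c2, if_neg c3, Expr.eval, e7, ite_self]
    simp [c1, c2, c3]

/-- Variable `24` tells whether the partial coloring `o` exists; array `1` holds it, or else `F`. -/
def Found (s : State) (o : Option (Sym2 (Fin n) → ℕ)) (F : Sym2 (Fin n) → ℕ) : Prop :=
  s.var 24 = (if o.isSome then 1 else 0) ∧ Colors s 1 (o.getD F)

/-- The trial works on the copy in array 4, so a failure leaves the coloring in array 1 intact; only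
a success is copied back. -/
theorem den_trialBody (h : Setup G nb D R b B s) {c : ℕ} (hc : s.var 23 = c) (hcB : c ≤ B)
    {F : Sym2 (Fin n) → ℕ} (hF : Colors s 1 F) {i j : Fin n}
    (h25 : s.var 25 = n * i.val + j.val + 1) (h24 : s.var 24 = 0) :
    Found (den ω 1 trialBody s) (trial nb D R s(i, j) F c) F := by
  simp only [trialBody, den_seq]
  obtain ⟨a10, a13, a14, a15, a16, a17, a18, a19⟩ := den_decodeStart (ω := ω) h hc hcB
  have S1 := h.den (ω := ω) decodeStart (by decide) (by decide)
  have F1 : Colors (den ω 1 decodeStart s) 1 F := by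
    intro i j; rw [den_arr (by decide), hF]
  have v25 : (den ω 1 decodeStart s).var 25 = n * i.val + j.val + 1 := by
    rw [den_var (by decide), h25]
  have v24 : (den ω 1 decodeStart s).var 24 = 0 := by rw [den_var (by decide), h24]
  generalize den ω 1 decodeStart s = s1 at a10 a13 a14 a15 a16 a17 a18 a19 S1 F1 v25 v24 ⊢
  have F2 := colors_copy (ω := ω) S1 (show 1 ≠ 4 by decide) F1
  have F2' : Colors (den ω 1 (copy 1 4) s1) 1 F := by
    intro i j; rw [den_arr (by decide), F1]
  have S2 := S1.den (ω := ω) (copy 1 4) (by decide) (by decide)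
  have f2 : ∀ y, y ∉ (copy 1 4).vars → (den ω 1 (copy 1 4) s1).var y = s1.var y :=
    fun y hy => den_var hy s1
  generalize den ω 1 (copy 1 4) s1 = s2 at F2 F2' S2 f2 ⊢
  obtain ⟨b13, b14, bT⟩ := den_walkLoop (ω := ω) S2 hcB (by rw [f2 10 (by decide), a10])
    (by rw [f2 13 (by decide), a13]) (by rw [f2 14 (by decide), a14])
    (by rw [f2 17 (by decide), a17]) (by rw [f2 18 (by decide), a18])
    (by rw [f2 19 (by decide), a19]) F2
  have S3 := S2.den (ω := ω) walkLoop (by decide) (by decide)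
  have F3 : Colors (den ω 1 walkLoop s2) 1 F := by
    intro i j; rw [den_arr (by decide), F2']
  have f3 : ∀ y, y ∉ walkLoop.vars → (den ω 1 walkLoop s2).var y = s2.var y :=
    fun y hy => den_var hy s2
  generalize den ω 1 walkLoop s2 = s3 at b13 b14 bT S3 F3 f3 ⊢
  have hfc := den_finalCheck (ω := ω) S3.var3
    (by rw [f3 17 (by decide), f2 17 (by decide), a17]) (codeLength_le h.hR) b13 b14
    (by rw [f3 15 (by decide), f2 15 (by decide), a15])
    (by rw [f3 16 (by decide), f2 16 (by decide), a16])
    (by rw [f3 25 (by decide), f2 25 (by decide), v25])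
  have w24 : s3.var 24 = 0 := by rw [f3 24 (by decide), f2 24 (by decide), v24]
  rw [hfc]
  have z1 : (codeWalks nb D R c 0).1 = Fin.ofNat n c := rfl
  have z2 : (codeWalks nb D R c 0).2.1 = Fin.ofNat n (c / n) := rfl
  have hfail : ∀ s', s'.var 18 = 0 → s'.var 24 = 0 → s'.arr = s3.arr →
      Found (den ω 1 (.cond (.var 18) (.assign 24 (.const 1) ;; copy 4 1) nop) s') none F := by
    intro s' h1 h2 h3
    rw [den_cond, den_nop]
    simp only [Expr.eval, h1, ne_eq, not_true_eq_false, if_false]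
    refine ⟨h2, fun i j => ?_⟩
    rw [h3]; exact F3 i j
  simp only [trial, z1, z2]
  rcases ho : eraseMatched (walkPairs (fun i => (codeWalks nb D R c i).1)
      (fun i => (codeWalks nb D R c i).2.1) (codeLength n R c)) F with _ | F' <;> rw [ho] at bT
  · rw [Option.bind_none]
    refine hfail _ ?_ ?_ ?_ <;> split_ifs
    · exact bT
    · simp
    · exact w24
    · simpa using w24
    · rfl
    · rfl
  · rw [Option.bind_some]
    simp only [Fin.val_inj, bT.2 i j]
    split_ifs with hcond
    · rw [den_cond]
      have h18 : (Expr.var 18).eval s3 = 1 := bT.1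
      rw [h18, if_pos (by decide), den_seq, den_assign]
      have S4 := S3.setVar (x := 24) (by decide) ((Expr.const 1).eval s3)
      refine ⟨?_, colors_copy (ω := ω) S4 (show 4 ≠ 1 by decide) ?_⟩
      · rw [den_var (by decide)]; simp [Expr.eval]
      · exact bT.2
    · exact hfail _ (by simp) (by simpa using w24) rfl

/-- Once variable 24 is set, the remaining rounds skip the trial; this is how `Option.or` keeps the
first success. -/
theorem den_searchLoop (h : Setup G nb D R b B s) {F : Sym2 (Fin n) → ℕ} (hF : Colors s 1 F)
    {i j : Fin n} (h25 : s.var 25 = n * i.val + j.val + 1) :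
    Colors (den ω 1 searchLoop s) 1 (resolve nb D R B s(i, j) F) := by
  simp only [searchLoop, den_seq, den_assign]
  have e0 : ((s.setVar 24 ((Expr.const 0).eval s)).setVar 23
    ((Expr.const 0).eval (s.setVar 24 ((Expr.const 0).eval s)))) = (s.setVar 24 0).setVar 23 0 := rfl
  rw [e0]
  have S0 := (h.setVar (x := 24) (by decide) 0).setVar (x := 23) (by decide) 0
  have h25' : ((s.setVar 24 0).setVar 23 0).var 25 = n * i.val + j.val + 1 := by simpa using h25
  have hI0 : Found ((s.setVar 24 0).setVar 23 0) (search nb D R s(i, j) F 0) F ∧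
      ((s.setVar 24 0).setVar 23 0).var 23 = 0 := ⟨⟨by simp [search], hF⟩, by simp⟩
  generalize (s.setVar 24 0).setVar 23 0 = s0 at S0 h25' hI0 ⊢
  have H := rep_rule (ω := ω) (k := 1) (x := 103) (e := .sub (.var 1) (.var 23))
    (c := .cond (.var 24) nop trialBody ;; .assign 23 (.add (.var 23) (.const 1)))
    (fun k s' => Found s' (search nb D R s(i, j) F k) F ∧ s'.var 23 = k) s0 B
    (by rw [S0.var1])
    (by
      rintro k s' v ⟨a1, a2⟩
      exact ⟨⟨by simpa using a1.1, a1.2⟩, by simpa using a2⟩)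
    hI0
    (by
      rintro k s' hk hf hf' ⟨a1, a2⟩
      have S' := S0.rep _ hf hf' (by decide) (by decide) (by decide)
      have b25 : s'.var 25 = n * i.val + j.val + 1 := by
        rw [hf 25 (by decide) (by decide), h25']
      refine ⟨by simp only [Expr.eval, a2, S'.var1]; omega, ?_⟩
      rw [den_seq, den_assign]
      have hinc : ∀ s'' : State, s''.var 23 = k → ∀ o, Found s'' o F →
          Found (s''.setVar 23 ((Expr.add (.var 23) (.const 1)).eval s'')) o F ∧
          (s''.setVar 23 ((Expr.add (.var 23) (.const 1)).eval s'')).var 23 = k + 1 := by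
        intro s'' h1 o h2
        exact ⟨⟨by simpa using h2.1, h2.2⟩, by simp [Expr.eval, h1]⟩
      rcases ho : search nb D R s(i, j) F k with _ | F'
      · rw [ho] at a1
        have b24 : (Expr.var 24).eval s' = 0 := a1.1
        rw [den_cond, b24, if_neg (by decide), search, ho, Option.none_or]
        refine hinc _ ?_ _ (den_trialBody S' a2 (by omega) a1.2 b25 a1.1)
        rw [den_var (by decide), a2]
      · rw [ho] at a1
        have b24 : (Expr.var 24).eval s' = 1 := a1.1
        rw [den_cond, b24, if_pos (by decide), search, ho, Option.some_or, den_nop]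
        exact hinc _ a2 _ a1)
    (by
      rintro s' hf hf' ⟨-, a2⟩
      left
      rw [S0.var1])
  exact H.1.2

variable [DecidableRel G.Adj]

theorem den_findEdge (h : Setup G nb D R b B s) {F : Sym2 (Fin n) → ℕ} (hF : Colors s 1 F) :
    (den ω 1 findEdge s).var 25 = lastUncolored G (dom F) (n * n) := by
  simp only [findEdge, den_seq, den_assign]
  have e0 : ((s.setVar 25 ((Expr.const 0).eval s)).setVar 28
    ((Expr.const 0).eval (s.setVar 25 ((Expr.const 0).eval s)))) = (s.setVar 25 0).setVar 28 0 := rfl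
  rw [e0]
  have S0 := (h.setVar (x := 25) (by decide) 0).setVar (x := 28) (by decide) 0
  have hF0 : Colors ((s.setVar 25 0).setVar 28 0) 1 F := hF
  have hI0 : ((s.setVar 25 0).setVar 28 0).var 25 = lastUncolored G (dom F) 0 ∧
      ((s.setVar 25 0).setVar 28 0).var 28 = 0 := by simp [lastUncolored]
  generalize (s.setVar 25 0).setVar 28 0 = s0 at S0 hF0 hI0 ⊢
  have H := rep_rule (ω := ω) (k := 1) (x := 104) (e := .sub (.var 5) (.var 28))
    (c := .cond (.read 0 (.var 28))
      (.cond (.read 1 (.var 28)) nop (.assign 25 (.add (.var 28) (.const 1)))) nop ;;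
      .assign 28 (.add (.var 28) (.const 1)))
    (fun k s' => s'.var 25 = lastUncolored G (dom F) k ∧ s'.var 28 = k) s0 (n * n)
    (by rw [S0.var1]; exact S0.hn)
    (by
      rintro k s' v ⟨a1, a2⟩
      exact ⟨by simpa using a1, by simpa using a2⟩)
    hI0
    (by
      rintro k s' hk hf hf' ⟨a1, a2⟩
      have S' := S0.rep _ hf hf' (by decide) (by decide) (by decide)
      have hF' : Colors s' 1 F := by
        intro i j; rw [hf' 1 (by decide), hF0]
      refine ⟨by simp only [Expr.eval, a2, S'.var5]; omega, ?_⟩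
      have c1 : (Expr.read 0 (.var 28)).eval s' ≠ 0 ↔
          G.Adj (Fin.ofNat n (k / n)) (Fin.ofNat n k) := by
        simp only [Expr.eval, a2]; exact adj_at S' hk
      have c2 : (Expr.read 1 (.var 28)).eval s' ≠ 0 ↔
          s(Fin.ofNat n (k / n), Fin.ofNat n k) ∈ dom F := by
        simp only [Expr.eval, a2, mem_dom]; rw [colors_at hF' hk]
      rw [den_seq, den_assign, den_cond, den_cond, den_nop, den_assign, lastUncolored]
      simp only [c1, c2]
      have e : (Expr.add (.var 28) (.const 1)).eval s' = k + 1 := by simp [Expr.eval, a2]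
      rw [e]
      by_cases h1 : G.Adj (Fin.ofNat n (k / n)) (Fin.ofNat n k) <;>
        by_cases h2 : s(Fin.ofNat n (k / n), Fin.ofNat n k) ∈ dom F
      · rw [if_pos h1, if_pos h2, if_neg (by tauto)]
        simp [Expr.eval, a1, a2]
      · rw [if_pos h1, if_neg h2, if_pos ⟨h1, h2⟩]
        simp [Expr.eval, a2]
      · rw [if_neg h1, if_neg (by tauto)]
        simp [Expr.eval, a1, a2]
      · rw [if_neg h1, if_neg (by tauto)]
        simp [Expr.eval, a1, a2])
    (by
      rintro s' hf hf' ⟨-, a2⟩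
      right
      have S' := S0.rep _ hf hf' (by decide) (by decide) (by decide)
      simp [Expr.eval, a2, S'.var5])
  exact H.1

end Prog

end RandRAM

/-! ### Verification of a coloring round and of the whole coloring loop -/

namespace RandRAM

open EntropyCompression

namespace Prog

variable {ω : ℕ → Bool} {n : ℕ} {G : SimpleGraph (Fin n)}
  {nb : Fin n → ℕ → Fin n} {D R b B : ℕ} {s : State}

/-- Variable 29 doubles until it reaches `2 ^ b`, so exactly `b` coins are flipped. The shift by one
that avoids the value 0 (uncolored) is left to `setColor`. -/
theorem den_randomColor (h : Setup G nb D R b B s) :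
    (den ω 1 randomColor s).var 30 = bitsValue (fun i => ω (s.flips + i)) b ∧
    (den ω 1 randomColor s).flips = s.flips + b := by
  simp only [randomColor, den_seq, den_assign]
  have e0 : ((s.setVar 30 ((Expr.const 0).eval s)).setVar 29
    ((Expr.const 1).eval (s.setVar 30 ((Expr.const 0).eval s)))) = (s.setVar 30 0).setVar 29 1 := rfl
  rw [e0]
  have S0 := (h.setVar (x := 30) (by decide) 0).setVar (x := 29) (by decide) 1
  have hI0 : ((s.setVar 30 0).setVar 29 1).var 29 = 2 ^ 0 ∧ ((s.setVar 30 0).setVar 29 1).var 30 =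
      bitsValue (fun i => ω (s.flips + i)) 0 ∧
      ((s.setVar 30 0).setVar 29 1).flips = s.flips + 0 := by simp [bitsValue]
  generalize (s.setVar 30 0).setVar 29 1 = s0 at S0 hI0 ⊢
  have H := rep_rule (ω := ω) (k := 1) (x := 105) (e := .sub (.var 4) (.var 29))
    (c := .flip 31 ;; .assign 30 (.add (.add (.var 30) (.var 30)) (.var 31)) ;;
      .assign 29 (.add (.var 29) (.var 29)))
    (fun k s' => s'.var 29 = 2 ^ k ∧ s'.var 30 = bitsValue (fun i => ω (s.flips + i)) k ∧
      s'.flips = s.flips + k) s0 b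
    (by rw [S0.var1]; exact S0.hb)
    (by
      rintro k s' v ⟨a1, a2, a3⟩
      exact ⟨by simpa using a1, by simpa using a2, by simpa using a3⟩)
    hI0
    (by
      rintro k s' hk hf hf' ⟨a1, a2, a3⟩
      have S' := S0.rep _ hf hf' (by decide) (by decide) (by decide)
      have hlt : (2 : ℕ) ^ k < 2 ^ b := Nat.pow_lt_pow_right (by decide) hk
      refine ⟨by simp only [Expr.eval, a1, S'.var4]; omega, ?_⟩
      have e : den ω 1 (.flip 31) s' =
          { s'.setVar 31 (ω s'.flips).toNat with flips := s'.flips + 1 } := rfl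
      rw [den_seq, den_seq, den_assign, den_assign, e]
      simp only [Expr.eval, State.setVar_var, State.setVar_flips, a1, a2, a3, bitsValue,
        Nat.reduceEqDiff, if_true, if_false]
      refine ⟨by rw [pow_succ]; omega, ?_, by omega⟩
      omega)
    (by
      rintro s' hf hf' ⟨a1, -, -⟩
      right
      have S' := S0.rep _ hf hf' (by decide) (by decide) (by decide)
      simp [Expr.eval, a1, S'.var4])
  exact ⟨H.2.1, H.2.2⟩

variable [NeZero n]

theorem den_setColor (h : Setup G nb D R b B s) {F : Sym2 (Fin n) → ℕ} (hF : Colors s 1 F)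
    {k c : ℕ} (h25 : s.var 25 = k + 1) (hk : k < n * n) (h30 : s.var 30 = c) :
    Colors (den ω 1 setColor s) 1
      (Function.update F s(Fin.ofNat n (k / n), Fin.ofNat n k) (c + 1)) := by
  simp only [setColor, den_seq]
  have e0 : den ω 1 (.assign 10 (.sub (.var 25) (.const 1))) s = s.setVar 10 k := by
    rw [den_assign]; simp [Expr.eval, h25]
  rw [e0]
  have S0 := h.setVar (x := 10) (by decide) k
  have F0 : Colors (s.setVar 10 k) 1 F := hF
  have v30 : (s.setVar 10 k).var 30 = c := by simpa using h30
  obtain ⟨a1, a2⟩ := den_divMod (ω := ω) (y := 0) (s := s.setVar 10 k) (a := k) (by decide)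
    (NeZero.pos n) S0.var0 (by simp) (by rw [S0.var1]; exact hk.le.trans S0.hn)
  have S1 := S0.den (ω := ω) (divMod 0) (by decide) (by decide)
  have F1 : Colors (den ω 1 (divMod 0) (s.setVar 10 k)) 1 F := by
    intro i j; rw [den_arr (by decide), F0]
  have w30 : (den ω 1 (divMod 0) (s.setVar 10 k)).var 30 = c := by rw [den_var (by decide), v30]
  generalize den ω 1 (divMod 0) (s.setVar 10 k) = s1 at a1 a2 S1 F1 w30 ⊢
  have hkn : k / n < n := Nat.div_lt_of_lt_mul hk
  set i : Fin n := Fin.ofNat n (k / n) with hi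
  set j : Fin n := Fin.ofNat n k with hj
  have hi' : s1.var 10 = i := by rw [a1, hi, Fin.val_ofNat, Nat.mod_eq_of_lt hkn]
  have hj' : s1.var 11 = j := by rw [a2, hj, Fin.val_ofNat]
  have key : den ω 1 (.write 1 (entry 27 26) (.add (.var 30) (.const 1)))
      (den ω 1 (.write 1 (entry 26 27) (.add (.var 30) (.const 1)))
        (den ω 1 (.assign 27 (.var 11)) (den ω 1 (.assign 26 (.var 10)) s1))) =
      (((s1.setVar 26 i).setVar 27 j).setArr 1 (n * i.val + j.val) (c + 1)).setArr 1
        (n * j.val + i.val) (c + 1) := by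
    simp only [den_assign, den_write, eval_entry, Expr.eval, State.setVar_var, State.setVar_arr,
      State.setArr_var, Nat.reduceEqDiff, if_false, if_true, hi', hj', w30, S1.row,
      State.setArr_arr, false_and]
  rw [key]
  exact colors_erase F1 i j (c + 1)

variable [DecidableRel G.Adj]

/-- The first alternative makes no claim about `flips`: a finished process reads no more coins. -/
theorem den_roundBody (h : Setup G nb D R b B s) {F : Sym2 (Fin n) → ℕ} (hF : Colors s 1 F) :
    (nextEdge G (dom F) = none ∧ Colors (den ω 1 roundBody s) 1 F) ∨
    ∃ e, nextEdge G (dom F) = some e ∧ (den ω 1 roundBody s).flips = s.flips + b ∧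
      Colors (den ω 1 roundBody s) 1 (resolve nb D R B e
        (Function.update F e (bitsValue (fun i => ω (s.flips + i)) b + 1))) := by
  simp only [roundBody, den_seq]
  have h25 := den_findEdge (ω := ω) h hF
  have S1 := h.den (ω := ω) findEdge (by decide) (by decide)
  have F1 : Colors (den ω 1 findEdge s) 1 F := by
    intro i j; rw [den_arr (by decide), hF]
  have fl1 : (den ω 1 findEdge s).flips = s.flips := den_flips (by decide) s
  generalize den ω 1 findEdge s = s1 at h25 S1 F1 fl1 ⊢
  rw [den_cond, den_nop, Expr.eval, h25, nextEdge]
  by_cases h0 : lastUncolored G (dom F) (n * n) = 0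
  · left
    rw [if_pos h0, if_neg (by simpa using h0)]
    exact ⟨rfl, F1⟩
  · right
    obtain ⟨hle, -, -⟩ := lastUncolored_spec (dom F) _ h0
    rw [if_pos h0, if_neg h0]
    refine ⟨_, rfl, ?_⟩
    set k := lastUncolored G (dom F) (n * n) - 1 with hk
    have h25' : s1.var 25 = k + 1 := by omega
    rw [den_seq, den_seq]
    obtain ⟨c1, c2⟩ := den_randomColor (ω := ω) S1
    have S2 := S1.den (ω := ω) randomColor (by decide) (by decide)
    have F2 : Colors (den ω 1 randomColor s1) 1 F := by
      intro i j; rw [den_arr (by decide), F1]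
    have v25 : (den ω 1 randomColor s1).var 25 = k + 1 := by rw [den_var (by decide), h25']
    rw [fl1] at c1 c2
    generalize den ω 1 randomColor s1 = s2 at c1 c2 S2 F2 v25 ⊢
    have hkn : k < n * n := by omega
    have F3 := den_setColor (ω := ω) S2 F2 v25 hkn c1
    have S3 := S2.den (ω := ω) setColor (by decide) (by decide)
    have w25 : (den ω 1 setColor s2).var 25 = k + 1 := by rw [den_var (by decide), v25]
    have fl3 : (den ω 1 setColor s2).flips = s.flips + b := by rw [den_flips (by decide), c2]
    generalize den ω 1 setColor s2 = s3 at F3 S3 w25 fl3 ⊢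
    refine ⟨by rw [den_flips (by decide), fl3], den_searchLoop (ω := ω) S3 F3 ?_⟩
    have hdiv : k / n < n := Nat.div_lt_of_lt_mul hkn
    rw [w25, Fin.val_ofNat, Fin.val_ofNat, Nat.mod_eq_of_lt hdiv, Nat.div_add_mod]

/-- Invariant: `t` more rounds of the process from the current state give what `t + j` rounds give
from the start. The conclusion is the case `t = 0` after `B` rounds. -/
theorem den_coloringLoop (h : Setup G nb D R b B s) {F : Sym2 (Fin n) → ℕ} (hF : Colors s 1 F) :
    Colors (den ω 1 coloringLoop s) 1 (process (nextEdge G) (resolve nb D R B) b B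
      (fun i => ω (s.flips + i)) F) := by
  have H := rep_rule (ω := ω) (k := 1) (x := 106) (e := .const 1) (c := roundBody)
    (fun j s' => ∃ F' : Sym2 (Fin n) → ℕ, Colors s' 1 F' ∧ ∀ t,
      process (nextEdge G) (resolve nb D R B) b t (fun i => ω (s'.flips + i)) F' =
        process (nextEdge G) (resolve nb D R B) b (t + j) (fun i => ω (s.flips + i)) F) s B
    (by rw [h.var1])
    (by rintro k s' v ⟨F', a1, a2⟩; exact ⟨F', a1, a2⟩)
    ⟨F, hF, fun t => rfl⟩
    (by
      rintro j s' hj hf hf' ⟨F', a1, a2⟩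
      refine ⟨by simp [Expr.eval], ?_⟩
      have S' := h.rep _ hf hf' (by decide) (by decide) (by decide)
      rcases den_roundBody (ω := ω) S' a1 with ⟨hn, hC⟩ | ⟨e, he, hfl, hC⟩
      · refine ⟨F', hC, fun t => ?_⟩
        rw [process_of_none hn, show t + (j + 1) = t + 1 + j by omega, ← a2, process_of_none hn]
      · refine ⟨_, hC, fun t => ?_⟩
        rw [show t + (j + 1) = t + 1 + j by omega, ← a2]
        conv_rhs => rw [process]
        simp only [he, hfl, add_assoc])
    (by rintro s' - - -; left; rw [h.var1])
  obtain ⟨F', h1, h2⟩ := H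
  have := h2 0
  rw [zero_add] at this
  rw [coloringLoop, ← this]
  exact h1

end Prog

end RandRAM

/-! ### Computation of the clock, the tables and the parameters -/

namespace RandRAM

open EntropyCompression

namespace Prog

/-- Put `(n + 2) ^ K` into variable `1`; to be run with variable `0` as the clock. -/
def clockProg : ℕ → Prog
  | 0 => .assign 1 (.const 1)
  | K + 1 => clockProg K ;; .assign 6 (.add (.var 1) (.var 1)) ;;
      .rep 100 (.const 1) (.assign 6 (.add (.var 6) (.var 1))) ;; .assign 1 (.var 6)

/-- Compute the multiples of `n`. -/
def rowsProg : Prog :=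
  .assign 7 (.const 0) ;;
  .assign 5 (.const 0) ;;
  .rep 100 (.sub (.var 0) (.var 7))
    (.write 2 (.var 7) (.var 5) ;; .assign 5 (.add (.var 5) (.var 0)) ;;
    .assign 7 (.add (.var 7) (.const 1)))

/-- Look at the entry in row `7` and column `8` of the adjacency matrix. -/
def neighborStep : Prog :=
  .cond (.read 0 (entry 7 8))
    (.write 3 (entry 7 9) (.var 8) ;; .assign 9 (.add (.var 9) (.const 1)) ;;
      .cond (.sub (.var 9) (.var 2)) (.assign 2 (.var 9)) nop) nop ;;
  .assign 8 (.add (.var 8) (.const 1))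

/-- List the neighbors of vertex `7`. -/
def neighborRow : Prog :=
  .assign 8 (.const 0) ;; .assign 9 (.const 0) ;;
  .rep 100 (.sub (.var 0) (.var 8)) neighborStep ;;
  .assign 7 (.add (.var 7) (.const 1))

/-- List the neighbors of every vertex, and find the maximum degree. -/
def neighborsProg : Prog :=
  .assign 2 (.const 0) ;; .assign 7 (.const 0) ;;
  .rep 101 (.sub (.var 0) (.var 7)) neighborRow ;;
  .assign 2 (.add (.var 2) (.const 2))

/-- Multiply variable `x` by variable `y`. -/
def mulProg (x y : ℕ) : Prog :=
  .assign 9 (.const 0) ;; .assign 8 (.const 0) ;;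
  .rep 100 (.sub (.var y) (.var 8))
    (.assign 9 (.add (.var 9) (.var x)) ;; .assign 8 (.add (.var 8) (.const 1))) ;;
  .assign x (.var 9)

/-- Multiply variable `x` by variable `y`, `j` times. -/
def powProg (x y : ℕ) : ℕ → Prog
  | 0 => nop
  | j + 1 => powProg x y j ;; mulProg x y

/-- Compute the least positive exponent `R` with `n ^ m ≤ D ^ R`. -/
def exponentProg (m : ℕ) : Prog :=
  .assign 7 (.const 1) ;; powProg 7 0 m ;; .assign 6 (.var 2) ;; .assign 3 (.const 1) ;;
  .rep 101 (.sub (.var 7) (.var 6)) (mulProg 6 2 ;; .assign 3 (.add (.var 3) (.const 1)))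

/-- A multiple of an expression. -/
def smulExpr (e : Expr) : ℕ → Expr
  | 0 => .const 0
  | j + 1 => .add (smulExpr e j) e

/-- Compute the least power `N` of two with `64 ^ m * D ^ (2 * m + 1) ≤ N ^ m`. -/
def paletteProg (m : ℕ) : Prog :=
  .assign 7 (.const (64 ^ m)) ;; powProg 7 2 (2 * m + 1) ;; .assign 6 (.const 1) ;;
  .assign 4 (.const 1) ;;
  .rep 101 (.sub (.var 7) (.var 6))
    (.assign 6 (smulExpr (.var 6) (2 ^ m)) ;; .assign 4 (.add (.var 4) (.var 4)))

/-- The part of the program that flips no coins. -/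
def prepare (m : ℕ) : Prog := rowsProg ;; neighborsProg ;; exponentProg m ;; paletteProg m

variable {ω : ℕ → Bool} {n B : ℕ} {s : State}

theorem den_clockProg (K : ℕ) (hn : s.var 0 = n) :
    (den ω 0 (clockProg K) s).var 1 = (n + 2) ^ K ∧ (den ω 0 (clockProg K) s).var 0 = n ∧
    (den ω 0 (clockProg K) s).arr = s.arr ∧ (den ω 0 (clockProg K) s).flips = s.flips := by
  induction K with
  | zero => simp [clockProg, den_assign, Expr.eval, hn]
  | succ K ih =>
    obtain ⟨h1, h2, h3, h4⟩ := ih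
    simp only [clockProg, den_seq]
    rw [← h3, ← h4]
    generalize den ω 0 (clockProg K) s = s1 at h1 h2 ⊢
    -- Multiplication by `n + 2` when `n` is the only clock: start with twice the number and add it
    -- `n` times.
    have e0 : den ω 0 (.assign 6 (.add (.var 1) (.var 1))) s1 =
        s1.setVar 6 (2 * (n + 2) ^ K) := by
      rw [den_assign]; simp only [Expr.eval, h1, two_mul]
    rw [e0]
    have H := rep_rule (ω := ω) (k := 0) (x := 100) (e := .const 1)
      (c := .assign 6 (.add (.var 6) (.var 1)))
      (fun j s' => s'.var 6 = (2 + j) * (n + 2) ^ K) (s1.setVar 6 (2 * (n + 2) ^ K)) n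
      (by simp [h2])
      (by intro j s' v h; simpa using h)
      (by simp)
      (by
        rintro j s' hj hf - a
        refine ⟨by simp [Expr.eval], ?_⟩
        have : s'.var 1 = (n + 2) ^ K := by rw [hf 1 (by decide) (by decide)]; simpa using h1
        rw [den_assign]
        simp only [Expr.eval, State.setVar_var, if_true, a, this]
        ring)
      (by rintro s' - - -; left; simp [h2])
    have e1 : (den ω 0 (.rep 100 (.const 1) (.assign 6 (.add (.var 6) (.var 1))))
      (s1.setVar 6 (2 * (n + 2) ^ K))).var 0 = n := by
      rw [den_var (by decide)]; simpa using h2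
    refine ⟨?_, ?_, ?_, ?_⟩
    · rw [den_assign]
      simp only [Expr.eval, State.setVar_var, if_true, H]
      ring
    · rw [den_var (by decide), e1]
    · funext a
      rw [den_arr (by simp [arrs]), den_arr (by simp [arrs])]
      rfl
    · rw [den_flips (by decide), den_flips (by decide)]
      rfl

theorem den_rowsProg (h0 : s.var 0 = n) (hB : n ≤ s.var 1) :
    (den ω 1 rowsProg s).var 5 = n * n ∧ ∀ i < n, (den ω 1 rowsProg s).arr 2 i = n * i := by
  simp only [rowsProg, den_seq, den_assign]
  have e0 : ((s.setVar 7 ((Expr.const 0).eval s)).setVar 5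
    ((Expr.const 0).eval (s.setVar 7 ((Expr.const 0).eval s)))) = (s.setVar 7 0).setVar 5 0 := rfl
  rw [e0]
  have H := rep_rule (ω := ω) (k := 1) (x := 100) (e := .sub (.var 0) (.var 7))
    (c := .write 2 (.var 7) (.var 5) ;; .assign 5 (.add (.var 5) (.var 0)) ;;
      .assign 7 (.add (.var 7) (.const 1)))
    (fun j s' => s'.var 0 = n ∧ s'.var 7 = j ∧ s'.var 5 = n * j ∧ ∀ i < j, s'.arr 2 i = n * i)
    ((s.setVar 7 0).setVar 5 0) n (by simpa using hB)
    (by intro j s' v h; simpa using h)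
    (by simp [h0])
    (by
      rintro j s' hj - - ⟨a0, a1, a2, a3⟩
      refine ⟨by simp only [Expr.eval, a0, a1]; omega, ?_⟩
      simp only [den_seq, den_assign, den_write, Expr.eval, State.setVar_var, State.setArr_var,
        State.setVar_arr, State.setArr_arr, Nat.reduceEqDiff, if_true, if_false, a0, a1, a2,
        true_and, OfNat.zero_ne_ofNat]
      refine ⟨by ring, fun i hi => ?_⟩
      by_cases hij : i = j
      · simp [hij]
      · rw [if_neg hij, a3 i (by omega)])
    (by
      rintro s' - - ⟨a0, a1, -, -⟩
      right
      simp [Expr.eval, a0, a1])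
  exact ⟨H.2.2.1, H.2.2.2⟩

theorem den_mulProg {x y a d : ℕ} (hx : x ∉ [8, 9, 100]) (hy : y ∉ [8, 9, 100])
    (hxa : s.var x = a) (hyd : s.var y = d) (hd : d ≤ s.var 1) :
    (den ω 1 (mulProg x y) s).var x = a * d := by
  simp only [List.mem_cons, List.not_mem_nil, or_false, not_or] at hx hy
  obtain ⟨hx1, hx2, hx3⟩ := hx
  obtain ⟨hy1, hy2, hy3⟩ := hy
  simp only [mulProg, den_seq, den_assign]
  have e0 : ((s.setVar 9 ((Expr.const 0).eval s)).setVar 8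
    ((Expr.const 0).eval (s.setVar 9 ((Expr.const 0).eval s)))) = (s.setVar 9 0).setVar 8 0 := rfl
  rw [e0]
  have H := rep_rule (ω := ω) (k := 1) (x := 100) (e := .sub (.var y) (.var 8))
    (c := .assign 9 (.add (.var 9) (.var x)) ;; .assign 8 (.add (.var 8) (.const 1)))
    (fun j s' => s'.var x = a ∧ s'.var y = d ∧ s'.var 8 = j ∧ s'.var 9 = a * j)
    ((s.setVar 9 0).setVar 8 0) d (by simpa using hd)
    (by intro j s' v h; simpa [hx3, hy3] using h)
    (by simp [hx1, hx2, hy1, hy2, hxa, hyd])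
    (by
      rintro j s' hj - - ⟨a1, a2, a3, a4⟩
      refine ⟨by simp only [Expr.eval, a2, a3]; omega, ?_⟩
      simp only [den_seq, den_assign, Expr.eval, State.setVar_var, Nat.reduceEqDiff, if_true,
        if_false, hx1, hx2, hy1, hy2, a1, a2, a3, a4, true_and]
      ring)
    (by
      rintro s' - - ⟨-, a2, a3, -⟩
      right
      simp [Expr.eval, a2, a3])
  rw [Expr.eval, State.setVar_var, if_pos rfl]
  exact H.2.2.2

theorem vars_powProg {x y z : ℕ} (hz : z ∉ [x, 8, 9, 99, 100]) (j : ℕ) :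
    z ∉ (powProg x y j).vars := by
  simp only [List.mem_cons, List.not_mem_nil, or_false, not_or] at hz
  induction j with
  | zero => simp [powProg, nop, vars, hz]
  | succ j ih => simp [powProg, mulProg, vars, hz, ih]

theorem arrs_powProg (x y j : ℕ) : (powProg x y j).arrs = [] := by
  induction j with
  | zero => rfl
  | succ j ih => simp [powProg, mulProg, arrs, ih]

theorem flipless_powProg (x y j : ℕ) : (powProg x y j).flipless = true := by
  induction j with
  | zero => rfl
  | succ j ih => simp [powProg, mulProg, flipless, ih]

theorem wf_powProg (x y j : ℕ) : (powProg x y j).wf = true := by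
  induction j with
  | zero => rfl
  | succ j ih => simp [powProg, mulProg, wf, vars, ih]

theorem den_powProg {x y a d : ℕ} (hx : x ∉ [1, 8, 9, 100]) (hy : y ∉ [x, 8, 9, 99, 100])
    (hxa : s.var x = a) (hyd : s.var y = d) (hd : d ≤ s.var 1) (j : ℕ) :
    (den ω 1 (powProg x y j) s).var x = a * d ^ j := by
  induction j with
  | zero => simpa [powProg] using hxa
  | succ j ih =>
    rw [powProg, den_seq, den_mulProg (by simp at hx ⊢; tauto) (by simp at hy ⊢; tauto) ih
      (by rw [den_var (vars_powProg hy j), hyd])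
      (by rw [den_var (vars_powProg (by simp at hx ⊢; tauto) j)]; exact hd), pow_succ, mul_assoc]

theorem eval_smulExpr (e : Expr) (j : ℕ) : (smulExpr e j).eval s = j * e.eval s := by
  induction j with
  | zero => simp [smulExpr, Expr.eval]
  | succ j ih => simp [smulExpr, Expr.eval, ih, add_mul]

/-- The search starts at `D ^ 1`, so it takes `R - 1` rounds and needs minimality only among
positive exponents. -/
theorem den_exponentProg {m D R : ℕ} (h0 : s.var 0 = n) (h1 : s.var 1 = B) (h2 : s.var 2 = D)
    (hn : n ≤ B) (hD : D ≤ B) (hR : 1 ≤ R) (hRB : R ≤ B) (hlow : ∀ j, 1 ≤ j → j < R → D ^ j < n ^ m)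
    (hhigh : n ^ m ≤ D ^ R) : (den ω 1 (exponentProg m) s).var 3 = R := by
  simp only [exponentProg, den_seq, den_assign]
  have a7 := den_powProg (ω := ω) (s := s.setVar 7 ((Expr.const 1).eval s)) (x := 7) (y := 0)
    (a := 1) (d := n) (by decide) (by decide) (by simp [Expr.eval]) (by simpa using h0)
    (by simpa [h1] using hn) m
  have a2 : (den ω 1 (powProg 7 0 m) (s.setVar 7 ((Expr.const 1).eval s))).var 2 = D := by
    rw [den_var (vars_powProg (by decide) m)]; simpa using h2
  have a1 : (den ω 1 (powProg 7 0 m) (s.setVar 7 ((Expr.const 1).eval s))).var 1 = B := by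
    rw [den_var (vars_powProg (by decide) m)]; simpa using h1
  generalize den ω 1 (powProg 7 0 m) (s.setVar 7 ((Expr.const 1).eval s)) = s1 at a7 a2 a1 ⊢
  have e1 : (s1.setVar 6 ((Expr.var 2).eval s1)).setVar 3 ((Expr.const 1).eval
      (s1.setVar 6 ((Expr.var 2).eval s1))) = (s1.setVar 6 D).setVar 3 1 := by
    simp only [Expr.eval, a2]
  rw [e1]
  rw [one_mul] at a7
  have H := rep_rule (ω := ω) (k := 1) (x := 101) (e := .sub (.var 7) (.var 6))
    (c := mulProg 6 2 ;; .assign 3 (.add (.var 3) (.const 1)))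
    (fun j s' => s'.var 6 = D ^ (j + 1) ∧ s'.var 3 = j + 1)
    ((s1.setVar 6 D).setVar 3 1) (R - 1) (by simp [a1]; omega)
    (by intro j s' v h; simpa using h)
    (by simp)
    (by
      rintro j s' hj hf - ⟨b6, b3⟩
      have f7 : s'.var 7 = n ^ m := by rw [hf 7 (by decide) (by decide)]; simpa using a7
      have f2 : s'.var 2 = D := by rw [hf 2 (by decide) (by decide)]; simpa using a2
      have f1 : s'.var 1 = B := by rw [hf 1 (by decide) (by decide)]; simpa using a1
      have := hlow (j + 1) (by omega) (by omega)
      refine ⟨by simp only [Expr.eval, f7, b6]; omega, ?_⟩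
      have c6 := den_mulProg (ω := ω) (s := s') (x := 6) (y := 2) (by decide) (by decide) b6 f2
        (by rw [f1]; exact hD)
      have c3 : (den ω 1 (mulProg 6 2) s').var 3 = j + 1 := by rw [den_var (by decide), b3]
      rw [den_seq, den_assign]
      simp [Expr.eval, c6, c3, pow_succ])
    (by
      rintro s' hf - ⟨b6, -⟩
      right
      have f7 : s'.var 7 = n ^ m := by rw [hf 7 (by decide) (by decide)]; simpa using a7
      rw [Nat.sub_add_cancel hR] at b6
      simp only [Expr.eval, f7, b6]
      omega)
  rw [Nat.sub_add_cancel hR] at H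
  exact H.2

/-- Variable 6 carries the `m`-th power of variable 4, so the palette is compared with `64 * D ^ (2
+ 1 / m)` without taking roots. -/
theorem den_paletteProg {m D b : ℕ} (h1 : s.var 1 = B) (h2 : s.var 2 = D) (hD : D ≤ B)
    (hbB : b ≤ B) (hlow : ∀ j < b, 2 ^ (m * j) < 64 ^ m * D ^ (2 * m + 1))
    (hhigh : 64 ^ m * D ^ (2 * m + 1) ≤ 2 ^ (m * b)) :
    (den ω 1 (paletteProg m) s).var 4 = 2 ^ b := by
  simp only [paletteProg, den_seq, den_assign]
  have a7 := den_powProg (ω := ω) (s := s.setVar 7 ((Expr.const (64 ^ m)).eval s)) (x := 7) (y := 2)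
    (a := 64 ^ m) (d := D) (by decide) (by decide) (by simp [Expr.eval]) (by simpa using h2)
    (by simpa [h1] using hD) (2 * m + 1)
  have a1 : (den ω 1 (powProg 7 2 (2 * m + 1)) (s.setVar 7 ((Expr.const (64 ^ m)).eval s))).var 1 =
      B := by
    rw [den_var (vars_powProg (by decide) _)]; simpa using h1
  generalize den ω 1 (powProg 7 2 (2 * m + 1)) (s.setVar 7 ((Expr.const (64 ^ m)).eval s)) = s1
    at a7 a1 ⊢
  have e1 : (s1.setVar 6 ((Expr.const 1).eval s1)).setVar 4 ((Expr.const 1).eval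
      (s1.setVar 6 ((Expr.const 1).eval s1))) = (s1.setVar 6 1).setVar 4 1 := rfl
  rw [e1]
  have H := rep_rule (ω := ω) (k := 1) (x := 101) (e := .sub (.var 7) (.var 6))
    (c := .assign 6 (smulExpr (.var 6) (2 ^ m)) ;; .assign 4 (.add (.var 4) (.var 4)))
    (fun j s' => s'.var 6 = 2 ^ (m * j) ∧ s'.var 4 = 2 ^ j)
    ((s1.setVar 6 1).setVar 4 1) b (by simp [a1, hbB])
    (by intro j s' v h; simpa using h)
    (by simp)
    (by
      rintro j s' hj hf - ⟨b6, b4⟩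
      have f7 : s'.var 7 = 64 ^ m * D ^ (2 * m + 1) := by
        rw [hf 7 (by decide) (by simp [vars])]; simpa using a7
      have := hlow j hj
      refine ⟨by simp only [Expr.eval, f7, b6]; omega, ?_⟩
      rw [den_seq, den_assign, den_assign, eval_smulExpr]
      simp only [Expr.eval, State.setVar_var, Nat.reduceEqDiff, if_true, if_false, b6, b4]
      exact ⟨by ring, by ring⟩)
    (by
      rintro s' hf - ⟨b6, -⟩
      right
      have f7 : s'.var 7 = 64 ^ m * D ^ (2 * m + 1) := by
        rw [hf 7 (by decide) (by simp [vars])]; simpa using a7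
      simp only [Expr.eval, f7, b6]
      omega)
  exact H.2

end Prog

end RandRAM

/-! ### The neighbor lists and the maximum degree -/

namespace RandRAM

open EntropyCompression

namespace Prog

variable {ω : ℕ → Bool} {n B : ℕ} {s : State} {G : SimpleGraph (Fin n)}

theorem den_neighborStep {i j c v : ℕ} (h7 : s.var 7 = i) (h8 : s.var 8 = j) (h9 : s.var 9 = c)
    (h2 : s.var 2 = v) (hrow : s.arr 2 i = n * i) :
    (den ω 1 neighborStep s).var 8 = j + 1 ∧
    (s.arr 0 (n * i + j) ≠ 0 → (den ω 1 neighborStep s).var 9 = c + 1 ∧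
      (den ω 1 neighborStep s).var 2 = max v (c + 1) ∧
      ∀ k, (den ω 1 neighborStep s).arr 3 k = if k = n * i + c then j else s.arr 3 k) ∧
    (s.arr 0 (n * i + j) = 0 → (den ω 1 neighborStep s).var 9 = c ∧
      (den ω 1 neighborStep s).var 2 = v ∧ (den ω 1 neighborStep s).arr 3 = s.arr 3) := by
  have e : (Expr.read 0 (entry 7 8)).eval s = s.arr 0 (n * i + j) := by
    rw [Expr.eval, eval_entry, h7, h8, hrow]
  simp only [neighborStep, den_seq, den_cond, den_nop, e]
  by_cases h : s.arr 0 (n * i + j) = 0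
  · simp [h, den_assign, Expr.eval, h8, h9, h2]
  · simp only [ne_eq, h, not_false_eq_true, if_true, den_assign, den_write, Expr.eval, eval_entry,
      State.setVar_var, State.setArr_var, Nat.reduceEqDiff, if_false, h7, h8, h9, h2, hrow]
    by_cases hlt : c + 1 - v = 0
    · simp [hlt, h2, h8]; omega
    · simp [hlt, h8]; omega

/-- Variable 9 counts the neighbors found so far and is thereby the next free slot of the row;
variable 2 is a running maximum of these counts. -/
theorem den_neighborRow [DecidableRel G.Adj] {i : Fin n} {v : ℕ} (h0 : s.var 0 = n)
    (hB : n ≤ s.var 1) (h7 : s.var 7 = i) (h2 : s.var 2 = v) (hv : v ≤ G.maxDegree)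
    (hrow : s.arr 2 i = n * i) (hadj : ∀ j : Fin n, s.arr 0 (n * i.val + j.val) ≠ 0 ↔ G.Adj i j)
    (h3 : ∀ k, s.arr 3 k < n) :
    (den ω 1 neighborRow s).var 7 = i + 1 ∧ v ≤ (den ω 1 neighborRow s).var 2 ∧
    (den ω 1 neighborRow s).var 2 ≤ G.maxDegree ∧ (∀ k, (den ω 1 neighborRow s).arr 3 k < n) ∧
    (∀ u : Fin n, G.Adj i u → ∃ d < (den ω 1 neighborRow s).var 2, d < n ∧
      (den ω 1 neighborRow s).arr 3 (n * i + d) = u) ∧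
    ∀ p < i.val, ∀ d < n, (den ω 1 neighborRow s).arr 3 (n * p + d) = s.arr 3 (n * p + d) := by
  simp only [neighborRow, den_seq, den_assign]
  have e0 : ((s.setVar 8 ((Expr.const 0).eval s)).setVar 9
    ((Expr.const 0).eval (s.setVar 8 ((Expr.const 0).eval s)))) = (s.setVar 8 0).setVar 9 0 := rfl
  rw [e0]
  have H := rep_rule (ω := ω) (k := 1) (x := 100) (e := .sub (.var 0) (.var 8))
    (c := neighborStep)
    (fun j s' => s'.var 8 = j ∧ s'.var 9 ≤ j ∧
      s'.var 9 = ((G.neighborFinset i).filter (fun u => u.val < j)).card ∧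
      v ≤ s'.var 2 ∧ s'.var 9 ≤ s'.var 2 ∧ s'.var 2 ≤ G.maxDegree ∧ (∀ k, s'.arr 3 k < n) ∧
      (∀ u : Fin n, u.val < j → G.Adj i u → ∃ d < s'.var 9, s'.arr 3 (n * i + d) = u) ∧
      ∀ p < i.val, ∀ d < n, s'.arr 3 (n * p + d) = s.arr 3 (n * p + d))
    ((s.setVar 8 0).setVar 9 0) n (by simpa using hB)
    (by intro j s' v h; simpa using h)
    (by simp [h2, hv, h3])
    (by
      rintro j s' hj hf hf' ⟨a1, a2, a3, a4, a5, a6, a7, a8, a9⟩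
      have f0 : s'.var 0 = n := by rw [hf 0 (by decide) (by decide)]; simpa using h0
      have f7 : s'.var 7 = i := by rw [hf 7 (by decide) (by decide)]; simpa using h7
      have g2 : s'.arr 2 i = n * i := by rw [hf' 2 (by decide)]; simpa using hrow
      have g0 : s'.arr 0 (n * i + j) ≠ 0 ↔ G.Adj i ⟨j, hj⟩ := by
        rw [hf' 0 (by decide), ← hadj]; rfl
      refine ⟨by simp only [Expr.eval, f0, a1]; omega, ?_⟩
      obtain ⟨b1, b2, b3⟩ := den_neighborStep (ω := ω) f7 a1 rfl rfl g2
      have hcard : ((G.neighborFinset i).filter (fun u => u.val < j + 1)).card =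
          ((G.neighborFinset i).filter (fun u => u.val < j)).card +
            if G.Adj i ⟨j, hj⟩ then 1 else 0 := by
        split_ifs with h
        · rw [← Finset.card_insert_of_notMem (a := (⟨j, hj⟩ : Fin n)) (by simp)]
          congr 1
          ext u
          simp only [Finset.mem_filter, SimpleGraph.mem_neighborFinset, Finset.mem_insert,
            Fin.ext_iff, Nat.lt_succ_iff_lt_or_eq]
          constructor
          · tauto
          · rintro (h' | h')
            · exact ⟨by rwa [show u = ⟨j, hj⟩ from Fin.ext h'], Or.inr h'⟩
            · tauto
        · rw [add_zero]
          congr 1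
          ext u
          simp only [Finset.mem_filter, SimpleGraph.mem_neighborFinset, Nat.lt_succ_iff_lt_or_eq]
          constructor
          · rintro ⟨h1, h2 | h2⟩
            · exact ⟨h1, h2⟩
            · exact absurd (by rwa [show u = ⟨j, hj⟩ from Fin.ext h2] at h1) h
          · tauto
      by_cases hA : G.Adj i ⟨j, hj⟩
      · obtain ⟨c1, c2, c3⟩ := b2 (g0.2 hA)
        rw [if_pos hA, ← a3] at hcard
        have hle : ((G.neighborFinset i).filter (fun u => u.val < j + 1)).card ≤ G.maxDegree :=
          (Finset.card_filter_le _ _).trans (G.degree_le_maxDegree i)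
        refine ⟨b1, by omega, by omega, by omega, by omega, by omega, fun k => ?_, ?_, ?_⟩
        · rw [c3]; split_ifs
          · exact hj
          · exact a7 k
        · intro u hu hAu
          rw [c1]
          rcases Nat.lt_succ_iff_lt_or_eq.1 hu with h | h
          · obtain ⟨d, hd, hd'⟩ := a8 u h hAu
            exact ⟨d, by omega, by rw [c3, if_neg (by omega), hd']⟩
          · exact ⟨s'.var 9, by omega, by rw [c3, if_pos rfl, h]⟩
        -- The slot number is at most `j < n`, so the write stays in row `i` and spares the earlier
        -- rows.
        · intro p hp d hd
          rw [c3, if_neg, a9 p hp d hd]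
          rw [index_inj hd (by omega)]
          omega
      · obtain ⟨c1, c2, c3⟩ := b3 (by rw [← not_ne_iff, g0]; exact hA)
        rw [if_neg hA, ← a3] at hcard
        rw [c1, c2, c3]
        refine ⟨b1, by omega, by omega, a4, a5, a6, a7, ?_, a9⟩
        intro u hu hAu
        rcases Nat.lt_succ_iff_lt_or_eq.1 hu with h | h
        · exact a8 u h hAu
        · exact absurd (by rwa [show u = ⟨j, hj⟩ from Fin.ext h] at hAu) hA)
    (by
      rintro s' hf hf' ⟨a1, -⟩
      right
      have f0 : s'.var 0 = n := by rw [hf 0 (by decide) (by decide)]; simpa using h0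
      simp [Expr.eval, f0, a1])
  obtain ⟨a1, a2, a3, a4, a5, a6, a7, a8, a9⟩ := H
  have f7 : (den ω 1 (.rep 100 (.sub (.var 0) (.var 8)) neighborStep)
      ((s.setVar 8 0).setVar 9 0)).var 7 = i := by
    rw [den_var (by decide)]; simpa using h7
  simp only [Expr.eval, State.setVar_var, State.setVar_arr, Nat.reduceEqDiff, if_true, if_false,
    f7, true_and]
  refine ⟨a4, a6, a7, fun u hu => ?_, a9⟩
  obtain ⟨d, hd, hd'⟩ := a8 u u.2 hu
  exact ⟨d, by omega, by omega, hd'⟩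

/-- The final addition of 2 ensures `2 ≤ D`, so that the powers of `D` grow even if the maximum
degree is 0 or 1. -/
theorem den_neighborsProg [DecidableRel G.Adj] (h0 : s.var 0 = n)
    (hB : n ≤ s.var 1) (hrow : ∀ i < n, s.arr 2 i = n * i)
    (hadj : ∀ i j : Fin n, s.arr 0 (n * i.val + j.val) ≠ 0 ↔ G.Adj i j)
    (h3 : ∀ k, s.arr 3 k < n) :
    G.maxDegree ≤ (den ω 1 neighborsProg s).var 2 ∧ 2 ≤ (den ω 1 neighborsProg s).var 2 ∧
    (den ω 1 neighborsProg s).var 2 ≤ G.maxDegree + 2 ∧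
    (∀ k, (den ω 1 neighborsProg s).arr 3 k < n) ∧
    (∀ i u : Fin n, G.Adj i u → ∃ d < (den ω 1 neighborsProg s).var 2,
      (den ω 1 neighborsProg s).arr 3 (n * i + d) = u) := by
  simp only [neighborsProg, den_seq, den_assign]
  have e0 : ((s.setVar 2 ((Expr.const 0).eval s)).setVar 7
    ((Expr.const 0).eval (s.setVar 2 ((Expr.const 0).eval s)))) = (s.setVar 2 0).setVar 7 0 := rfl
  rw [e0]
  have H := rep_rule (ω := ω) (k := 1) (x := 101) (e := .sub (.var 0) (.var 7))
    (c := neighborRow)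
    (fun i s' => s'.var 7 = i ∧ s'.var 2 ≤ G.maxDegree ∧ (∀ k, s'.arr 3 k < n) ∧
      ∀ p u : Fin n, p.val < i → G.Adj p u → ∃ d < s'.var 2, d < n ∧ s'.arr 3 (n * p + d) = u)
    ((s.setVar 2 0).setVar 7 0) n (by simpa using hB)
    (by intro j s' v h; simpa using h)
    (by simp [h3])
    (by
      rintro i s' hi hf hf' ⟨a1, a2, a3, a4⟩
      have f0 : s'.var 0 = n := by rw [hf 0 (by decide) (by decide)]; simpa using h0
      have f1 : n ≤ s'.var 1 := by rw [hf 1 (by decide) (by decide)]; simpa using hB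
      refine ⟨by simp only [Expr.eval, f0, a1]; omega, ?_⟩
      obtain ⟨b1, b2, b3, b4, b5, b6⟩ := den_neighborRow (ω := ω) (G := G) (i := ⟨i, hi⟩) f0 f1 a1
        rfl a2 (by rw [hf' 2 (by decide)]; exact hrow i hi)
        (by rw [hf' 0 (by decide)]; exact hadj _) a3
      refine ⟨b1, b3, b4, fun p u hp hA => ?_⟩
      rcases Nat.lt_succ_iff_lt_or_eq.1 hp with h | h
      · obtain ⟨d, hd, hdn, hd'⟩ := a4 p u h hA
        exact ⟨d, by omega, hdn, by rw [b6 p h d hdn, hd']⟩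
      · obtain rfl : p = ⟨i, hi⟩ := Fin.ext h
        exact b5 u hA)
    (by
      rintro s' hf hf' ⟨a1, -⟩
      right
      have f0 : s'.var 0 = n := by rw [hf 0 (by decide) (by decide)]; simpa using h0
      simp [Expr.eval, f0, a1])
  obtain ⟨a1, a2, a3, a4⟩ := H
  generalize den ω 1 (.rep 101 (.sub (.var 0) (.var 7)) neighborRow)
      ((s.setVar 2 0).setVar 7 0) = s1 at a1 a2 a3 a4 ⊢
  simp only [Expr.eval, State.setVar_var, State.setVar_arr, if_true]
  -- Distinct neighbors occupy distinct slots below variable 2, which therefore bounds every degree.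
  have hdeg : G.maxDegree ≤ s1.var 2 := by
    refine G.maxDegree_le_of_forall_degree_le _ fun p => ?_
    have hinj : (G.neighborFinset p).card ≤ (Finset.range (s1.var 2)).card := by
      choose! f hf1 hf2 hf3 using fun u (hA : G.Adj p u) => a4 p u p.2 hA
      refine Finset.card_le_card_of_injOn f (fun u hu => ?_) (fun u hu w hw h => ?_)
      · simp only [Finset.mem_coe, SimpleGraph.mem_neighborFinset] at hu
        simpa using hf1 u hu
      · simp only [Finset.mem_coe, SimpleGraph.mem_neighborFinset] at hu hw
        have h1 := hf3 u hu
        rw [h, hf3 w hw] at h1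
        exact (Fin.ext h1).symm
    simpa using hinj
  refine ⟨by omega, by omega, by omega, a3, fun i u hA => ?_⟩
  obtain ⟨d, hd, -, hd'⟩ := a4 i u i.2 hA
  exact ⟨d, by omega, hd'⟩

end Prog

end RandRAM

/-! ### Parameters -/

namespace EntropyCompression

/-- Take the least `R`. If `R > 1`, minimality gives `D ^ (R - 1) < n ^ m`, so `D ^ R` overshoots by
at most the factor `D` and remains polynomial. -/
theorem exists_walk_length {n D : ℕ} (m : ℕ) (hD2 : 2 ≤ D) (hDn : D ≤ n + 2) (hn : 0 < n) :
    ∃ R, 1 ≤ R ∧ (∀ j, 1 ≤ j → j < R → D ^ j < n ^ m) ∧ n ^ m ≤ D ^ R ∧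
      D ^ R ≤ (n + 2) ^ (m + 1) := by
  have hex : ∃ R, 1 ≤ R ∧ n ^ m ≤ D ^ R := by
    refine ⟨n ^ m, Nat.one_le_pow _ _ hn, ?_⟩
    exact (Nat.lt_pow_self (by omega)).le
  classical
  obtain ⟨h1, h2⟩ := Nat.find_spec hex
  have hlow : ∀ j, 1 ≤ j → j < Nat.find hex → D ^ j < n ^ m := by
    intro j hj hjR
    have := Nat.find_min hex hjR
    push Not at this
    exact this hj
  refine ⟨Nat.find hex, h1, hlow, h2, ?_⟩
  set R := Nat.find hex
  rcases Nat.lt_or_ge 1 R with h | h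
  · have h3 := hlow (R - 1) (by omega) (by omega)
    calc D ^ R = D ^ (R - 1) * D := by rw [← pow_succ, Nat.sub_add_cancel h1]
      _ ≤ (n + 2) ^ m * (n + 2) :=
        Nat.mul_le_mul (h3.le.trans (Nat.pow_le_pow_left (by omega) m)) hDn
      _ = (n + 2) ^ (m + 1) := (pow_succ _ _).symm
  · rw [show R = 1 by omega, pow_one]
    exact hDn.trans (Nat.le_self_pow (by omega) _)

/-- Take the least admissible `b` and a quarter of the palette for `y`. Then `2 * y = 2 ^ (b - 1)`,
so minimality at `b - 1` is the upper bound. -/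
theorem exists_palette {m D : ℕ} (hm : 1 ≤ m) (hD : 1 ≤ D) :
    ∃ b y, 2 ^ b = 4 * y ∧ (∀ j < b, 2 ^ (m * j) < 64 ^ m * D ^ (2 * m + 1)) ∧
      64 ^ m * D ^ (2 * m + 1) ≤ 2 ^ (m * b) ∧ b ≤ 64 ^ m * D ^ (2 * m + 1) ∧
      (2 * y) ^ m ≤ 64 ^ m * D ^ (2 * m + 1) := by
  have hex : ∃ b, 64 ^ m * D ^ (2 * m + 1) ≤ 2 ^ (m * b) := by
    refine ⟨64 ^ m * D ^ (2 * m + 1), Nat.lt_two_pow_self.le.trans ?_⟩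
    exact Nat.pow_le_pow_right (by omega) (Nat.le_mul_of_pos_left _ hm)
  classical
  have h2 := Nat.find_spec hex
  have hlow : ∀ j < Nat.find hex, 2 ^ (m * j) < 64 ^ m * D ^ (2 * m + 1) :=
    fun j hj => not_le.1 (Nat.find_min hex hj)
  set b := Nat.find hex
  -- The factor `64 ^ m` forces this; it makes the palette divisible by 4.
  have hb : 6 ≤ b := by
    have h3 : (2 : ℕ) ^ (6 * m) ≤ 2 ^ (m * b) := by
      refine le_trans ?_ h2
      rw [pow_mul]
      exact Nat.le_mul_of_pos_right _ (by positivity)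
    have h4 := (Nat.pow_le_pow_iff_right (by omega)).1 h3
    rw [mul_comm] at h4
    exact Nat.le_of_mul_le_mul_left h4 hm
  have h5 := hlow (b - 1) (by omega)
  refine ⟨b, 2 ^ (b - 2), ?_, hlow, h2, ?_, ?_⟩
  · rw [show (4 : ℕ) = 2 ^ 2 by norm_num, ← pow_add, Nat.add_sub_cancel' (by omega)]
  · refine le_trans ?_ h5.le
    calc b = (b - 1) + 1 := by omega
      _ ≤ 2 ^ (b - 1) := Nat.lt_two_pow_self
      _ ≤ 2 ^ (m * (b - 1)) :=
        Nat.pow_le_pow_right (by omega) (Nat.le_mul_of_pos_left _ hm)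
  · rw [← pow_succ', show b - 2 + 1 = b - 1 by omega, ← pow_mul, mul_comm]
    exact h5.le

/-- Stated in `m`-th powers to stay in `ℕ`: `y ^ m` exceeds `(16 * D ^ 2) ^ m` by a factor `D`, and
over `R` edges this amounts to `D ^ R ≥ n ^ m`, which pays for the free start of the second walk. -/
theorem palette_bounds {m D n R b y : ℕ} (hm : 1 ≤ m) (hD : 1 ≤ D) (hby : 2 ^ b = 4 * y)
    (hb : 64 ^ m * D ^ (2 * m + 1) ≤ 2 ^ (m * b)) (hR : n ^ m ≤ D ^ R) :
    16 * D ^ 2 ≤ y ∧ n * (16 * D ^ 2) ^ R ≤ y ^ R := by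
  have h1 : (16 * D ^ 2) ^ m * D ≤ y ^ m := by
    have h : 4 ^ m * ((16 * D ^ 2) ^ m * D) ≤ 4 ^ m * y ^ m := by
      calc 4 ^ m * ((16 * D ^ 2) ^ m * D) = 64 ^ m * D ^ (2 * m + 1) := by
            rw [show (64 : ℕ) = 4 * 16 by norm_num, mul_pow 4 16, mul_pow 16 (D ^ 2), ← pow_mul]; ring
        _ ≤ (2 ^ b) ^ m := by rw [← pow_mul, mul_comm b]; exact hb
        _ = 4 ^ m * y ^ m := by rw [hby, mul_pow]
    exact Nat.le_of_mul_le_mul_left h (by positivity)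
  refine ⟨?_, ?_⟩
  · refine (Nat.pow_le_pow_iff_left (by omega : m ≠ 0)).1 (le_trans ?_ h1)
    exact Nat.le_mul_of_pos_right _ hD
  · refine (Nat.pow_le_pow_iff_left (by omega : m ≠ 0)).1 ?_
    calc (n * (16 * D ^ 2) ^ R) ^ m = n ^ m * ((16 * D ^ 2) ^ m) ^ R := by
          rw [mul_pow, ← pow_mul, ← pow_mul, mul_comm R]
      _ ≤ D ^ R * ((16 * D ^ 2) ^ m) ^ R := Nat.mul_le_mul_right _ hR
      _ = ((16 * D ^ 2) ^ m * D) ^ R := by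
          rw [mul_pow ((16 * D ^ 2) ^ m) D R, mul_comm]
      _ ≤ (y ^ m) ^ R := Nat.pow_le_pow_left h1 R
      _ = (y ^ R) ^ m := by rw [← pow_mul, ← pow_mul, mul_comm]

/-- `R` and `D ^ (2 * R)` take up `3 * (m + 1)` factors `n + 2`, and the two starting vertices take
2. -/
theorem codes_le {n D R m K : ℕ} (hK : 3 * m + 5 ≤ K) (hD : 2 ≤ D)
    (h : D ^ R ≤ (n + 2) ^ (m + 1)) : n * n * R * D ^ (2 * R) ≤ (n + 2) ^ K := by
  have hR : R ≤ D ^ R := (Nat.lt_pow_self (by omega)).le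
  calc n * n * R * D ^ (2 * R)
      ≤ (n + 2) * (n + 2) * (n + 2) ^ (m + 1) * ((n + 2) ^ (m + 1)) ^ 2 := by
        rw [mul_comm 2 R, pow_mul]
        exact Nat.mul_le_mul (Nat.mul_le_mul (Nat.mul_le_mul (by omega) (by omega))
          (hR.trans h)) (Nat.pow_le_pow_left h 2)
    _ = (n + 2) ^ (3 * m + 5) := by ring
    _ ≤ (n + 2) ^ K := Nat.pow_le_pow_right (by omega) hK

theorem palette_le_clock {n D m K : ℕ} (hK : 8 * m + 1 ≤ K) (hD : D ≤ n + 2) :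
    64 ^ m * D ^ (2 * m + 1) ≤ (n + 2) ^ K := by
  calc 64 ^ m * D ^ (2 * m + 1) ≤ ((n + 2) ^ 6) ^ m * (n + 2) ^ (2 * m + 1) := by
        refine Nat.mul_le_mul (Nat.pow_le_pow_left ?_ m) (Nat.pow_le_pow_left hD _)
        calc 64 = 2 ^ 6 := by norm_num
          _ ≤ (n + 2) ^ 6 := Nat.pow_le_pow_left (by omega) 6
    _ = (n + 2) ^ (8 * m + 1) := by rw [← pow_mul, ← pow_add]; congr 1; ring
    _ ≤ (n + 2) ^ K := Nat.pow_le_pow_right (by omega) hK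

/-- Since `2 * |E| ≤ n * n` and `n ≤ 2 ^ n`, already `n * k + n * n` rounds would suffice. -/
theorem failure_le {n k K : ℕ} (hK : k + 2 ≤ K) (G : SimpleGraph (Fin n)) [DecidableRel G.Adj] :
    n ^ k * 4 ^ G.edgeFinset.card ≤ 2 ^ (n + 2) ^ K := by
  have h1 : G.edgeFinset.card ≤ n.choose 2 := by simpa using G.card_edgeFinset_le_card_choose_two
  have h2 : 2 * n.choose 2 ≤ n * n := by
    rw [Nat.choose_two_right]
    exact (Nat.mul_div_le _ _).trans (Nat.mul_le_mul_left _ (Nat.sub_le _ _))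
  have h3 : n * k + n * n ≤ (n + 2) ^ K := by
    have hk : k ≤ (n + 2) ^ k := (Nat.lt_pow_self (by omega)).le
    calc n * k + n * n = n * (k + n) := by ring
      _ ≤ (n + 2) * ((n + 2) ^ k + n * (n + 2) ^ k) := by
          refine Nat.mul_le_mul (by omega) (Nat.add_le_add hk ?_)
          exact Nat.le_mul_of_pos_right _ (by positivity)
      _ ≤ (n + 2) * ((n + 2) * (n + 2) ^ k) := by
          refine Nat.mul_le_mul_left _ ?_
          rw [← one_add_mul]
          exact Nat.mul_le_mul_right _ (by omega)
      _ = (n + 2) ^ (k + 2) := by ring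
      _ ≤ (n + 2) ^ K := Nat.pow_le_pow_right (by omega) hK
  calc n ^ k * 4 ^ G.edgeFinset.card ≤ (2 ^ n) ^ k * 2 ^ (n * n) := by
        refine Nat.mul_le_mul (Nat.pow_le_pow_left Nat.lt_two_pow_self.le k) ?_
        rw [show (4 : ℕ) = 2 ^ 2 by norm_num, ← pow_mul]
        exact Nat.pow_le_pow_right (by omega) (by omega)
    _ = 2 ^ (n * k + n * n) := by rw [← pow_mul, ← pow_add]
    _ ≤ 2 ^ (n + 2) ^ K := Nat.pow_le_pow_right (by omega) h3

/-- From `D ≤ 3 * Δ` and `3 ^ (2 * m + 1) ≤ 27 ^ m` the constant is `64 * 27 = 1728`, doubled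
because `hy` bounds only half of the palette. -/
theorem palette_le_rpow {m D Δ y : ℕ} {ε : ℝ} (hm : 1 ≤ m) (hε : 1 ≤ ε * m) (hΔ : 1 ≤ Δ)
    (hD : D ≤ Δ + 2) (hy : (2 * y) ^ m ≤ 64 ^ m * D ^ (2 * m + 1)) :
    (4 * y : ℝ) ≤ 3456 * (Δ : ℝ) ^ (2 + ε) := by
  have hΔ' : (1 : ℝ) ≤ Δ := by exact_mod_cast hΔ
  have h1 : (2 * y) ^ m ≤ 1728 ^ m * Δ ^ (2 * m + 1) := by
    calc (2 * y) ^ m ≤ 64 ^ m * (3 * Δ) ^ (2 * m + 1) :=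
          hy.trans (Nat.mul_le_mul_left _ (Nat.pow_le_pow_left (by omega) _))
      _ = 64 ^ m * 3 ^ (2 * m + 1) * Δ ^ (2 * m + 1) := by rw [mul_pow]; ring
      _ ≤ 64 ^ m * 3 ^ (3 * m) * Δ ^ (2 * m + 1) := by
          refine Nat.mul_le_mul_right _ (Nat.mul_le_mul_left _ ?_)
          exact Nat.pow_le_pow_right (by omega) (by omega)
      _ = 1728 ^ m * Δ ^ (2 * m + 1) := by rw [pow_mul, ← mul_pow]; norm_num
  have h2 : ((Δ : ℝ)) ^ (2 * m + 1) ≤ ((Δ : ℝ) ^ (2 + ε)) ^ m := by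
    rw [← Real.rpow_natCast, ← Real.rpow_natCast, ← Real.rpow_mul (by positivity)]
    refine Real.rpow_le_rpow_of_exponent_le hΔ' ?_
    push_cast
    linarith
  have h3 : (2 * y : ℝ) ^ m ≤ (1728 * (Δ : ℝ) ^ (2 + ε)) ^ m := by
    have h : (2 * y : ℝ) ^ m ≤ 1728 ^ m * (Δ : ℝ) ^ (2 * m + 1) := by exact_mod_cast h1
    rw [mul_pow 1728]
    exact h.trans (by gcongr)
  have h4 := (pow_le_pow_iff_left₀ (by positivity) (by positivity) (by omega : m ≠ 0)).1 h3
  linarith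

end EntropyCompression

/-! ### The state reached by the preparations -/

namespace RandRAM

open EntropyCompression

namespace Prog

variable {ω : ℕ → Bool} {n : ℕ} {G : SimpleGraph (Fin n)} {s : State}

theorem flipless_clockProg (K : ℕ) : (clockProg K).flipless = true := by
  induction K with
  | zero => rfl
  | succ K ih => simp [clockProg, flipless, ih]

theorem wf_clockProg (K : ℕ) : (clockProg K).wf = true := by
  induction K with
  | zero => rfl
  | succ K ih => simp [clockProg, wf, vars, ih]

theorem vars_clockProg (K : ℕ) : 0 ∉ (clockProg K).vars := by
  induction K with
  | zero => decide
  | succ K ih => simp [clockProg, vars, ih]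

theorem flipless_prepare (m : ℕ) : (prepare m).flipless = true := by
  simp only [prepare, exponentProg, paletteProg, flipless, flipless_powProg, Bool.true_and,
    Bool.and_true]
  decide

theorem wf_prepare (m : ℕ) : (prepare m).wf = true := by
  simp only [prepare, exponentProg, paletteProg, wf, wf_powProg, Bool.true_and, Bool.and_true]
  simp only [vars]
  rfl

theorem vars_exponentProg {z : ℕ} (hz : z ∉ [3, 6, 7, 8, 9, 99, 100, 101]) (m : ℕ) :
    z ∉ (exponentProg m).vars := by
  have := vars_powProg (x := 7) (y := 0) (z := z) (by simp at hz ⊢; tauto) m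
  simp only [List.mem_cons, List.not_mem_nil, or_false, not_or] at hz
  simp [exponentProg, mulProg, vars, this, hz]

theorem vars_paletteProg {z : ℕ} (hz : z ∉ [4, 6, 7, 8, 9, 99, 100, 101]) (m : ℕ) :
    z ∉ (paletteProg m).vars := by
  have := vars_powProg (x := 7) (y := 2) (z := z) (by simp at hz ⊢; tauto) (2 * m + 1)
  simp only [List.mem_cons, List.not_mem_nil, or_false, not_or] at hz
  simp [paletteProg, vars, this, hz]

theorem arrs_exponentProg (m : ℕ) : (exponentProg m).arrs = [] := by
  simp [exponentProg, mulProg, arrs, arrs_powProg]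

theorem arrs_paletteProg (m : ℕ) : (paletteProg m).arrs = [] := by
  simp [paletteProg, arrs, arrs_powProg]

theorem vars_prepare (m : ℕ) : 1 ∉ (prepare m).vars := by
  simp only [prepare, vars, List.mem_append, not_or]
  exact ⟨by decide, by decide, vars_exponentProg (by decide) m, vars_paletteProg (by decide) m⟩

/-- The preparations provide all that the coloring process needs. -/
theorem exists_setup [NeZero n] [DecidableRel G.Adj] {m K : ℕ} (hm : 1 ≤ m) (hK : 8 * m + 5 ≤ K)
    (h0 : s.var 0 = n) (h1 : s.var 1 = (n + 2) ^ K) (harr : s.arr = (inputState G).arr) :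
    ∃ (nb : Fin n → ℕ → Fin n) (D R b y : ℕ),
      Setup G nb D R b ((n + 2) ^ K) (den ω 1 (prepare m) s) ∧
      Colors (den ω 1 (prepare m) s) 1 (0 : Sym2 (Fin n) → ℕ) ∧
      (∀ u v, G.Adj u v → ∃ d < D, nb u d = v) ∧ n * n * R * D ^ (2 * R) ≤ (n + 2) ^ K ∧
      G.maxDegree ≤ D ∧ D ≤ G.maxDegree + 2 ∧ 16 * D ^ 2 ≤ y ∧
      n * (16 * D ^ 2) ^ R ≤ y ^ R ∧ 2 ^ b = 4 * y ∧
      (2 * y) ^ m ≤ 64 ^ m * D ^ (2 * m + 1) := by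
  have hn : 0 < n := NeZero.pos n
  have hB2 : (n + 2) ^ 2 ≤ (n + 2) ^ K := Nat.pow_le_pow_right (by omega) (by omega)
  have hBn : n + 2 ≤ (n + 2) ^ K := Nat.le_self_pow (by omega) _
  have hnn : n * n ≤ (n + 2) ^ K := le_trans (by nlinarith) hB2
  have hadj : ∀ i j : Fin n, s.arr 0 (n * i.val + j.val) ≠ 0 ↔ G.Adj i j := by
    intro i j
    rw [harr]
    simp only [inputState, true_and, ne_eq, ite_eq_right_iff, one_ne_zero, imp_false, not_not]
    constructor
    · rintro ⟨i', j', h, hA⟩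
      rw [index_inj j.2 j'.2] at h
      rwa [Fin.ext h.1, Fin.ext h.2]
    · exact fun h => ⟨i, j, rfl, h⟩
  have harr3 : ∀ a, a ≠ 0 → ∀ k, s.arr a k = 0 := by
    intro a ha k; rw [harr]; simp [inputState, ha]
  simp only [prepare, den_seq]
  -- the multiples of `n`
  obtain ⟨a5, a2⟩ := den_rowsProg (ω := ω) h0 (by rw [h1]; omega)
  have v0 : (den ω 1 rowsProg s).var 0 = n := by rw [den_var (by decide), h0]
  have v1 : (den ω 1 rowsProg s).var 1 = (n + 2) ^ K := by rw [den_var (by decide), h1]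
  have r0 : (den ω 1 rowsProg s).arr 0 = s.arr 0 := den_arr (by decide) s
  have r1 : (den ω 1 rowsProg s).arr 1 = s.arr 1 := den_arr (by decide) s
  have r3 : (den ω 1 rowsProg s).arr 3 = s.arr 3 := den_arr (by decide) s
  generalize den ω 1 rowsProg s = s1 at a5 a2 v0 v1 r0 r1 r3 ⊢
  -- the neighbors
  obtain ⟨b1, b2, b3, b4, b5⟩ := den_neighborsProg (ω := ω) (G := G) v0 (by rw [v1]; omega) a2
    (by rw [r0]; exact hadj) (fun k => by rw [r3, harr3 3 (by decide)]; exact hn)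
  have w0 : (den ω 1 neighborsProg s1).var 0 = n := by rw [den_var (by decide), v0]
  have w1 : (den ω 1 neighborsProg s1).var 1 = (n + 2) ^ K := by rw [den_var (by decide), v1]
  have w5 : (den ω 1 neighborsProg s1).var 5 = n * n := by rw [den_var (by decide), a5]
  have t0 : (den ω 1 neighborsProg s1).arr 0 = s.arr 0 := by rw [den_arr (by decide), r0]
  have t1 : (den ω 1 neighborsProg s1).arr 1 = s.arr 1 := by rw [den_arr (by decide), r1]
  have t2 : (den ω 1 neighborsProg s1).arr 2 = s1.arr 2 := den_arr (by decide) s1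
  generalize den ω 1 neighborsProg s1 = s2 at b1 b2 b3 b4 b5 w0 w1 w5 t0 t1 t2 ⊢
  obtain ⟨D, hD⟩ : ∃ D, s2.var 2 = D := ⟨_, rfl⟩
  rw [hD] at b1 b2 b3 b5
  have hΔ : G.maxDegree ≤ n := by
    have := G.maxDegree_lt_card_verts
    simpa using this.le
  have hDn : D ≤ n + 2 := by omega
  obtain ⟨R, hR1, hRlow, hRhigh, hRle⟩ := exists_walk_length m b2 hDn hn
  obtain ⟨b, y, hby, hblow, hbhigh, hble, hy⟩ := exists_palette hm (show 1 ≤ D by omega)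
  obtain ⟨hy1, hy2⟩ := palette_bounds hm (by omega) hby hbhigh hRhigh
  have hRB : R ≤ (n + 2) ^ K := by
    refine (Nat.lt_pow_self (by omega : 1 < D)).le.trans (hRle.trans ?_)
    exact Nat.pow_le_pow_right (by omega) (by omega)
  have hbB : b ≤ (n + 2) ^ K := hble.trans (palette_le_clock (by omega) hDn)
  -- the parameters
  have c3 := den_exponentProg (ω := ω) (m := m) w0 w1 hD (by omega) (by omega) hR1 hRB hRlow hRhigh
  have x0 : (den ω 1 (exponentProg m) s2).var 0 = n := by
    rw [den_var (vars_exponentProg (by decide) m), w0]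
  have x1 : (den ω 1 (exponentProg m) s2).var 1 = (n + 2) ^ K := by
    rw [den_var (vars_exponentProg (by decide) m), w1]
  have x2 : (den ω 1 (exponentProg m) s2).var 2 = D := by
    rw [den_var (vars_exponentProg (by decide) m), hD]
  have x5 : (den ω 1 (exponentProg m) s2).var 5 = n * n := by
    rw [den_var (vars_exponentProg (by decide) m), w5]
  have xa : (den ω 1 (exponentProg m) s2).arr = s2.arr := by
    funext a; exact den_arr (by simp [arrs_exponentProg]) s2
  generalize den ω 1 (exponentProg m) s2 = s3 at c3 x0 x1 x2 x5 xa ⊢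
  have d4 := den_paletteProg (ω := ω) (m := m) x1 x2 (by omega) hbB hblow hbhigh
  have ya : (den ω 1 (paletteProg m) s3).arr = s2.arr := by
    rw [← xa]; funext a; exact den_arr (by simp [arrs_paletteProg]) s3
  have yv : ∀ z, z ∉ [4, 6, 7, 8, 9, 99, 100, 101] →
      (den ω 1 (paletteProg m) s3).var z = s3.var z :=
    fun z hz => den_var (vars_paletteProg hz m) s3
  generalize den ω 1 (paletteProg m) s3 = s4 at d4 ya yv ⊢
  -- All entries of the table, including unused slots, are below `n`, so `Fin.ofNat` does not alter
  -- them.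
  refine ⟨fun i d => Fin.ofNat n (s2.arr 3 (n * i + d)), D, R, b, y, ?_, ?_, ?_,
    codes_le (by omega) b2 hRle, b1, b3, hy1, hy2, hby, hy⟩
  · exact
    { var0 := by rw [yv 0 (by decide), x0]
      var1 := by rw [yv 1 (by decide), x1]
      var2 := by rw [yv 2 (by decide), x2]
      var3 := by rw [yv 3 (by decide), c3]
      var4 := d4
      var5 := by rw [yv 5 (by decide), x5]
      adj := by rw [ya, t0]; exact hadj
      row := by rw [ya, t2]; exact fun i => a2 i i.2
      nbr := by
        intro i d _
        rw [ya, Fin.val_ofNat, Nat.mod_eq_of_lt (b4 _)]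
      hD := by omega
      hR := hR1
      hn := hnn
      hb := hbB
      hRB := hRB }
  · intro i j
    rw [ya, t1]; exact harr3 1 (by decide) _
  · intro u v hA
    obtain ⟨d, hd, hd'⟩ := b5 u v hA
    refine ⟨d, hd, ?_⟩
    ext
    rw [Fin.val_ofNat, hd', Nat.mod_eq_of_lt v.2]

theorem outputColoring_eq {F : Sym2 (Fin n) → ℕ} (h : Colors s 1 F) : outputColoring n s = F := by
  funext e
  rw [outputColoring, h e.inf e.sup]
  congr 1
  induction e with
  | _ a b =>
    rcases le_total a b with hab | hab
    · simp [hab]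
    · simp [hab, Sym2.eq_swap]

end Prog

end RandRAM

/-! ### The assembled algorithm, its running time and its failure probability -/

namespace RandRAM

open EntropyCompression

namespace Prog

variable {n : ℕ} {G : SimpleGraph (Fin n)}

/-- The coloring algorithm: set up a clock, prepare the parameters, and color. -/
def algorithm (m K : ℕ) : Cmd :=
  .seq ((clockProg K).compile 0) ((prepare m ;; coloringLoop).compile 1)

/-- A bound on the running time of the algorithm. -/
noncomputable def runningTime (m K : ℕ) : Polynomial ℕ :=
  (clockProg K).cost + (prepare m ;; coloringLoop).cost.comp ((Polynomial.X + 2) ^ K) +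
    (Polynomial.X + 2) ^ K * (Polynomial.X + 2) ^ K

/-- The final state of the algorithm. -/
noncomputable def finalState (m K : ℕ) (G : SimpleGraph (Fin n)) (ω : ℕ → Bool) : State :=
  den ω 1 (prepare m ;; coloringLoop) (den ω 0 (clockProg K) (inputState G))

theorem run_algorithm (m K : ℕ) (G : SimpleGraph (Fin n)) (ω : ℕ → Bool) :
    ∃ t ≤ (runningTime m K).eval n,
      Run ω (algorithm m K) (inputState G) t (finalState m K G ω) := by
  obtain ⟨t₁, ht₁, h₁⟩ := exists_run (ω := ω) (wf_clockProg K) (vars_clockProg K) (inputState G)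
  have hwf : (prepare m ;; coloringLoop).wf = true := by
    simp only [wf, wf_prepare, Bool.true_and]
    decide
  have hvars : 1 ∉ (prepare m ;; coloringLoop).vars := by
    simp only [vars, List.mem_append, not_or]
    exact ⟨vars_prepare m, by decide⟩
  obtain ⟨t₂, ht₂, h₂⟩ := exists_run (ω := ω) hwf hvars (den ω 0 (clockProg K) (inputState G))
  refine ⟨t₁ + t₂, ?_, .seq h₁ h₂⟩
  -- The second phase is clocked by `(n + 2) ^ K`, hence the composition of polynomials in
  -- `runningTime`.
  rw [(den_clockProg K (n := n) (by rfl)).1] at ht₂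
  have : (inputState G).var 0 = n := rfl
  rw [this] at ht₁
  simp only [runningTime, Polynomial.eval_add, Polynomial.eval_comp, Polynomial.eval_mul,
    Polynomial.eval_pow, Polynomial.eval_X, Polynomial.eval_ofNat]
  omega

theorem haltsWithin_algorithm (m K : ℕ) (G : SimpleGraph (Fin n)) :
    HaltsWithin (algorithm m K) G ((runningTime m K).eval n) := fun ω =>
  let ⟨t, ht, h⟩ := run_algorithm m K G ω
  ⟨t, _, ht, h⟩

/-- Maximum degree 0 is treated apart: `D ≤ 3 * Δ` fails there, but without edges no color is used.
-/
theorem ncard_image_le_rpow [DecidableRel G.Adj] {D m b y : ℕ} {ε : ℝ} {F : Sym2 (Fin n) → ℕ}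
    (hm : 1 ≤ m) (hε : 1 ≤ ε * m) (hD : D ≤ G.maxDegree + 2) (hb : 2 ^ b = 4 * y)
    (hy : (2 * y) ^ m ≤ 64 ^ m * D ^ (2 * m + 1)) (hF : (F '' G.edgeSet).ncard ≤ 2 ^ b) :
    ((F '' G.edgeSet).ncard : ℝ) ≤ 3456 * (G.maxDegree : ℝ) ^ (2 + ε) := by
  rcases Nat.eq_zero_or_pos G.maxDegree with h | h
  · have : G.edgeSet = ∅ := by
      rw [Set.eq_empty_iff_forall_notMem]
      intro e
      induction e with
      | _ u v =>
        intro he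
        have h1 : 0 < G.degree u := (G.degree_pos_iff_exists_adj u).2 ⟨v, he⟩
        have h2 := G.degree_le_maxDegree u
        omega
    rw [this]
    simp only [Set.image_empty, Set.ncard_empty, Nat.cast_zero]
    positivity
  · refine le_trans ?_ (palette_le_rpow hm hε h hD hy)
    rw [hb] at hF
    exact_mod_cast hF

theorem failureProb_le_one (P : Cmd) (T : ℕ) (Good : (Sym2 (Fin n) → ℕ) → Prop) :
    failureProb P G T Good ≤ 1 := by
  rw [failureProb, div_le_one (by positivity)]
  have h := Set.ncard_le_card {r : Fin T → Bool | ¬ ∃ (t : ℕ) (s : State), t ≤ T ∧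
      Run (coins r) P (inputState G) t s ∧ Good (outputColoring n s)}
  simp only [Nat.card_eq_fintype_card, Fintype.card_pi, Fintype.card_bool, Finset.prod_const,
    Finset.card_univ, Fintype.card_fin] at h
  exact_mod_cast h

theorem failureProb_algorithm_le [NeZero n] [DecidableRel G.Adj] {m k K : ℕ} {ε : ℝ} (hm : 1 ≤ m)
    (hε : 1 ≤ ε * m) (hK : 8 * m + 5 ≤ K) (hkK : k + 2 ≤ K) :
    (n : ℝ) ^ k * failureProb (algorithm m K) G ((runningTime m K).eval n) (fun f =>
      IsNonrepetitive G f ∧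
        ((f '' G.edgeSet).ncard : ℝ) ≤ 3456 * (G.maxDegree : ℝ) ^ (2 + ε)) ≤ 1 := by
  set T := (runningTime m K).eval n with hT
  obtain ⟨c1, c0, ca, cf⟩ := den_clockProg (ω := fun _ => false) K (n := n) (s := inputState G) rfl
  have hclock : ∀ ω, den ω 0 (clockProg K) (inputState G) =
      den (fun _ => false) 0 (clockProg K) (inputState G) :=
    fun ω => by rw [den_eq_of_flipless (flipless_clockProg K)]
  obtain ⟨nb, D, R, b, y, hS, hC, hnb, hB, hΔD, hDΔ, hy, hyR, hby, hym⟩ :=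
    exists_setup (ω := fun _ => false) hm hK c0 c1 ca
  set s₁ := den (fun _ => false) 0 (clockProg K) (inputState G) with hs₁
  have hfl : (den (fun _ => false) 1 (prepare m) s₁).flips = 0 := by
    rw [den_flips (flipless_prepare m), cf]; rfl
  set s₂ := den (fun _ => false) 1 (prepare m) s₁ with hs₂
  have hfinal : ∀ ω, finalState m K G ω = den ω 1 coloringLoop s₂ := by
    intro ω
    rw [finalState, hclock, den_seq, den_eq_of_flipless (flipless_prepare m) (fun _ => false)]
  -- The last summand of `runningTime` is there for this purpose: as `b ≤ (n + 2) ^ K`, all coins of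
  -- the process fit into a string of length `T`.
  obtain ⟨s, hs⟩ : ∃ s, T = b * (n + 2) ^ K + s := by
    refine Nat.exists_eq_add_of_le (le_trans (Nat.mul_le_mul_right _ hS.hb) ?_)
    simp only [hT, runningTime, Polynomial.eval_add, Polynomial.eval_mul,
      Polynomial.eval_pow, Polynomial.eval_X, Polynomial.eval_ofNat]
    omega
  have hcard := card_unfinished_le (nb := nb) (B := (n + 2) ^ K) hS.hR hΔD hS.hD hy hyR hby hs
  set bad := Finset.univ.filter fun r : Fin T → Bool => nextEdge G (dom (process (nextEdge G)
      (resolve nb D R ((n + 2) ^ K)) b ((n + 2) ^ K) (coins r) 0)) ≠ none with hbad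
  have hsub : {r : Fin T → Bool | ¬ ∃ (t : ℕ) (s : State), t ≤ T ∧
      Run (coins r) (algorithm m K) (inputState G) t s ∧
        (IsNonrepetitive G (outputColoring n s) ∧
          ((outputColoring n s '' G.edgeSet).ncard : ℝ) ≤
            3456 * (G.maxDegree : ℝ) ^ (2 + ε))} ⊆ bad := by
    intro r hr
    by_contra hrb
    refine hr ?_
    obtain ⟨t, ht, hrun⟩ := run_algorithm m K G (coins r)
    have hcol := den_coloringLoop (ω := coins r) hS hC
    rw [hfl] at hcol
    simp only [zero_add] at hcol
    rw [← hfinal] at hcol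
    simp only [hbad, Finset.coe_filter, Finset.mem_univ, true_and, Set.mem_ofPred_eq, ne_eq,
      not_not] at hrb
    obtain ⟨g1, g2⟩ := process_good hS.hR hS.hD hnb hB rfl hrb
    refine ⟨t, _, ht, hrun, ?_⟩
    rw [outputColoring_eq hcol]
    exact ⟨g1, ncard_image_le_rpow hm hε hDΔ hby hym g2⟩
  have hle := Set.ncard_le_ncard hsub bad.finite_toSet
  rw [Set.ncard_coe_finset] at hle
  have hmain : n ^ k * bad.card ≤ 2 ^ T := by
    refine Nat.le_of_mul_le_mul_right (c := 2 ^ (n + 2) ^ K) ?_ (by positivity)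
    calc n ^ k * bad.card * 2 ^ (n + 2) ^ K = n ^ k * (bad.card * 2 ^ (n + 2) ^ K) := by ring
      _ ≤ n ^ k * (4 ^ G.edgeFinset.card * 2 ^ T) := Nat.mul_le_mul_left _ hcard
      _ = n ^ k * 4 ^ G.edgeFinset.card * 2 ^ T := by ring
      _ ≤ 2 ^ (n + 2) ^ K * 2 ^ T := Nat.mul_le_mul_right _ (failure_le hkK G)
      _ = 2 ^ T * 2 ^ (n + 2) ^ K := mul_comm _ _
  rw [failureProb, ← mul_div_assoc, div_le_one (by positivity)]
  exact_mod_cast (Nat.mul_le_mul_left _ hle).trans hmain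

end Prog

end RandRAM

/-- There is an absolute constant `c` such that for every `ε > 0` and every exponent `k` there is a
randomized polynomial-time algorithm that, on every graph `G` with `n` vertices and maximum degree
`Δ`, outputs, except with probability at most `n ^ (-k)`, a non-repetitive edge coloring of `G`
with at most `c * Δ ^ (2 + ε)` colors. -/
theorem mainTheorem6 :
    ∃ c : ℝ, 0 < c ∧ ∀ ε : ℝ, 0 < ε → ∀ k : ℕ,
      ∃ (P : RandRAM.Cmd) (time : Polynomial ℕ),
        ∀ (n : ℕ) (G : SimpleGraph (Fin n)) [DecidableRel G.Adj],
          RandRAM.HaltsWithin P G (time.eval n) ∧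
          (n : ℝ) ^ k * RandRAM.failureProb P G (time.eval n) (fun f =>
            IsNonrepetitive G f ∧
              ((f '' G.edgeSet).ncard : ℝ) ≤ c * (G.maxDegree : ℝ) ^ (2 + ε)) ≤ 1 := by

  refine ⟨3456, by norm_num, fun ε hε k => ?_⟩
  -- The palette has order `D ^ (2 + 1 / m)`, so `1 / m` has to be at most `ε`.
  obtain ⟨m, hm⟩ := exists_nat_gt (1 / ε)
  have hm0 : (0 : ℝ) < m := lt_trans (by positivity) hm
  have hm1 : 1 ≤ m := by exact_mod_cast hm0
  have hεm : 1 ≤ ε * m := by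
    rw [div_lt_iff₀ hε, mul_comm] at hm
    exact hm.le
  refine ⟨RandRAM.Prog.algorithm m (8 * m + k + 8), RandRAM.Prog.runningTime m (8 * m + k + 8),
    fun n G _ => ⟨RandRAM.Prog.haltsWithin_algorithm _ _ G, ?_⟩⟩
  -- For `n = 0` the bound is void: `0 ^ k ≤ 1`, and a probability is at most 1.
  rcases Nat.eq_zero_or_pos n with rfl | hn
  · refine (mul_le_of_le_one_right (by positivity) (RandRAM.Prog.failureProb_le_one _ _ _)).trans ?_
    exact pow_le_one₀ (by simp) (by simp)
  · have : NeZero n := ⟨hn.ne'⟩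
    exact RandRAM.Prog.failureProb_algorithm_le hm1 hεm (by omega) (by omega)
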